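/- Let $d\ge 1$, $s\ge 0$ be integers, $T>0$, $\Lambda=(0,2\pi)^d$, $D_T=\Lambda\times(0,T)$, and $\|\partial^s\phi\|^2=\sum_{|\alpha|=s}\|\partial^\alpha\phi\|^2$ (for vector valued $\phi$ also summed over the components). **Data.** Let $\mu=\mu_s+\mu_n$ be nonnegative measures on $\mathbb R^d$ with $\int_{|z|>0}|z|^2\wedge 1\,d\mu<\infty$, $\mu_s(-B)=\mu_s(B)$ for all Borel sets $B\subseteq\mathbb R^d\setminus\{0\}$, and $\int_{|z|>0}|z|\wedge 1\,d\mu_n<\infty$. Put $$\mathcal L^\mu[\phi](x)=\int_{|z|>0}\phi(x+z)-\phi(x)-z\cdot\partial\phi(x)\mathbf 1_{|z|<1}\,d\mu(z),\qquad G^{\mu}(\xi)=\int_{|z|>0}e^{i\xi\cdot z}-1-i\xi\cdot z\,\mathbf 1_{|z|<1}\,d\mu(z).$$ Let $u_0\in L^\infty(\Lambda)\cap BV(\Lambda)$ be $2\pi$-periodic in each coordinate and let $f=(f_1,\dots,f_d)$ with $f_j\in C^{s+1}(\mathbb R)$. **Method.** Let $0<\theta<1$, $\epsilon_N\sim N^{-\theta}$,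 $m_N\sim N^{\theta/2}(\log N)^{-d/2}$ as $N\to\infty$, with $\epsilon_Nm_N^2(\log N)^d\le C$ for $N\ge 2$. Let $Q_N^{j,k}(x,t)=\sum_{m_N\le|\xi|\le N}\hat Q_{N,|\xi|}^{j,k}(t)e^{i\xi\cdot x}$ with real $\hat Q^{j,k}_{N,p}(t)$ nondecreasing in $p\in[m_N,N]$ and $|\hat Q^{j,k}_{N,p}-\delta_{jk}|\le C m_N^2p^{-2}$ there, with $C$ independent of $N\ge2$ and $t\in[0,T]$. Here $|\xi|$ is the Euclidean length of $\xi\in\mathbb Z^d$. Let $P_N$ be the Fourier projection onto $|\xi|\le N$, let $*$ be the convolution of periodic functions normalized by $(2\pi)^{-d}$, and for $N\ge2$ let $u_N(x,t)=\sum_{|\xi|\le N}\hat u_\xi(t)e^{i\xi\cdot x}$ be a real solution on $[0,T]$ of $$\partial_tu_N+\partial_x\cdot P_Nf(u_N)=\mathcal L^\mu[u_N]+\epsilon_N\sum_{j,k=1}^d\partial_j\partial_kQ_N^{j,k}*u_N,\qquad u_N(\cdot,0)=P_Nu_0 .$$ **The constants $\mathcal K_k$.** For $1\le k\le s+1$ let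 $\mathcal K_k=\mathcal K_k(f,u_N)$ be the least constant with $\|\partial^kf(u_N(\cdot,t))\|_{L^2(\Lambda)}\le\mathcal K_k\|\partial^ku_N(\cdot,t)\|_{L^2(\Lambda)}$ for all $t\in[0,T]$. **Theorem.** 1. There is $C_n$ with $|G^{\mu_n}(\xi)|\le C_n(1+|\xi|)$ for all $\xi\in\mathbb R^d$ (the integral being absolutely convergent). 2. The $\mathcal K_k$ exist, and with a constant $C$ that depends only on $d$ and $s$, $$\mathcal K_k\le C\sum_{j=1}^k|f|_{C^j}\|u_N\|_{L^\infty(D_T)}^{j-1},\qquad |f|_{C^j}=\sup_{|v|\le\|u_N\|_{L^\infty(D_T)}}|f^{(j)}(v)| .$$ 3. There is a constant $C$, independent of $N\ge2$, $f$ and $u_N$ (it may depend on $d,s,T,\mu,u_0,\theta$ and the sequences $\epsilon_N,m_N,Q_N$), such that whenever $$\epsilon_N>\frac{8\,d^{s/2}\,\mathcal K_{s+1}}{N},$$ there is a constant $\tilde{\mathcal B}_s$ with $$\epsilon_N^s\|\partial^su_N(\cdot,t)\|_{L^2(\Lambda)}+\epsilon_N^{s+\frac12}\|\partial^{s+1}u_N\|_{L^2(D_T)}\le\tilde{\mathcal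 B}_s+4\epsilon_N^s\|\partial^su_N(\cdot,0)\|_{L^2(\Lambda)}\qquad\text{for all }t\in[0,T],$$ where $\tilde{\mathcal B}_0\le C\|u_N\|_{L^\infty(D_T)}$ and, for $s\ge1$, both $$\tilde{\mathcal B}_s\le C\Big(1+\prod_{k=1}^s\mathcal K_s\Big)=C\big(1+\mathcal K_s^s\big)\quad\text{and}\quad \tilde{\mathcal B}_s\le C\Big(1+\sum_{j=0}^{s-1}\epsilon_N^j\|\partial^ju_N(\cdot,0)\|_{L^2(\Lambda)}\Big)\prod_{k=1}^s(1+\mathcal K_k).$$ -/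

import Mathlib

open Set Filter MeasureTheory Asymptotics

noncomputable section

namespace SVV

/-- Euclidean space of dimension `d`. -/
abbrev Space (d : ℕ) : Type := EuclideanSpace ℝ (Fin d)

/-- The periodicity cell `Λ = (0, 2π)^d`. -/
def cell (d : ℕ) : Set (Space d) := {x | ∀ i, x i ∈ Ioo 0 (2 * Real.pi)}

/-- `Λ`-periodicity: `2π`-periodic in each coordinate direction. -/
def IsPeriodic {d : ℕ} {F : Type*} (φ : Space d → F) : Prop :=
  ∀ i x, φ (x + EuclideanSpace.single i (2 * Real.pi)) = φ x

/-! ### Derivatives and their `L²` norms -/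

section Derivatives

variable {d : ℕ} {F : Type*} [NormedAddCommGroup F] [NormedSpace ℝ F]

/-- The partial derivative `∂_j φ`. -/
def partialD (j : Fin d) (φ : Space d → F) : Space d → F :=
  fun x => fderiv ℝ φ x (EuclideanSpace.single j 1)

/-- The derivative `∂^α φ = ∂_1^{α_1} ⋯ ∂_d^{α_d} φ`. -/
def multiD (α : Fin d → ℕ) (φ : Space d → F) : Space d → F :=
  (List.finRange d).foldr (fun j g => (partialD j)^[α j] g) φ

/-- `‖∂^s φ‖²_{L²(Λ)}`, the sum of `‖∂^α φ‖²_{L²(Λ)}` over all multi-indices with `|α| = s`.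
For vector valued `φ` the pointwise norm is the Euclidean one. -/
def derivSq (s : ℕ) (φ : Space d → F) : ℝ :=
  ∑ α ∈ Finset.piAntidiag (Finset.univ : Finset (Fin d)) s, ∫ x in cell d, ‖multiD α φ x‖ ^ 2

/-- `‖∂^s φ‖_{L²(Λ)}`. -/
def derivNorm (s : ℕ) (φ : Space d → F) : ℝ := √(derivSq s φ)

/-- `‖∂^s u‖_{L²(D_T)}` with `D_T = Λ × (0,T)`; the time variable of `u` comes first. -/
def derivNormDT (T : ℝ) (s : ℕ) (u : ℝ → Space d → F) : ℝ :=
  √(∫ t in Ioo 0 T, derivSq s (u t))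

end Derivatives

/-! ### Functions of bounded variation -/

/-- `u ∈ BV(Λ)`: `u ∈ L¹(Λ)`, and `∫_Λ u div φ` is bounded over the `C¹` vector fields `φ` that have
compact support in `Λ` and satisfy `|φ| ≤ 1`. -/
def IsBV {d : ℕ} (u : Space d → ℝ) : Prop :=
  IntegrableOn u (cell d) ∧
  ∃ V : ℝ, ∀ φ : Space d → Space d, ContDiff ℝ 1 φ → HasCompactSupport φ → tsupport φ ⊆ cell d →
    (∀ x, ‖φ x‖ ≤ 1) → ∫ x in cell d, u x * ∑ j, partialD j (fun y => φ y j) x ≤ V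

/-! ### Lévy measures, the nonlocal operator and its symbol -/

section Levy

variable {d : ℕ}

/-- `∫_{|z|>0} |z|² ∧ 1 dμ(z) < ∞`. (Such a measure is finite on the sets `{|z| ≥ r}`, `r > 0`, hence
is a Radon measure on `ℝ^d ∖ {0}`; what it does at the origin plays no role.) -/
def IsLevyMeasure (μ : Measure (Space d)) : Prop :=
  ∫⁻ z in {0}ᶜ, ENNReal.ofReal (min (‖z‖ ^ 2) 1) ∂μ < ⊤

/-- `∫_{|z|>0} |z| ∧ 1 dμ(z) < ∞`. -/
def HasFirstMoment (μ : Measure (Space d)) : Prop :=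
  ∫⁻ z in {0}ᶜ, ENNReal.ofReal (min ‖z‖ 1) ∂μ < ⊤

/-- `μ(-B) = μ(B)` for all Borel sets `B ⊆ ℝ^d ∖ {0}`. -/
def IsSymmetricMeasure (μ : Measure (Space d)) : Prop :=
  ∀ B : Set (Space d), MeasurableSet B → B ⊆ {0}ᶜ → μ ((fun z => -z) ⁻¹' B) = μ B

/-- `𝓛^μ[φ](x) = ∫_{|z|>0} φ(x+z) - φ(x) - z·∂φ(x) 1_{|z|<1} dμ(z)`. -/
def levyOp (μ : Measure (Space d)) (φ : Space d → ℝ) (x : Space d) : ℝ :=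
  ∫ z in {0}ᶜ, (φ (x + z) - φ x - if ‖z‖ < 1 then fderiv ℝ φ x z else 0) ∂μ

/-- The integrand `e^{iξ·z} - 1 - i ξ·z 1_{|z|<1}` of the symbol. -/
def symbolIntegrand (ξ z : Space d) : ℂ :=
  Complex.exp (Complex.I * (inner ℝ ξ z : ℝ)) - 1
    - if ‖z‖ < 1 then Complex.I * (inner ℝ ξ z : ℝ) else 0

/-- The symbol `G^μ(ξ) = ∫_{|z|>0} e^{iξ·z} - 1 - i ξ·z 1_{|z|<1} dμ(z)`. -/
def levySymbol (μ : Measure (Space d)) (ξ : Space d) : ℂ :=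
  ∫ z in {0}ᶜ, symbolIntegrand ξ z ∂μ

end Levy

/-! ### Fourier series -/

section Fourier

variable {d : ℕ}

/-- An integer frequency as a vector of `ℝ^d`. -/
def freqVec (ξ : Fin d → ℤ) : Space d := WithLp.toLp 2 fun i => (ξ i : ℝ)

/-- The frequencies `ξ ∈ ℤ^d` with `|ξ| ≤ N` (Euclidean length). -/
def freqs (d N : ℕ) : Finset (Fin d → ℤ) :=
  (Fintype.piFinset fun _ => Finset.Icc (-(N : ℤ)) N).filter fun ξ => ∑ i, ξ i ^ 2 ≤ (N : ℤ) ^ 2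

theorem mem_freqs {N : ℕ} {ξ : Fin d → ℤ} : ξ ∈ freqs d N ↔ ‖freqVec ξ‖ ≤ N := by
  have h1 : ‖freqVec ξ‖ ≤ N ↔ ∑ i, ξ i ^ 2 ≤ (N : ℤ) ^ 2 := by
    rw [← abs_of_nonneg (norm_nonneg (freqVec ξ)), ← abs_of_nonneg (Nat.cast_nonneg (α := ℝ) N),
      ← sq_le_sq, EuclideanSpace.norm_sq_eq]
    simp only [freqVec, Real.norm_eq_abs, sq_abs]
    exact_mod_cast Iff.rfl
  rw [h1]
  simp only [freqs, Finset.mem_filter, Fintype.mem_piFinset, Finset.mem_Icc, and_iff_right_iff_imp]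
  intro h i
  have h2 : ξ i ^ 2 ≤ (N : ℤ) ^ 2 :=
    (Finset.single_le_sum (f := fun i => ξ i ^ 2) (fun j _ => sq_nonneg _)
      (Finset.mem_univ i)).trans h
  exact abs_le.1 (abs_le_of_sq_le_sq h2 (by positivity))

/-- `e^{iξ·x}`. -/
def expWave (ξ : Fin d → ℤ) (x : Space d) : ℂ :=
  Complex.exp (Complex.I * (inner ℝ (freqVec ξ) x : ℝ))

/-- The Fourier coefficient `(2π)^{-d} ∫_Λ φ(x) e^{-iξ·x} dx`. -/
def fourierCoefficient (φ : Space d → ℂ) (ξ : Fin d → ℤ) : ℂ :=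
  ((2 * Real.pi : ℝ) ^ d : ℂ)⁻¹ * ∫ x in cell d, φ x * expWave (-ξ) x

/-- The Fourier projection `P_N φ`. -/
def fourierProj (N : ℕ) (φ : Space d → ℂ) (x : Space d) : ℂ :=
  ∑ ξ ∈ freqs d N, fourierCoefficient φ ξ * expWave ξ x

/-- Convolution of periodic functions, `(2π)^{-d} ∫_Λ K(x-y) φ(y) dy`, so normalized that the Fourier
coefficients are multiplied. -/
def periodicConv (K φ : Space d → ℂ) (x : Space d) : ℂ :=
  ((2 * Real.pi : ℝ) ^ d : ℂ)⁻¹ * ∫ y in cell d, K (x - y) * φ y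

end Fourier

/-! ### The spectral vanishing viscosity approximation -/

section Scheme

variable {d : ℕ}

/-- The kernel `∑_{m ≤ |ξ| ≤ N} q(|ξ|) e^{iξ·x}` with the radial Fourier coefficients `q`. -/
def viscosityKernel (N : ℕ) (m : ℝ) (q : ℝ → ℝ) (x : Space d) : ℂ :=
  ∑ ξ ∈ (freqs d N).filter (fun ξ => m ≤ ‖freqVec ξ‖), (q ‖freqVec ξ‖ : ℂ) * expWave ξ x

/-- The assumptions on the parameters of the method. The amplitude is `ε N`, the viscosity-free
spectrum is `m N`, and `Q N j k p t` is the Fourier coefficient of the kernel `Q_N^{j,k}(·,t)` at the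
frequencies with `|ξ| = p`. -/
structure IsSVVParameters (d : ℕ) (T θ : ℝ) (ε m : ℕ → ℝ)
    (Q : ℕ → Fin d → Fin d → ℝ → ℝ → ℝ) : Prop where
  theta_pos : 0 < θ
  theta_lt_one : θ < 1
  amplitude : ε =Θ[atTop] fun N : ℕ => (N : ℝ) ^ (-θ)
  spectrum : m =Θ[atTop] fun N : ℕ => (N : ℝ) ^ (θ / 2) * Real.log N ^ (-(d : ℝ) / 2)
  kernel_mono : ∀ N, 2 ≤ N → ∀ j k, ∀ t ∈ Icc 0 T,
    MonotoneOn (fun p => Q N j k p t) (Icc (m N) N)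
  kernel_bound : ∃ C : ℝ, ∀ N, 2 ≤ N → ∀ j k, ∀ t ∈ Icc 0 T, ∀ p ∈ Icc (m N) (N : ℝ),
    |Q N j k p t - if j = k then 1 else 0| ≤ C * m N ^ 2 / p ^ 2

/-- The right-hand side of the semi-discrete equation
`∂_t u = -∂_x·P_N f(u) + 𝓛^μ[u] + ε ∑_{j,k} ∂_j ∂_k Q^{j,k} ∗ u`
at a fixed time, where `v = u(·,t)` and `q j k` are the coefficients of `Q^{j,k}(·,t)`. -/
def svvRHS (N : ℕ) (f : ℝ → Space d) (μ : Measure (Space d)) (ε m : ℝ)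
    (q : Fin d → Fin d → ℝ → ℝ) (v : Space d → ℝ) (x : Space d) : ℂ :=
  -(∑ j, partialD j (fourierProj N fun y => ((f (v y) j : ℝ) : ℂ)) x)
    + (levyOp μ v x : ℂ)
    + (ε : ℂ) * ∑ j, ∑ k,
        partialD j (partialD k (periodicConv (viscosityKernel N m (q j k)) fun y => (v y : ℂ))) x

/-- `u` is a solution on `[0,T]` of the spectral vanishing viscosity approximation with initial value
`P_N u₀`: a real `N`-trigonometric polynomial in space, whose coefficients are continuous on `[0,T]`
and differentiable in `(0,T)`, which satisfies the equation pointwise. -/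
structure IsSVVSolution (N : ℕ) (T : ℝ) (f : ℝ → Space d) (μ : Measure (Space d))
    (u₀ : Space d → ℝ) (ε m : ℝ) (Q : Fin d → Fin d → ℝ → ℝ → ℝ) (u : ℝ → Space d → ℝ) :
    Prop where
  expansion : ∃ c : (Fin d → ℤ) → ℝ → ℂ,
    (∀ ξ ∈ freqs d N, ContinuousOn (c ξ) (Icc 0 T) ∧ DifferentiableOn ℝ (c ξ) (Ioo 0 T)) ∧
    ∀ t ∈ Icc 0 T, ∀ x, (u t x : ℂ) = ∑ ξ ∈ freqs d N, c ξ t * expWave ξ x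
  equation : ∀ t ∈ Ioo 0 T, ∀ x,
    HasDerivAt (fun τ => (u τ x : ℂ)) (svvRHS N f μ ε m (fun j k p => Q j k p t) (u t) x) t
  initial : ∀ x, (u 0 x : ℂ) = fourierProj N (fun y => (u₀ y : ℂ)) x

/-- `‖u‖_{L^∞(D_T)}` for a function that is continuous on `[0,T] × ℝ^d` and periodic in space. -/
def supNormDT (T : ℝ) (u : ℝ → Space d → ℝ) : ℝ :=
  sSup {r | ∃ t ∈ Icc 0 T, ∃ x, r = |u t x|}

/-- `|f|_{C^k} = sup_{|v| ≤ R} |f^{(k)}(v)|`. -/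
def fluxNorm (f : ℝ → Space d) (R : ℝ) (k : ℕ) : ℝ :=
  sSup {r | ∃ v : ℝ, |v| ≤ R ∧ r = ‖iteratedDeriv k f v‖}

/-- The smallest constant `𝒦_k ≥ 0` such that
`‖∂^k f(u(·,t))‖_{L²(Λ)} ≤ 𝒦_k ‖∂^k u(·,t)‖_{L²(Λ)}` for all `t ∈ [0,T]`. -/
def compositionConst (T : ℝ) (f : ℝ → Space d) (u : ℝ → Space d → ℝ) (k : ℕ) : ℝ :=
  sInf {K | 0 ≤ K ∧ ∀ t ∈ Icc 0 T,
    derivNorm k (fun x => f (u t x)) ≤ K * derivNorm k (u t)}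

end Scheme

end SVV

end

/-! Everything is computed on the Fourier side. A solution is a trigonometric polynomial, its
coefficients solve a finite system of ordinary differential equations, and for a nonnegative weight
`W` one follows the energy `∑ W(ξ)|c_ξ|²`. Three effects enter (`energy_balance_le`). The nonlocal
operator multiplies `c_ξ` by a symbol whose real part is `∫ (cos(ξ·z) - 1) dμ ≤ 0`, so it drops out
of every upper bound. The viscosity dissipates at least `ε|ξ|² - R` with `R` independent of `N`,
because the missing viscosity at low frequencies and the deviation of the kernel from the identity
are both of size `ε m²` (`viscosityForm_ge`). The projection in the convection disappears when
tested against a polynomial of degree `N`. The convection is then zero for `W = 1`, being in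
divergence form, and for order `s` Young's inequality gives at most `𝒦_s²/ε ‖∂^s u‖²` plus a quarter
of the viscous dissipation (`convection_sobWeight_le`). Order zero follows by Grönwall and yields a
bound for `ε ∫ ‖∂u‖² dt`. In higher order a growth term `l ‖∂^s u‖²` is split at the frequency `|ξ|²
= 4l/ε` (`mul_sobWeight_le`): the high part is absorbed by the dissipation, the low part is a
multiple of `‖∂u‖²`, which is already integrated in time. With `l = 2R` this gives a bounded
contribution after scaling by `ε^(2s)`. With `l = 2𝒦_s²/ε` it gives `𝒦_s^(2s)`, the square of the
first form of the bound. If instead the convection term is paid for by the dissipation of order `s -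
1`, one gains one factor `𝒦_s` per order, and induction gives the product form. Both hold at once,
so their minimum serves as the constant. The bound for `𝒦_k` is a Moser estimate: after scaling to
`|v| ≤ 1`, the chain rule produces products of derivatives that Hölder-type scaling reduces to `∫
|∂^j v|^(2k/j)`, and these are controlled by `‖∂^k v‖²` through a Gagliardo-Nirenberg inequality
(`exists_wordEnergy_le`). The bound for the symbol of `μn` is the elementary estimate
`norm_symbolIntegrand_le`. -/

noncomputable section

set_option linter.unusedSectionVars false

namespace SVV

/-! ### Integration over the period cell; words of partial derivatives. -/

section PeriodicCalculus

variable {d : ℕ} {F G : Type*} [NormedAddCommGroup F] [NormedSpace ℝ F]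
  [NormedAddCommGroup G] [NormedSpace ℝ G]

theorem cell_eq_preimage (d : ℕ) :
    cell d = (WithLp.ofLp : Space d → (Fin d → ℝ)) ⁻¹'
      (Set.univ.pi fun _ => Ioo (0 : ℝ) (2 * Real.pi)) := by
  ext x; simp [cell]

theorem measurableEmbedding_ofLp (d : ℕ) :
    MeasurableEmbedding (WithLp.ofLp : Space d → (Fin d → ℝ)) :=
  (EuclideanSpace.equiv (Fin d) ℝ).toHomeomorph.measurableEmbedding

theorem volume_cell (d : ℕ) : volume (cell d) = ENNReal.ofReal ((2 * Real.pi) ^ d) := by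
  rw [cell_eq_preimage,
    (PiLp.volume_preserving_ofLp (Fin d)).measure_preimage_emb (measurableEmbedding_ofLp d),
    Real.volume_pi_Ioo]
  simp [ENNReal.ofReal_pow Real.two_pi_pos.le]

instance isFiniteMeasure_restrict_cell (d : ℕ) :
    IsFiniteMeasure (volume.restrict (cell d)) :=
  ⟨by rw [Measure.restrict_apply_univ, volume_cell]; exact ENNReal.ofReal_lt_top⟩

theorem integral_cell_one (d : ℕ) : (∫ _x in cell d, (1 : ℂ)) = ((2 * Real.pi : ℝ) ^ d : ℂ) := by
  rw [setIntegral_const, measureReal_def, volume_cell,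
    ENNReal.toReal_ofReal (by positivity [Real.pi_pos])]
  simp

theorem integrableOn_cell (φ : Space d → F) (hφ : Continuous φ) : IntegrableOn φ (cell d) := by
  have hK : IsCompact ((WithLp.toLp 2 : (Fin d → ℝ) → Space d) ''
      (Set.univ.pi fun _ => Icc (0 : ℝ) (2 * Real.pi))) :=
    (isCompact_univ_pi fun _ => isCompact_Icc).image
      (EuclideanSpace.equiv (Fin d) ℝ).symm.continuous
  refine (hφ.continuousOn.integrableOn_compact hK).mono_set fun x hx => ?_
  exact ⟨WithLp.ofLp x, fun i _ => Ioo_subset_Icc_self (hx i), rfl⟩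

/-- The divergence theorem on the cube for the field `φ e_j`: only the two faces orthogonal to `e_j`
contribute, and they cancel by periodicity. Every integration by parts in space rests on this. -/
theorem integral_partialD_eq_zero (j : Fin d) {φ : Space d → F} (hφ : ContDiff ℝ 1 φ)
    (hper : IsPeriodic φ) : ∫ x in cell d, partialD j φ x = 0 := by
  obtain _ | n := d
  · exact j.elim0
  let L : (Fin (n + 1) → ℝ) ≃L[ℝ] Space (n + 1) := (EuclideanSpace.equiv (Fin (n + 1)) ℝ).symm
  have hL : ∀ x, L x = WithLp.toLp 2 x := fun x => rfl
  have hcont : Continuous (partialD j φ) :=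
    (hφ.continuous_fderiv (by simp)).clm_apply continuous_const
  have key := integral_divergence_of_hasFDerivAt_off_countable' (E := F) (n := n)
    (fun _ => 0) (fun _ => 2 * Real.pi) (fun _ => Real.two_pi_pos.le)
    (fun i => if i = j then φ ∘ L else 0)
    (fun i x => if i = j then (fderiv ℝ φ (L x)).comp (L : (Fin (n + 1) → ℝ) →L[ℝ] _) else 0)
    ∅ countable_empty
    (fun i => by
      by_cases h : i = j
      · simpa [h] using (hφ.continuous.comp L.continuous).continuousOn
      · simp only [h, if_false]; exact continuousOn_const)
    (fun x _ i => by
      by_cases h : i = j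
      · simpa [h] using ((hφ.differentiable (by simp)) (L x)).hasFDerivAt.comp x
          L.hasFDerivAt
      · simp only [h, if_false]; exact hasFDerivAt_const (0 : F) x)
    (by
      apply Continuous.integrableOn_Icc
      refine continuous_finsetSum _ fun i _ => ?_
      by_cases h : i = j
      · simp only [h, if_true]
        exact (((hφ.continuous_fderiv (by simp)).comp L.continuous).clm_comp
          continuous_const).clm_apply continuous_const
      · simp only [h, if_false]
        exact continuous_const)
  have hsum : ∀ x : Fin (n + 1) → ℝ, (∑ i, (if i = j then (fderiv ℝ φ (L x)).comp
      (L : (Fin (n + 1) → ℝ) →L[ℝ] _) else 0) (Pi.single i 1)) = partialD j φ (L x) := by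
    intro x
    rw [Finset.sum_eq_single j (fun i _ h => by simp [h]) (by simp)]
    simp only [if_true, partialD]
    rfl
  simp only [hsum] at key
  have hface : ∀ x : Fin n → ℝ, φ (L (j.insertNth (2 * Real.pi) x)) = φ (L (j.insertNth 0 x)) := by
    intro x
    rw [← hper j (L (j.insertNth 0 x))]
    congr 1
    ext i
    refine Fin.succAboveCases j ?_ (fun k => ?_) i
    · simp [hL]
    · simp [hL, Fin.succAbove_ne]
  rw [Finset.sum_eq_single j (fun i _ h => by simp [h]) (by simp)] at key
  simp only [if_true, Function.comp_def, hface, sub_self] at key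
  rw [← key, cell_eq_preimage]
  have h2 := (PiLp.volume_preserving_ofLp (Fin (n + 1))).setIntegral_preimage_emb
    (measurableEmbedding_ofLp (n + 1)) (fun x => partialD j φ (L x))
    (Set.univ.pi fun _ => Ioo (0 : ℝ) (2 * Real.pi))
  refine h2.trans ?_
  rw [volume_pi]
  exact setIntegral_congr_set Measure.univ_pi_Ioo_ae_eq_Icc

/-! ### Iterated partial derivatives -/

/-- The iterated partial derivative along a word of directions, the first letter being the
outermost derivative. -/
def listD (l : List (Fin d)) (φ : Space d → F) : Space d → F := l.foldr partialD φ

@[simp] theorem listD_nil (φ : Space d → F) : listD [] φ = φ := rfl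

@[simp] theorem listD_cons (j : Fin d) (l : List (Fin d)) (φ : Space d → F) :
    listD (j :: l) φ = partialD j (listD l φ) := rfl

/-- The sorted word with `α j` letters `j`. -/
def wordOf (α : Fin d → ℕ) : List (Fin d) :=
  (List.finRange d).flatMap fun j => List.replicate (α j) j

/-- Words, unlike multi-indices, permit induction one derivative at a time. -/
theorem multiD_eq_listD (α : Fin d → ℕ) (φ : Space d → F) :
    multiD α φ = listD (wordOf α) φ := by
  unfold multiD listD wordOf
  induction List.finRange d with
  | nil => rfl
  | cons j l ih =>
    rw [List.foldr_cons, ih, List.flatMap_cons, List.foldr_append]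
    induction α j with
    | zero => rfl
    | succ n hn => rw [Function.iterate_succ_apply', hn, List.replicate_succ, List.foldr_cons]

theorem length_wordOf (α : Fin d → ℕ) : (wordOf α).length = ∑ j, α j := by
  simp [wordOf, List.length_flatMap, Finset.sum_eq_multiset_sum, Fin.univ_def]

theorem prod_wordOf {R : Type*} [CommMonoid R] (α : Fin d → ℕ) (g : Fin d → R) :
    ((wordOf α).map g).prod = ∏ j, g j ^ α j := by
  rw [wordOf, Finset.prod_eq_multiset_prod, Fin.univ_def]
  simp only [Multiset.map_coe, Multiset.prod_coe]
  induction List.finRange d with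
  | nil => rfl
  | cons j l ih => simp [ih]

theorem length_wordOf_of_mem {α : Fin d → ℕ} {k : ℕ}
    (h : α ∈ Finset.piAntidiag (Finset.univ : Finset (Fin d)) k) : (wordOf α).length = k := by
  rw [length_wordOf]; exact (Finset.mem_piAntidiag.1 h).1

theorem contDiff_partialD {n m : WithTop ℕ∞} (j : Fin d) {φ : Space d → F}
    (hφ : ContDiff ℝ n φ) (h : m + 1 ≤ n) : ContDiff ℝ m (partialD j φ) :=
  (hφ.fderiv_right h).clm_apply contDiff_const

theorem IsPeriodic.partialD {φ : Space d → F} (h : IsPeriodic φ) (j : Fin d) :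
    IsPeriodic (partialD j φ) := by
  intro i x
  have : (fun y => φ (y + EuclideanSpace.single i (2 * Real.pi))) = φ := funext fun y => h i y
  unfold SVV.partialD
  rw [← fderiv_comp_add_right, this]

theorem IsPeriodic.listD {φ : Space d → F} (h : IsPeriodic φ) (l : List (Fin d)) :
    IsPeriodic (listD l φ) := by
  induction l with
  | nil => exact h
  | cons j l ih => exact ih.partialD j

theorem IsPeriodic.comp {φ : Space d → F} (h : IsPeriodic φ) (g : F → G) :
    IsPeriodic (fun x => g (φ x)) := fun i x => congrArg g (h i x)

theorem contDiff_listD (l : List (Fin d)) (n : ℕ) {φ : Space d → F}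
    (hφ : ContDiff ℝ (n + l.length : ℕ) φ) : ContDiff ℝ n (listD l φ) := by
  induction l generalizing n with
  | nil => simpa using hφ
  | cons j l ih =>
    refine contDiff_partialD (n := ((n + 1 : ℕ) : WithTop ℕ∞)) j (ih (n + 1) ?_) (by simp)
    refine hφ.of_le ?_
    simp only [List.length_cons]
    norm_cast
    omega

theorem listD_clm (A : F →L[ℝ] G) (l : List (Fin d)) {φ : Space d → F}
    (hφ : ContDiff ℝ (l.length : ℕ) φ) :
    listD l (fun x => A (φ x)) = fun x => A (listD l φ x) := by
  induction l with
  | nil => rfl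
  | cons j l ih =>
    rw [List.length_cons] at hφ
    rw [listD_cons, ih (hφ.of_le (by norm_cast; omega)), listD_cons]
    have h1 : ContDiff ℝ 1 (listD l φ) := by
      have := contDiff_listD l 1 (φ := φ) (by rw [add_comm]; exact hφ)
      exact_mod_cast this
    funext x
    unfold partialD
    have := (A.hasFDerivAt.comp x ((h1.differentiable (by simp)) x).hasFDerivAt).fderiv
    simp only [Function.comp_def] at this
    rw [this]; rfl

theorem iteratedFDeriv_basis_eq_listD (k : ℕ) {φ : Space d → F} (hφ : ContDiff ℝ k φ)
    (l : Fin k → Fin d) (x : Space d) :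
    iteratedFDeriv ℝ k φ x (fun i => EuclideanSpace.single (l i) 1) =
      listD (List.ofFn l) φ x := by
  induction k generalizing x with
  | zero => simp
  | succ k ih =>
    rw [iteratedFDeriv_succ_apply_left, List.ofFn_succ, listD_cons]
    have h : listD (List.ofFn fun i => l i.succ) φ =
        fun y => iteratedFDeriv ℝ k φ y (fun i => EuclideanSpace.single (l i.succ) 1) := by
      funext y; rw [← ih (hφ.of_le (by norm_cast; omega))]
    rw [h]
    unfold partialD
    have hd : DifferentiableAt ℝ (iteratedFDeriv ℝ k φ) x :=
      (hφ.differentiable_iteratedFDeriv (by norm_cast; omega)) x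
    have := ((ContinuousMultilinearMap.apply ℝ (fun _ : Fin k => Space d) F
      (fun i => EuclideanSpace.single (l i.succ) 1)).hasFDerivAt.comp x hd.hasFDerivAt).fderiv
    simp only [Function.comp_def, ContinuousMultilinearMap.apply_apply] at this
    rw [this]
    rfl

theorem norm_listD_le_iteratedFDeriv (l : List (Fin d)) {φ : Space d → F}
    (hφ : ContDiff ℝ (l.length : ℕ) φ) (x : Space d) :
    ‖listD l φ x‖ ≤ ‖iteratedFDeriv ℝ l.length φ x‖ := by
  have h := iteratedFDeriv_basis_eq_listD l.length hφ l.get x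
  rw [List.ofFn_get] at h
  rw [← h]
  refine (ContinuousMultilinearMap.le_opNorm _ _).trans ?_
  simp

/-- Each argument is expanded in the standard basis and multilinearity is used. With the preceding
lemma this lets chain rule bounds for Fréchet derivatives be used for partial derivatives. -/
theorem norm_iteratedFDeriv_le_sum (k : ℕ) {φ : Space d → F} (hφ : ContDiff ℝ k φ)
    (x : Space d) :
    ‖iteratedFDeriv ℝ k φ x‖ ≤ ∑ l : Fin k → Fin d, ‖listD (List.ofFn l) φ x‖ := by
  refine ContinuousMultilinearMap.opNorm_le_bound (Finset.sum_nonneg fun _ _ => norm_nonneg _)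
    fun v => ?_
  have hv : v = fun i => ∑ j, v i j • (EuclideanSpace.single j 1 : Space d) := by
    funext i
    ext j
    simp [Finset.sum_apply, Pi.single_apply]
  conv_lhs => rw [hv]
  rw [ContinuousMultilinearMap.map_sum, Finset.sum_mul]
  refine (norm_sum_le _ _).trans (Finset.sum_le_sum fun l _ => ?_)
  rw [ContinuousMultilinearMap.map_smul_univ, norm_smul, iteratedFDeriv_basis_eq_listD k hφ,
    mul_comm, norm_prod]
  gcongr with i
  exact PiLp.norm_apply_le (v i) (l i)

end PeriodicCalculus

/-! ### Trigonometric polynomials, Parseval's identity and Sobolev weights. -/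

section TrigPolynomials

variable {d N : ℕ}

/-! ### Exponentials -/

theorem inner_freqVec_single (ξ : Fin d → ℤ) (j : Fin d) (a : ℝ) :
    inner ℝ (freqVec ξ) (EuclideanSpace.single j a) = a * ξ j := by
  simp [EuclideanSpace.inner_single_right, freqVec]

theorem norm_freqVec_sq (ξ : Fin d → ℤ) : ‖freqVec ξ‖ ^ 2 = ∑ j, (ξ j : ℝ) ^ 2 := by
  rw [EuclideanSpace.norm_sq_eq]
  simp [freqVec]

theorem contDiff_expWave {n : WithTop ℕ∞} (ξ : Fin d → ℤ) : ContDiff ℝ n (expWave ξ) := by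
  unfold expWave
  exact (contDiff_const.mul (Complex.ofRealCLM.contDiff.comp
    (contDiff_const.inner ℝ contDiff_id))).cexp

theorem hasFDerivAt_expWave (ξ : Fin d → ℤ) (x : Space d) :
    HasFDerivAt (expWave ξ)
      ((Complex.I * expWave ξ x) • (Complex.ofRealCLM.comp (innerSL ℝ (freqVec ξ)))) x := by
  have h1 : HasFDerivAt (fun y : Space d => ((inner ℝ (freqVec ξ) y : ℝ) : ℂ))
      (Complex.ofRealCLM.comp (innerSL ℝ (freqVec ξ))) x :=
    (Complex.ofRealCLM.comp (innerSL ℝ (freqVec ξ))).hasFDerivAt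
  have h2 : HasFDerivAt (expWave ξ) _ x := (h1.const_mul Complex.I).cexp
  refine h2.congr_fderiv ?_
  ext v
  simp [expWave]
  ring

theorem fderiv_expWave (ξ : Fin d → ℤ) (x z : Space d) :
    fderiv ℝ (expWave ξ) x z = Complex.I * (inner ℝ (freqVec ξ) z : ℝ) * expWave ξ x := by
  rw [(hasFDerivAt_expWave ξ x).fderiv]
  simp
  ring

theorem partialD_expWave (ξ : Fin d → ℤ) (j : Fin d) (x : Space d) :
    partialD j (expWave ξ) x = Complex.I * ξ j * expWave ξ x := by
  rw [partialD, fderiv_expWave, inner_freqVec_single]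
  simp

theorem expWave_add_apply (ξ : Fin d → ℤ) (x y : Space d) :
    expWave ξ (x + y) = expWave ξ x * expWave ξ y := by
  simp [expWave, inner_add_right, mul_add, Complex.exp_add]

theorem expWave_mul (ξ η : Fin d → ℤ) (x : Space d) :
    expWave ξ x * expWave η x = expWave (ξ + η) x := by
  have : freqVec (ξ + η) = freqVec ξ + freqVec η := by ext; simp [freqVec]
  simp [expWave, this, inner_add_left, mul_add, Complex.exp_add]

theorem expWave_zero (x : Space d) : expWave 0 x = 1 := by
  have : freqVec (0 : Fin d → ℤ) = 0 := by ext; simp [freqVec]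
  simp [expWave, this]

theorem expWave_neg (ξ : Fin d → ℤ) (x : Space d) : expWave (-ξ) x = expWave ξ (-x) := by
  have : freqVec (-ξ) = -freqVec ξ := by ext; simp [freqVec]
  simp [expWave, this]

theorem conj_expWave (ξ : Fin d → ℤ) (x : Space d) :
    (starRingEnd ℂ) (expWave ξ x) = expWave (-ξ) x := by
  rw [expWave_neg, expWave, expWave, ← Complex.exp_conj]
  simp

theorem norm_expWave (ξ : Fin d → ℤ) (x : Space d) : ‖expWave ξ x‖ = 1 := by
  rw [expWave, mul_comm, Complex.norm_exp_ofReal_mul_I]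

theorem isPeriodic_expWave (ξ : Fin d → ℤ) : IsPeriodic (expWave ξ) := by
  intro i x
  rw [expWave_add_apply]
  have : expWave ξ (EuclideanSpace.single i (2 * Real.pi)) = 1 := by
    rw [expWave, inner_freqVec_single, Complex.exp_eq_one_iff]
    exact ⟨ξ i, by push_cast; ring⟩
  rw [this, mul_one]

/-- If `ξ j ≠ 0`, the wave is a multiple of its own derivative in direction `j`, whose integral
vanishes. -/
theorem integral_expWave (ξ : Fin d → ℤ) :
    ∫ x in cell d, expWave ξ x = if ξ = 0 then ((2 * Real.pi : ℝ) ^ d : ℂ) else 0 := by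
  split_ifs with h
  · subst h
    simp only [expWave_zero, integral_cell_one]
  · obtain ⟨j, hj⟩ := Function.ne_iff.1 h
    have := integral_partialD_eq_zero j (contDiff_expWave ξ) (isPeriodic_expWave ξ)
    simp only [partialD_expWave] at this
    rw [integral_const_mul] at this
    refine (mul_eq_zero.1 this).resolve_left (mul_ne_zero Complex.I_ne_zero ?_)
    exact_mod_cast hj

theorem two_pi_pow_ne_zero (d : ℕ) : ((2 * Real.pi : ℝ) ^ d : ℂ) ≠ 0 := by
  have := Real.pi_ne_zero
  simp [this]

/-! ### Trigonometric polynomials -/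

/-- The trigonometric polynomial of degree `N` with coefficients `c`. -/
def trigPoly (N : ℕ) (c : (Fin d → ℤ) → ℂ) (x : Space d) : ℂ :=
  ∑ ξ ∈ freqs d N, c ξ * expWave ξ x

theorem contDiff_trigPoly {n : WithTop ℕ∞} (c : (Fin d → ℤ) → ℂ) :
    ContDiff ℝ n (trigPoly N c) :=
  ContDiff.sum fun ξ _ => contDiff_const.mul (contDiff_expWave ξ)

theorem isPeriodic_trigPoly (c : (Fin d → ℤ) → ℂ) : IsPeriodic (trigPoly N c) := by
  intro i x
  exact Finset.sum_congr rfl fun ξ _ => by rw [isPeriodic_expWave ξ i x]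

theorem fderiv_trigPoly (c : (Fin d → ℤ) → ℂ) (x z : Space d) :
    fderiv ℝ (trigPoly N c) x z =
      ∑ ξ ∈ freqs d N, c ξ * (Complex.I * (inner ℝ (freqVec ξ) z : ℝ)) * expWave ξ x := by
  have h : HasFDerivAt (trigPoly N c) (∑ ξ ∈ freqs d N, c ξ • fderiv ℝ (expWave ξ) x) x :=
    HasFDerivAt.fun_sum fun ξ _ => ((contDiff_expWave (n := 1) ξ).differentiable (by simp)
      x).hasFDerivAt.const_mul (c ξ)
  rw [h.fderiv]
  simp [fderiv_expWave, mul_assoc]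

theorem partialD_trigPoly (c : (Fin d → ℤ) → ℂ) (j : Fin d) :
    partialD j (trigPoly N c) = trigPoly N fun ξ => Complex.I * ξ j * c ξ := by
  funext x
  rw [partialD, fderiv_trigPoly, trigPoly]
  refine Finset.sum_congr rfl fun ξ _ => ?_
  rw [inner_freqVec_single]
  push_cast
  ring

theorem listD_trigPoly (c : (Fin d → ℤ) → ℂ) (l : List (Fin d)) :
    listD l (trigPoly N c) = trigPoly N fun ξ => (l.map fun j => Complex.I * ξ j).prod * c ξ := by
  induction l with
  | nil => simp
  | cons j l ih => simp [ih, partialD_trigPoly, mul_assoc]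

/-- Only the coefficients of `g` up to degree `N` are seen, which is why the projection in the flux
costs nothing. Integrability of `g` suffices, so rough initial data are covered. -/
theorem integral_mul_conj_trigPoly (b : (Fin d → ℤ) → ℂ) {g : Space d → ℂ}
    (hg : IntegrableOn g (cell d)) :
    ∫ x in cell d, g x * (starRingEnd ℂ) (trigPoly N b x) =
      ((2 * Real.pi : ℝ) ^ d : ℂ) *
        ∑ ξ ∈ freqs d N, (starRingEnd ℂ) (b ξ) * fourierCoefficient g ξ := by
  simp only [trigPoly, map_sum, map_mul, conj_expWave, Finset.mul_sum]
  rw [integral_finsetSum]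
  · refine Finset.sum_congr rfl fun ξ _ => ?_
    rw [fourierCoefficient]
    have : (fun x => g x * ((starRingEnd ℂ) (b ξ) * expWave (-ξ) x)) =
        fun x => (starRingEnd ℂ) (b ξ) * (g x * expWave (-ξ) x) := by funext x; ring
    rw [this, integral_const_mul]
    field_simp [two_pi_pow_ne_zero d]
  · intro ξ _
    refine Integrable.mul_bdd (c := ‖b ξ‖) hg
      (continuous_const.mul (contDiff_expWave (n := 0) (-ξ)).continuous).aestronglyMeasurable ?_
    exact Eventually.of_forall fun x => by simp [norm_expWave]

theorem fourierCoefficient_trigPoly (c : (Fin d → ℤ) → ℂ) {ξ : Fin d → ℤ}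
    (hξ : ξ ∈ freqs d N) : fourierCoefficient (trigPoly N c) ξ = c ξ := by
  simp only [fourierCoefficient, trigPoly, Finset.sum_mul]
  rw [integral_finsetSum]
  · rw [Finset.sum_eq_single ξ]
    · simp only [mul_assoc, expWave_mul, add_neg_cancel, expWave_zero, integral_const_mul,
        integral_cell_one]
      field_simp [two_pi_pow_ne_zero d]
    · intro η _ hη
      simp only [mul_assoc, expWave_mul, integral_const_mul, integral_expWave]
      rw [if_neg fun h => hη (add_neg_eq_zero.1 h), mul_zero]
    · exact fun h => absurd hξ h
  · exact fun η _ => integrableOn_cell _ ((continuous_const.mul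
      (contDiff_expWave (n := 0) _).continuous).mul (contDiff_expWave (n := 0) _).continuous)

theorem integral_norm_sq_trigPoly (c : (Fin d → ℤ) → ℂ) :
    ∫ x in cell d, ‖trigPoly N c x‖ ^ 2 =
      (2 * Real.pi) ^ d * ∑ ξ ∈ freqs d N, ‖c ξ‖ ^ 2 := by
  have h := integral_mul_conj_trigPoly (N := N) c
    (integrableOn_cell _ (contDiff_trigPoly (N := N) (n := 0) c).continuous)
  have h1 : ∀ z : ℂ, z * (starRingEnd ℂ) z = ((‖z‖ ^ 2 : ℝ) : ℂ) := fun z => by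
    rw [Complex.mul_conj, Complex.normSq_eq_norm_sq]
  simp only [h1] at h
  rw [integral_complex_ofReal] at h
  have h2 : ∑ ξ ∈ freqs d N, (starRingEnd ℂ) (c ξ) * fourierCoefficient (trigPoly N c) ξ =
      ((∑ ξ ∈ freqs d N, ‖c ξ‖ ^ 2 : ℝ) : ℂ) := by
    push_cast
    refine Finset.sum_congr rfl fun ξ hξ => ?_
    rw [fourierCoefficient_trigPoly c hξ, mul_comm, h1]
    push_cast; rfl
  rw [h2] at h
  exact_mod_cast h

theorem fourierCoefficient_partialD (j : Fin d) {φ : Space d → ℂ} (hφ : ContDiff ℝ 1 φ)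
    (hper : IsPeriodic φ) (ξ : Fin d → ℤ) :
    fourierCoefficient (partialD j φ) ξ = Complex.I * ξ j * fourierCoefficient φ ξ := by
  have hdiff := hφ.differentiable (by simp)
  have he : ContDiff ℝ 1 (expWave (-ξ)) := contDiff_expWave _
  have hprod := integral_partialD_eq_zero j (hφ.mul he) (fun i x => by
    rw [hper i x, isPeriodic_expWave (-ξ) i x])
  have h1 : ∀ x, partialD j (fun y => φ y * expWave (-ξ) y) x =
      partialD j φ x * expWave (-ξ) x - (Complex.I * ξ j) * (φ x * expWave (-ξ) x) := by
    intro x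
    have h2 := partialD_expWave (-ξ) j x
    unfold partialD at h2 ⊢
    rw [fderiv_fun_mul (hdiff x) (he.differentiable (by simp) x)]
    simp [h2]
    ring
  simp only [h1] at hprod
  rw [integral_sub, integral_const_mul, sub_eq_zero] at hprod
  · rw [fourierCoefficient, hprod, fourierCoefficient]; ring
  · exact integrableOn_cell _ (((contDiff_partialD (m := 0) j hφ (by simp)).continuous).mul
      he.continuous)
  · exact (integrableOn_cell _ (hφ.continuous.mul he.continuous)).const_mul _

theorem fourierCoefficient_listD (l : List (Fin d)) {φ : Space d → ℂ}
    (hφ : ContDiff ℝ (l.length : ℕ) φ) (hper : IsPeriodic φ) (ξ : Fin d → ℤ) :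
    fourierCoefficient (listD l φ) ξ =
      (l.map fun j => Complex.I * ξ j).prod * fourierCoefficient φ ξ := by
  induction l with
  | nil => simp
  | cons j l ih =>
    rw [List.length_cons] at hφ
    have h1 := contDiff_listD l 1 (φ := φ) (by rw [add_comm]; exact hφ)
    rw [listD_cons, fourierCoefficient_partialD j (by exact_mod_cast h1) (hper.listD l),
      ih (hφ.of_le (by norm_cast; omega)), List.map_cons, List.prod_cons, mul_assoc, mul_assoc,
      mul_assoc]

/-! ### Real trigonometric polynomials -/

/-- The real function `v` is the trigonometric polynomial with coefficients `c`. -/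
def IsTrigPoly (N : ℕ) (c : (Fin d → ℤ) → ℂ) (v : Space d → ℝ) : Prop :=
  ∀ x, (v x : ℂ) = trigPoly N c x

theorem IsTrigPoly.eq_re {c : (Fin d → ℤ) → ℂ} {v : Space d → ℝ} (h : IsTrigPoly N c v) :
    v = fun x => Complex.reCLM (trigPoly N c x) := by
  funext x
  rw [← h x]; simp

theorem IsTrigPoly.contDiff {n : WithTop ℕ∞} {c : (Fin d → ℤ) → ℂ} {v : Space d → ℝ}
    (h : IsTrigPoly N c v) : ContDiff ℝ n v := by
  rw [h.eq_re]
  exact Complex.reCLM.contDiff.comp (contDiff_trigPoly c)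

theorem IsTrigPoly.isPeriodic {c : (Fin d → ℤ) → ℂ} {v : Space d → ℝ}
    (h : IsTrigPoly N c v) : IsPeriodic v := by
  rw [h.eq_re]
  exact (isPeriodic_trigPoly c).comp _

theorem IsTrigPoly.listD {c : (Fin d → ℤ) → ℂ} {v : Space d → ℝ} (h : IsTrigPoly N c v)
    (l : List (Fin d)) :
    IsTrigPoly N (fun ξ => (l.map fun j => Complex.I * ξ j).prod * c ξ) (listD l v) := by
  intro x
  have h1 := listD_clm Complex.ofRealCLM l (h.contDiff (n := l.length))
  have h2 : (fun x => Complex.ofRealCLM (v x)) = trigPoly N c := funext h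
  rw [h2, listD_trigPoly] at h1
  exact (congrFun h1 x).symm

theorem IsTrigPoly.fderiv_apply {c : (Fin d → ℤ) → ℂ} {v : Space d → ℝ}
    (h : IsTrigPoly N c v) (x z : Space d) :
    ((fderiv ℝ v x z : ℝ) : ℂ) = fderiv ℝ (trigPoly N c) x z := by
  have h2 : (fun x => Complex.ofRealCLM (v x)) = trigPoly N c := funext h
  rw [← h2]
  have := (Complex.ofRealCLM.hasFDerivAt.comp x
    ((h.contDiff (n := 1)).differentiable (by simp) x).hasFDerivAt).fderiv
  simp only [Function.comp_def] at this
  rw [this]; rfl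

theorem IsTrigPoly.integral_sq {c : (Fin d → ℤ) → ℂ} {v : Space d → ℝ} (h : IsTrigPoly N c v) :
    ∫ x in cell d, ‖v x‖ ^ 2 = (2 * Real.pi) ^ d * ∑ ξ ∈ freqs d N, ‖c ξ‖ ^ 2 := by
  rw [← integral_norm_sq_trigPoly]
  simp only [← h _, Complex.norm_real]

/-- The Fourier weight `∑_{|α| = s} ξ^{2α}` of `‖∂^s ·‖²`. -/
def sobWeight (s : ℕ) (ξ : Fin d → ℤ) : ℝ :=
  ∑ α ∈ Finset.piAntidiag (Finset.univ : Finset (Fin d)) s, ∏ j, ((ξ j : ℝ) ^ 2) ^ α j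

theorem norm_prod_wave (ξ : Fin d → ℤ) (l : List (Fin d)) :
    ‖(l.map fun j => Complex.I * (ξ j : ℂ)).prod‖ ^ 2 = (l.map fun j => (ξ j : ℝ) ^ 2).prod := by
  induction l with
  | nil => simp
  | cons j l ih =>
    rw [List.map_cons, List.prod_cons, norm_mul, mul_pow, ih, List.map_cons, List.prod_cons]
    simp

theorem IsTrigPoly.derivSq_eq {c : (Fin d → ℤ) → ℂ} {v : Space d → ℝ} (h : IsTrigPoly N c v)
    (s : ℕ) :
    derivSq s v = (2 * Real.pi) ^ d * ∑ ξ ∈ freqs d N, sobWeight s ξ * ‖c ξ‖ ^ 2 := by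
  simp only [derivSq, multiD_eq_listD, (h.listD _).integral_sq, ← Finset.mul_sum]
  rw [Finset.sum_comm]
  congr 1
  refine Finset.sum_congr rfl fun ξ _ => ?_
  rw [sobWeight, Finset.sum_mul]
  refine Finset.sum_congr rfl fun α _ => ?_
  rw [norm_mul, mul_pow, norm_prod_wave, prod_wordOf]

theorem sobWeight_nonneg (s : ℕ) (ξ : Fin d → ℤ) : 0 ≤ sobWeight s ξ :=
  Finset.sum_nonneg fun _ _ => Finset.prod_nonneg fun _ _ => by positivity

theorem sobWeight_zero (ξ : Fin d → ℤ) : sobWeight 0 ξ = 1 := by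
  simp [sobWeight]

/-- Every multi-index of order `s + 1` arises from one of order `s` by raising an entry. It may
arise in several ways, so the right side overcounts and only an inequality holds. -/
theorem sobWeight_succ_le (s : ℕ) (ξ : Fin d → ℤ) :
    sobWeight (s + 1) ξ ≤ ‖freqVec ξ‖ ^ 2 * sobWeight s ξ := by
  have hp : ∀ α : Fin d → ℕ, 0 ≤ ∏ j, ((ξ j : ℝ) ^ 2) ^ α j :=
    fun α => Finset.prod_nonneg fun _ _ => by positivity
  rw [norm_freqVec_sq, Finset.sum_mul]
  simp only [sobWeight, Finset.mul_sum]
  rw [← Finset.sum_product']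
  have hsub : Finset.piAntidiag (Finset.univ : Finset (Fin d)) (s + 1) ⊆
      (Finset.univ ×ˢ Finset.piAntidiag (Finset.univ : Finset (Fin d)) s).image
        (fun p => p.2 + Pi.single p.1 1) := by
    intro β hβ
    have hsum := (Finset.mem_piAntidiag.1 hβ).1
    obtain ⟨j, -, hj⟩ : ∃ j ∈ (Finset.univ : Finset (Fin d)), β j ≠ 0 := by
      by_contra! hne
      rw [Finset.sum_eq_zero hne] at hsum
      omega
    have hle : (Pi.single j 1 : Fin d → ℕ) ≤ β := by
      intro k
      by_cases hk : k = j
      · subst hk; simp; omega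
      · simp [hk]
    have hadd : β - Pi.single j 1 + Pi.single j 1 = β := tsub_add_cancel_of_le hle
    refine Finset.mem_image.2 ⟨(j, β - Pi.single j 1), ?_, hadd⟩
    refine Finset.mem_product.2 ⟨Finset.mem_univ _, Finset.mem_piAntidiag.2 ⟨?_, by simp⟩⟩
    have h2 : ∑ k, β k = ∑ k, (β - Pi.single j 1 : Fin d → ℕ) k + 1 := by
      conv_lhs => rw [← hadd]
      simp only [Pi.add_apply, Finset.sum_add_distrib]
      simp
    exact Nat.add_right_cancel (h2.symm.trans hsum)
  calc _ ≤ ∑ β ∈ (Finset.univ ×ˢ Finset.piAntidiag (Finset.univ : Finset (Fin d)) s).image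
        (fun p => p.2 + Pi.single p.1 1), ∏ j, ((ξ j : ℝ) ^ 2) ^ β j :=
        Finset.sum_le_sum_of_subset_of_nonneg hsub fun β _ _ => hp β
    _ ≤ ∑ p ∈ Finset.univ ×ˢ Finset.piAntidiag (Finset.univ : Finset (Fin d)) s,
        ∏ j, ((ξ j : ℝ) ^ 2) ^ (p.2 + Pi.single p.1 1 : Fin d → ℕ) j :=
        Finset.sum_image_le_of_nonneg fun β _ => hp β
    _ = _ := by
        refine Finset.sum_congr rfl fun p _ => ?_
        simp only [Pi.add_apply, pow_add, Finset.prod_mul_distrib]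
        rw [mul_comm]
        congr 1
        rw [Finset.prod_eq_single p.1]
        · simp
        · intro k _ hk; simp [hk]
        · simp

theorem sobWeight_le_pow (s : ℕ) (ξ : Fin d → ℤ) : sobWeight s ξ ≤ (‖freqVec ξ‖ ^ 2) ^ s := by
  induction s with
  | zero => simp [sobWeight_zero]
  | succ s ih =>
    refine (sobWeight_succ_le s ξ).trans ?_
    rw [pow_succ' (‖freqVec ξ‖ ^ 2) s]
    exact mul_le_mul_of_nonneg_left ih (sq_nonneg _)

theorem sobWeight_one_le (ξ : Fin d → ℤ) : sobWeight 1 ξ ≤ ‖freqVec ξ‖ ^ 2 := by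
  simpa using sobWeight_le_pow 1 ξ

end TrigPolynomials

/-! ### The nonlocal operator as a Fourier multiplier. -/

section LevyOperator

variable {d N : ℕ}

theorem norm_exp_I_mul_sub_one_le_two (θ : ℝ) : ‖Complex.exp (Complex.I * θ) - 1‖ ≤ 2 := by
  refine (norm_sub_le _ _).trans ?_
  rw [mul_comm, Complex.norm_exp_ofReal_mul_I, norm_one]
  norm_num

/-- Taylor expansion for `|θ| ≤ 1`; beyond that the triangle inequality gives `2|θ| ≤ 2θ²`. -/
theorem norm_exp_I_mul_sub_one_sub_le (θ : ℝ) :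
    ‖Complex.exp (Complex.I * θ) - 1 - Complex.I * θ‖ ≤ 2 * θ ^ 2 := by
  have hn : ‖Complex.I * (θ : ℂ)‖ = |θ| := by simp
  rcases le_or_gt |θ| 1 with h | h
  · refine (Complex.norm_exp_sub_one_sub_id_le (hn.trans_le h)).trans ?_
    rw [hn, sq_abs]
    nlinarith [sq_nonneg θ]
  · refine (norm_sub_le _ _).trans ?_
    have h1 := Real.norm_exp_I_mul_ofReal_sub_one_le (x := θ)
    rw [hn]
    rw [Real.norm_eq_abs] at h1
    nlinarith [sq_abs θ]

theorem measurable_symbolIntegrand (ξ : Space d) : Measurable (symbolIntegrand ξ) := by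
  have h : Measurable fun z : Space d => Complex.I * ((inner ℝ ξ z : ℝ) : ℂ) :=
    (Continuous.measurable (by fun_prop))
  exact (h.cexp.sub_const 1).sub
    (Measurable.ite (measurableSet_lt measurable_norm measurable_const) h measurable_const)

/-- For small jumps the exponential increment and the compensator are each at most `|ξ||z|`; no
cancellation between them is needed. Large jumps are bounded by `2`. -/
theorem norm_symbolIntegrand_le (ξ z : Space d) :
    ‖symbolIntegrand ξ z‖ ≤ 2 * (1 + ‖ξ‖) * min ‖z‖ 1 := by
  have hin := abs_real_inner_le_norm ξ z
  unfold symbolIntegrand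
  split_ifs with h
  · rw [min_eq_left h.le]
    refine (norm_sub_le _ _).trans ?_
    have h1 := Real.norm_exp_I_mul_ofReal_sub_one_le (x := inner ℝ ξ z)
    have h2 : ‖Complex.I * ((inner ℝ ξ z : ℝ) : ℂ)‖ = |inner ℝ ξ z| := by simp
    rw [h2]
    rw [Real.norm_eq_abs] at h1
    nlinarith [norm_nonneg z, norm_nonneg ξ]
  · rw [min_eq_right (not_lt.1 h), sub_zero]
    refine (norm_exp_I_mul_sub_one_le_two _).trans ?_
    nlinarith [norm_nonneg ξ]

theorem norm_symbolIntegrand_le_sq (ξ z : Space d) :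
    ‖symbolIntegrand ξ z‖ ≤ 2 * (1 + ‖ξ‖ ^ 2) * min (‖z‖ ^ 2) 1 := by
  have hin := abs_real_inner_le_norm ξ z
  unfold symbolIntegrand
  split_ifs with h
  · rw [min_eq_left (by nlinarith [norm_nonneg z])]
    refine (norm_exp_I_mul_sub_one_sub_le _).trans ?_
    have h3 : (inner ℝ ξ z : ℝ) ^ 2 ≤ (‖ξ‖ * ‖z‖) ^ 2 := by
      rw [← sq_abs]
      exact pow_le_pow_left₀ (abs_nonneg _) hin 2
    nlinarith [sq_nonneg ‖z‖]
  · rw [min_eq_right (by nlinarith [norm_nonneg z]), sub_zero]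
    refine (norm_exp_I_mul_sub_one_le_two _).trans ?_
    nlinarith [sq_nonneg ‖ξ‖]

theorem HasFirstMoment.integrableOn {μ : Measure (Space d)} (h : HasFirstMoment μ) :
    IntegrableOn (fun z => min ‖z‖ 1) {0}ᶜ μ := by
  refine ⟨(Continuous.aestronglyMeasurable (by fun_prop)), ?_⟩
  rwa [hasFiniteIntegral_iff_ofReal (Eventually.of_forall fun z => by positivity)]

theorem IsLevyMeasure.integrableOn {μ : Measure (Space d)} (h : IsLevyMeasure μ) :
    IntegrableOn (fun z => min (‖z‖ ^ 2) 1) {0}ᶜ μ := by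
  refine ⟨(Continuous.aestronglyMeasurable (by fun_prop)), ?_⟩
  rwa [hasFiniteIntegral_iff_ofReal (Eventually.of_forall fun z => by positivity)]

/-- The symbol of a measure with a finite first moment grows at most linearly. -/
theorem HasFirstMoment.levySymbol_le {μ : Measure (Space d)} (h : HasFirstMoment μ) :
    ∃ C : ℝ, ∀ ξ : Space d, IntegrableOn (symbolIntegrand ξ) {0}ᶜ μ ∧
      ‖levySymbol μ ξ‖ ≤ C * (1 + ‖ξ‖) := by
  refine ⟨2 * ∫ z in {0}ᶜ, min ‖z‖ 1 ∂μ, fun ξ => ⟨?_, ?_⟩⟩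
  · exact (h.integrableOn.const_mul (2 * (1 + ‖ξ‖))).mono'
      (measurable_symbolIntegrand ξ).aestronglyMeasurable
      (Eventually.of_forall fun z => norm_symbolIntegrand_le ξ z)
  · refine (norm_integral_le_of_norm_le (h.integrableOn.const_mul (2 * (1 + ‖ξ‖)))
      (Eventually.of_forall fun z => norm_symbolIntegrand_le ξ z)).trans ?_
    rw [integral_const_mul]
    apply le_of_eq
    ring

theorem IsLevyMeasure.integrableOn_symbolIntegrand {μ : Measure (Space d)}
    (h : IsLevyMeasure μ) (ξ : Space d) : IntegrableOn (symbolIntegrand ξ) {0}ᶜ μ :=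
  (h.integrableOn.const_mul (2 * (1 + ‖ξ‖ ^ 2))).mono'
    (measurable_symbolIntegrand ξ).aestronglyMeasurable
    (Eventually.of_forall fun z => norm_symbolIntegrand_le_sq ξ z)

/-- The compensator is purely imaginary, so the real part is the integral of `cos(ξ·z) - 1`. This
sign is all that the energy estimates use of the nonlocal operator. -/
theorem IsLevyMeasure.re_levySymbol_nonpos {μ : Measure (Space d)} (h : IsLevyMeasure μ)
    (ξ : Space d) : (levySymbol μ ξ).re ≤ 0 := by
  have h1 := Complex.reCLM.integral_comp_comm (h.integrableOn_symbolIntegrand ξ)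
  simp only [Complex.reCLM_apply] at h1
  rw [levySymbol, ← h1]
  refine integral_nonpos fun z => ?_
  simp only [symbolIntegrand, Pi.zero_apply]
  have h2 : (if ‖z‖ < 1 then Complex.I * ((inner ℝ ξ z : ℝ) : ℂ) else 0).re = 0 := by
    split_ifs <;> simp
  rw [Complex.sub_re, h2, Complex.sub_re, mul_comm, Complex.exp_ofReal_mul_I_re, Complex.one_re]
  linarith [Real.cos_le_one (inner ℝ ξ z)]

theorem IsLevyMeasure.levyOp_trigPoly {μ : Measure (Space d)} (h : IsLevyMeasure μ)
    {c : (Fin d → ℤ) → ℂ} {v : Space d → ℝ} (hv : IsTrigPoly N c v) (x : Space d) :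
    (levyOp μ v x : ℂ) = trigPoly N (fun ξ => levySymbol μ (freqVec ξ) * c ξ) x := by
  have h1 : ∀ z : Space d,
      ((v (x + z) - v x - if ‖z‖ < 1 then fderiv ℝ v x z else 0 : ℝ) : ℂ) =
        ∑ ξ ∈ freqs d N, symbolIntegrand (freqVec ξ) z * (c ξ * expWave ξ x) := by
    intro z
    have h2 : ((if ‖z‖ < 1 then fderiv ℝ v x z else 0 : ℝ) : ℂ) =
        ∑ ξ ∈ freqs d N, (if ‖z‖ < 1 then Complex.I * ((inner ℝ (freqVec ξ) z : ℝ) : ℂ) else 0) *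
          (c ξ * expWave ξ x) := by
      split_ifs
      · rw [hv.fderiv_apply, fderiv_trigPoly]
        exact Finset.sum_congr rfl fun ξ _ => by ring
      · simp
    push_cast only [Complex.ofReal_sub]
    rw [h2, hv, hv, trigPoly, trigPoly, ← Finset.sum_sub_distrib, ← Finset.sum_sub_distrib]
    refine Finset.sum_congr rfl fun ξ _ => ?_
    rw [expWave_add_apply, symbolIntegrand]
    have h3 : expWave ξ z = Complex.exp (Complex.I * ((inner ℝ (freqVec ξ) z : ℝ) : ℂ)) := rfl
    rw [← h3]
    ring
  rw [levyOp, ← integral_complex_ofReal]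
  simp only [h1]
  rw [integral_finsetSum _ fun ξ _ => (h.integrableOn_symbolIntegrand _).mul_const _]
  refine Finset.sum_congr rfl fun ξ _ => ?_
  simp only [integral_mul_const, levySymbol]
  ring

end LevyOperator

/-! ### Gagliardo-Nirenberg interpolation for bounded periodic functions. -/

section GagliardoNirenberg

variable {d : ℕ}

theorem hasDerivAt_abs_rpow_mul_self {q : ℝ} (hq : 0 < q) (x : ℝ) :
    HasDerivAt (fun y : ℝ => |y| ^ q * y) ((q + 1) * |x| ^ q) x := by
  have hc : Continuous fun y : ℝ => |y| ^ q :=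
    continuous_abs.rpow_const fun _ => Or.inr hq.le
  -- At the origin the derivative is obtained as the continuous extension of the formula valid on
  -- both sides.
  refine hasDerivAt_of_hasDerivAt_of_ne' (x := 0) (f := fun y : ℝ => |y| ^ q * y)
    (g := fun y => (q + 1) * |y| ^ q) (fun y hy => ?_)
    (hc.mul continuous_id).continuousAt (continuous_const.mul hc).continuousAt x
  rcases lt_or_gt_of_ne hy with h | h
  · have h1 := ((Real.hasDerivAt_rpow_const (x := -y) (p := q + 1)
      (Or.inl (neg_ne_zero.2 hy))).comp y (hasDerivAt_neg y)).neg
    have h2 : HasDerivAt (fun z : ℝ => |z| ^ q * z)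
        (-((q + 1) * (-y) ^ (q + 1 - 1) * -1)) y := by
      refine h1.congr_of_eventuallyEq ?_
      filter_upwards [gt_mem_nhds h] with z hz
      simp only [Function.comp_def, Pi.neg_apply]
      rw [abs_of_neg hz, Real.rpow_add_one (by linarith)]
      ring
    refine h2.congr_deriv ?_
    rw [abs_of_neg h, add_sub_cancel_right]
    ring
  · have h1 := Real.hasDerivAt_rpow_const (x := y) (p := q + 1) (Or.inl hy)
    have h2 : HasDerivAt (fun z : ℝ => |z| ^ q * z) ((q + 1) * y ^ (q + 1 - 1)) y := by
      refine h1.congr_of_eventuallyEq ?_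
      filter_upwards [lt_mem_nhds h] with z hz
      rw [abs_of_pos hz, Real.rpow_add_one (by linarith)]
    refine h2.congr_deriv ?_
    rw [abs_of_pos h, add_sub_cancel_right]

theorem contDiff_abs_rpow_mul_self {q : ℝ} (hq : 0 < q) :
    ContDiff ℝ 1 fun y : ℝ => |y| ^ q * y := by
  rw [contDiff_one_iff_deriv]
  refine ⟨fun x => (hasDerivAt_abs_rpow_mul_self hq x).differentiableAt, ?_⟩
  have : deriv (fun y : ℝ => |y| ^ q * y) = fun x => (q + 1) * |x| ^ q :=
    funext fun x => (hasDerivAt_abs_rpow_mul_self hq x).deriv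
  rw [this]
  exact continuous_const.mul (continuous_abs.rpow_const fun _ => Or.inr hq.le)

/-- Integrate the derivative `∂_i (w |∂_i w|^(p-2) ∂_i w)`, which has mean zero. One factor `∂_i w`
is traded for `w` and a second derivative. -/
theorem integral_abs_partialD_rpow_le {w : Space d → ℝ} (hw : ContDiff ℝ 2 w)
    (hper : IsPeriodic w) (i : Fin d) {p : ℝ} (hp : 2 < p) :
    ∫ x in cell d, |partialD i w x| ^ p ≤
      (p - 1) * ∫ x in cell d,
        |w x| * |partialD i (partialD i w) x| * |partialD i w x| ^ (p - 2) := by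
  have hq : 0 < p - 2 := by linarith
  have hw1 : ContDiff ℝ 1 (partialD i w) := contDiff_partialD i hw (by norm_num)
  have hS := (contDiff_abs_rpow_mul_self hq).comp hw1
  have hc1 := hw1.continuous
  have hc2 : Continuous (partialD i (partialD i w)) :=
    (contDiff_partialD (m := 0) i hw1 (by norm_num)).continuous
  have hcr : Continuous fun x => |partialD i w x| ^ (p - 2) :=
    hc1.abs.rpow_const fun _ => Or.inr hq.le
  have hcp : Continuous fun x => |partialD i w x| ^ p :=
    hc1.abs.rpow_const fun _ => Or.inr (by linarith)
  have hzero := integral_partialD_eq_zero i ((hw.of_le (by norm_num)).mul hS) (fun j x => by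
    simp only [Function.comp_def]
    rw [hper j x, hper.partialD i j x])
  have hpt : ∀ x, partialD i (fun y => w y * ((fun y : ℝ => |y| ^ (p - 2) * y) ∘ partialD i w) y) x =
      |partialD i w x| ^ p +
        (p - 1) * (w x * partialD i (partialD i w) x * |partialD i w x| ^ (p - 2)) := by
    intro x
    have hd := hw1.differentiable (by norm_num) x
    have h1 := (hasDerivAt_abs_rpow_mul_self hq (partialD i w x)).comp_hasFDerivAt x
      hd.hasFDerivAt
    have h2 := (hw.differentiable (by norm_num) x).hasFDerivAt.mul h1
    have h3 : partialD i (fun y => w y * ((fun y : ℝ => |y| ^ (p - 2) * y) ∘ partialD i w) y) x =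
      _ := congrArg (fun A => A (EuclideanSpace.single i 1)) h2.fderiv
    rw [h3]
    have h4 : |partialD i w x| ^ p =
        |partialD i w x| ^ (p - 2) * partialD i w x * partialD i w x := by
      rw [mul_assoc, ← abs_mul_abs_self (partialD i w x), ← sq, ← Real.rpow_natCast,
        ← Real.rpow_add_of_nonneg (abs_nonneg _) hq.le (by norm_num)]
      congr 1
      push_cast
      ring
    have h5 : fderiv ℝ w x (EuclideanSpace.single i 1) = partialD i w x := rfl
    have h6 : fderiv ℝ (partialD i w) x (EuclideanSpace.single i 1) =
      partialD i (partialD i w) x := rfl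
    rw [h4]
    simp only [add_apply, smul_apply, smul_eq_mul, h5, h6,
      Function.comp_apply]
    ring
  simp only [hpt] at hzero
  have hci : Continuous fun x => w x * partialD i (partialD i w) x * |partialD i w x| ^ (p - 2) :=
    (hw.continuous.mul hc2).mul hcr
  rw [integral_add (integrableOn_cell _ hcp) ((integrableOn_cell _ hci).const_mul _),
    integral_const_mul] at hzero
  have hle : -∫ x in cell d, w x * partialD i (partialD i w) x * |partialD i w x| ^ (p - 2) ≤
      ∫ x in cell d, |w x| * |partialD i (partialD i w) x| * |partialD i w x| ^ (p - 2) := by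
    rw [← integral_neg]
    refine integral_mono (integrableOn_cell _ hci).neg
      (integrableOn_cell _ ((hw.continuous.abs.mul hc2.abs).mul hcr)) fun x => ?_
    have hr : 0 ≤ |partialD i w x| ^ (p - 2) := Real.rpow_nonneg (abs_nonneg _) _
    simp only
    rw [← abs_mul, ← neg_mul]
    exact mul_le_mul_of_nonneg_right (neg_le_abs _) hr
  nlinarith

/-- Weighted arithmetic-geometric mean with `A` and `C` scaled by `η` and `B` by the compensating
factor `L`, for which `η^a L^b η^c = 1`. The factor `a` is kept in front of `A` so that this term
vanishes when `a = 0`. -/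
theorem exists_young_three {a b c : ℝ} (ha : 0 ≤ a) (hb : 0 < b) (hc : 0 ≤ c)
    (habc : a + b + c = 1) {η : ℝ} (hη : 0 < η) :
    ∃ K : ℝ, 0 ≤ K ∧ ∀ A B C : ℝ, 0 ≤ A → 0 ≤ B → 0 ≤ C →
      A ^ a * B ^ b * C ^ c ≤ η * a * A + K * B + η * C := by
  set L : ℝ := η ^ (-(a + c) / b) with hL
  have hLpos : 0 < L := Real.rpow_pos_of_pos hη _
  refine ⟨b * L, by positivity, fun A B C hA hB hC => ?_⟩
  have h := Real.geom_mean_le_arith_mean3_weighted ha hb.le hc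
    (mul_nonneg hη.le hA) (mul_nonneg hLpos.le hB) (mul_nonneg hη.le hC) habc
  rw [Real.mul_rpow hη.le hA, Real.mul_rpow hLpos.le hB, Real.mul_rpow hη.le hC] at h
  have hone : η ^ a * L ^ b * η ^ c = 1 := by
    rw [hL, ← Real.rpow_mul hη.le, ← Real.rpow_add hη, ← Real.rpow_add hη]
    have : a + -(a + c) / b * b + c = 0 := by field_simp; ring
    rw [this, Real.rpow_zero]
  have heq : η ^ a * A ^ a * (L ^ b * B ^ b) * (η ^ c * C ^ c) =
      (η ^ a * L ^ b * η ^ c) * (A ^ a * B ^ b * C ^ c) := by ring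
  rw [heq, hone, one_mul] at h
  have hc1 : c * (η * C) ≤ 1 * (η * C) :=
    mul_le_mul_of_nonneg_right (by linarith) (mul_nonneg hη.le hC)
  nlinarith

/-- The sum of `∫ |∂_l v|^{2k/j}` over all words `l` of length `j`. -/
def wordEnergy (k j : ℕ) (v : Space d → ℝ) : ℝ :=
  ∑ l : Fin j → Fin d, ∫ x in cell d, |listD (List.ofFn l) v x| ^ (2 * k / j : ℝ)

theorem wordEnergy_nonneg (k j : ℕ) (v : Space d → ℝ) : 0 ≤ wordEnergy k j v :=
  Finset.sum_nonneg fun _ _ => integral_nonneg fun _ => Real.rpow_nonneg (abs_nonneg _) _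

theorem continuous_listD {v : Space d → ℝ} (hv : ∀ n : ℕ, ContDiff ℝ n v) (l : List (Fin d)) :
    Continuous (listD l v) := (contDiff_listD l 0 (hv _)).continuous

theorem continuous_abs_listD_rpow {v : Space d → ℝ} (hv : ∀ n : ℕ, ContDiff ℝ n v)
    (l : List (Fin d)) {p : ℝ} (hp : 0 ≤ p) : Continuous fun x => |listD l v x| ^ p :=
  (continuous_listD hv l).abs.rpow_const fun _ => Or.inr hp

theorem integral_listD_le_wordEnergy (k : ℕ) {j : ℕ} (v : Space d → ℝ) (l : Fin j → Fin d) :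
    ∫ x in cell d, |listD (List.ofFn l) v x| ^ (2 * k / j : ℝ) ≤ wordEnergy k j v :=
  Finset.single_le_sum
    (f := fun l : Fin j → Fin d => ∫ x in cell d, |listD (List.ofFn l) v x| ^ (2 * k / j : ℝ))
    (fun _ _ => integral_nonneg fun _ => Real.rpow_nonneg (abs_nonneg _) _) (Finset.mem_univ l)

/-- For `p = 2k/(j+1)` the three factors in `integral_abs_partialD_rpow_le` fit the Young weights
`j/(2k)`, `(j+2)/(2k)` and `(k-j-1)/k`, whose sum is one. For `j = 0` the function itself is
replaced by its bound `1`, and the lower order term carries the factor `j = 0`. -/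
theorem exists_wordEnergy_interpolation (d : ℕ) {k j : ℕ} (hjk : j + 1 < k) {η : ℝ}
    (hη : 0 < η) :
    ∃ K : ℝ, 0 ≤ K ∧ ∀ v : Space d → ℝ, (∀ n : ℕ, ContDiff ℝ n v) → IsPeriodic v →
      (∀ x, |v x| ≤ 1) →
      wordEnergy k (j + 1) v ≤ η * j * wordEnergy k j v + K * wordEnergy k (j + 2) v := by
  have hk : (0 : ℝ) < k := by exact_mod_cast (by omega : 0 < k)
  have hjk' : ((j : ℝ) + 1) < k := by exact_mod_cast hjk
  have hj0 : (0 : ℝ) ≤ j := Nat.cast_nonneg j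
  set p : ℝ := 2 * k / (j + 1 : ℕ) with hp
  have hp2 : 2 < p := by
    rw [hp, lt_div_iff₀ (by positivity)]
    push_cast
    linarith
  -- The number of words of length `j + 1`, raised by one to keep `n ≥ 1` in every dimension.
  set n : ℝ := (d : ℝ) ^ (j + 1) + 1 with hn
  have hn1 : 1 ≤ n := by rw [hn]; linarith [pow_nonneg (Nat.cast_nonneg d : (0 : ℝ) ≤ d) (j + 1)]
  -- Small enough that the term `(p - 1) δ I` is absorbed on the left, and that the sum over all
  -- words still has coefficient at most `η`.
  set δ : ℝ := min 1 (η / n) / (2 * (p - 1)) with hδ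
  have hδpos : 0 < δ := by
    have : 0 < p - 1 := by linarith
    rw [hδ]; positivity
  have hδ1 : (p - 1) * δ ≤ 1 / 2 := by
    have : 0 < p - 1 := by linarith
    rw [hδ, mul_div_assoc', div_le_iff₀ (by positivity)]
    nlinarith [min_le_left 1 (η / n)]
  have hδ2 : n * (2 * ((p - 1) * δ)) ≤ η := by
    have : 0 < p - 1 := by linarith
    have h1 : 2 * ((p - 1) * δ) = min 1 (η / n) := by rw [hδ]; field_simp
    rw [h1]
    calc n * min 1 (η / n) ≤ n * (η / n) := by gcongr; exact min_le_right _ _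
      _ = η := by field_simp
  obtain ⟨K, hK, hY⟩ := exists_young_three (a := j / (2 * k)) (b := (j + 2) / (2 * k))
    (c := (k - j - 1) / k) (by positivity) (by positivity)
    (div_nonneg (by linarith) hk.le) (by field_simp; ring) hδpos
  refine ⟨n * (2 * ((p - 1) * K)), by
    have : 0 < p - 1 := by linarith
    positivity, fun v hv hper hbd => ?_⟩
  have hword : ∀ l : Fin (j + 1) → Fin d,
      ∫ x in cell d, |listD (List.ofFn l) v x| ^ p ≤
        2 * ((p - 1) * δ) * (j * wordEnergy k j v) +
          2 * ((p - 1) * K) * wordEnergy k (j + 2) v := by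
    intro l
    set i := l 0
    set t : Fin j → Fin d := fun m => l m.succ
    set w := listD (List.ofFn t) v with hw
    have hl : listD (List.ofFn l) v = partialD i w := by rw [List.ofFn_succ, listD_cons]
    have hl2 : listD (List.ofFn (Fin.cons i l : Fin (j + 2) → Fin d)) v =
        partialD i (partialD i w) := by
      rw [List.ofFn_cons, listD_cons, hl]
    have hwC : ContDiff ℝ 2 w := contDiff_listD (List.ofFn t) 2 (hv _)
    have hint := integral_abs_partialD_rpow_le hwC (hper.listD _) i hp2
    have hw1 := continuous_listD hv (List.ofFn t)
    have hw2 := continuous_listD hv (List.ofFn l)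
    have hw3 := continuous_listD hv (List.ofFn (Fin.cons i l : Fin (j + 2) → Fin d))
    have hA := continuous_abs_listD_rpow hv (List.ofFn t) (p := 2 * k / j) (by positivity)
    have hB := continuous_abs_listD_rpow hv (List.ofFn (Fin.cons i l : Fin (j + 2) → Fin d))
      (p := 2 * k / (j + 2 : ℕ)) (by positivity)
    have hC := continuous_abs_listD_rpow hv (List.ofFn l) (p := p) (by linarith)
    rw [hl] at hw2 hC
    rw [hl2] at hw3 hB
    rw [← hw] at hw1 hA
    rw [hl]
    have hpt : ∀ x, |w x| * |partialD i (partialD i w) x| * |partialD i w x| ^ (p - 2) ≤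
        δ * (j / (2 * k)) * |w x| ^ (2 * k / j : ℝ) +
          K * |partialD i (partialD i w) x| ^ (2 * k / (j + 2 : ℕ) : ℝ) +
          δ * |partialD i w x| ^ p := by
      intro x
      refine le_trans ?_ (hY _ _ _ (Real.rpow_nonneg (abs_nonneg _) _)
        (Real.rpow_nonneg (abs_nonneg _) _) (Real.rpow_nonneg (abs_nonneg _) _))
      rw [← Real.rpow_mul (abs_nonneg _), ← Real.rpow_mul (abs_nonneg _),
        ← Real.rpow_mul (abs_nonneg _)]
      have e2 : (2 * k / (j + 2 : ℕ) : ℝ) * ((j + 2) / (2 * k)) = 1 := by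
        push_cast; field_simp
      have e3 : p * ((k - j - 1) / k) = p - 2 := by
        rw [hp]; push_cast; field_simp; ring
      rw [e2, e3, Real.rpow_one]
      -- For `j = 0` the exponent is `0` by the convention for division, the right side is `1`, and
      -- the bound on `v` is used; otherwise equality holds.
      have e1 : |w x| ≤ |w x| ^ ((2 * k / j : ℝ) * (j / (2 * k))) := by
        rcases Nat.eq_zero_or_pos j with h0 | h0
        · subst h0
          have hwv : w = v := by rw [hw]; simp
          rw [hwv]
          simpa using hbd x
        · have : (0 : ℝ) < j := by exact_mod_cast h0
          have e : (2 * k / j : ℝ) * (j / (2 * k)) = 1 := by field_simp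
          rw [e, Real.rpow_one]
      have hr : 0 ≤ |partialD i w x| ^ (p - 2) := Real.rpow_nonneg (abs_nonneg _) _
      gcongr
    have hint2 : ∫ x in cell d,
        |w x| * |partialD i (partialD i w) x| * |partialD i w x| ^ (p - 2) ≤
        δ * (j / (2 * k)) * (∫ x in cell d, |w x| ^ (2 * k / j : ℝ)) +
          K * (∫ x in cell d, |partialD i (partialD i w) x| ^ (2 * k / (j + 2 : ℕ) : ℝ)) +
          δ * ∫ x in cell d, |partialD i w x| ^ p := by
      rw [← integral_const_mul, ← integral_const_mul, ← integral_const_mul, ← integral_add,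
        ← integral_add]
      · refine integral_mono (integrableOn_cell _ ((hw1.abs.mul hw3.abs).mul
          (hw2.abs.rpow_const fun _ => Or.inr (by linarith)))) ?_ hpt
        exact integrableOn_cell _ (((continuous_const.mul hA).add
          (continuous_const.mul hB)).add (continuous_const.mul hC))
      · exact integrableOn_cell _ ((continuous_const.mul hA).add (continuous_const.mul hB))
      · exact integrableOn_cell _ (continuous_const.mul hC)
      · exact integrableOn_cell _ (continuous_const.mul hA)
      · exact integrableOn_cell _ (continuous_const.mul hB)
    have hEA : ∫ x in cell d, |w x| ^ (2 * k / j : ℝ) ≤ wordEnergy k j v :=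
      integral_listD_le_wordEnergy k v t
    have hEB : ∫ x in cell d, |partialD i (partialD i w) x| ^ (2 * k / (j + 2 : ℕ) : ℝ) ≤
        wordEnergy k (j + 2) v := by
      rw [← hl2]; exact integral_listD_le_wordEnergy k v _
    set I := ∫ x in cell d, |partialD i w x| ^ p
    have hI : 0 ≤ I := integral_nonneg fun _ => Real.rpow_nonneg (abs_nonneg _) _
    have hp1 : 0 < p - 1 := by linarith
    have hA0 := wordEnergy_nonneg k j v
    have s1 : δ * (j / (2 * k)) * (∫ x in cell d, |w x| ^ (2 * k / j : ℝ)) ≤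
        δ * (j * wordEnergy k j v) := by
      rw [mul_assoc]
      have hjk2 : (j : ℝ) / (2 * k) ≤ j := by
        rw [div_le_iff₀ (by positivity)]
        nlinarith
      gcongr
    have s2 := mul_le_mul_of_nonneg_left hEB hK
    have s3 : I ≤ (p - 1) * (δ * (j * wordEnergy k j v) + K * wordEnergy k (j + 2) v + δ * I) :=
      hint.trans (mul_le_mul_of_nonneg_left (hint2.trans (by linarith)) hp1.le)
    have s4 : (p - 1) * δ * I ≤ 1 / 2 * I := mul_le_mul_of_nonneg_right hδ1 hI
    nlinarith
  have hp1 : 0 < p - 1 := by linarith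
  have hA0 := wordEnergy_nonneg k j v
  have hB0 := wordEnergy_nonneg k (j + 2) v
  set R := 2 * ((p - 1) * δ) * (j * wordEnergy k j v) +
          2 * ((p - 1) * K) * wordEnergy k (j + 2) v with hR
  have hR0 : 0 ≤ R := by positivity
  have hsum : wordEnergy k (j + 1) v ≤ n * R := by
    have h1 : wordEnergy k (j + 1) v ≤ ∑ _l : Fin (j + 1) → Fin d, R :=
      Finset.sum_le_sum fun l _ => hword l
    refine h1.trans ?_
    rw [Finset.sum_const, nsmul_eq_mul]
    refine mul_le_mul_of_nonneg_right ?_ hR0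
    simp [hn]
  refine hsum.trans ?_
  have h2 : n * (2 * ((p - 1) * δ)) * (j * wordEnergy k j v) ≤ η * (j * wordEnergy k j v) :=
    mul_le_mul_of_nonneg_right hδ2 (by positivity)
  rw [hR]
  nlinarith

/-- By induction the lower order term of the interpolation inequality is bounded by the energy being
estimated, and `η` is chosen so that at most half of it reappears. The induction starts because
there is no lower order term for `j = 0`. -/
theorem exists_wordEnergy_le_succ (d k j : ℕ) (hjk : j + 1 < k) :
    ∃ C : ℝ, 0 ≤ C ∧ ∀ v : Space d → ℝ, (∀ n : ℕ, ContDiff ℝ n v) → IsPeriodic v →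
      (∀ x, |v x| ≤ 1) → wordEnergy k (j + 1) v ≤ C * wordEnergy k (j + 2) v := by
  induction j with
  | zero =>
    obtain ⟨K, hK, h⟩ := exists_wordEnergy_interpolation d hjk one_pos
    exact ⟨K, hK, fun v hv hp hb => by simpa using h v hv hp hb⟩
  | succ j ih =>
    obtain ⟨C, hC, h⟩ := ih (by omega)
    have hpos : 0 < 2 * (((j + 1 : ℕ) : ℝ) * C + 1) := by positivity
    obtain ⟨K, hK, h2⟩ := exists_wordEnergy_interpolation d hjk (one_div_pos.2 hpos)
    refine ⟨2 * K, by positivity, fun v hv hp hb => ?_⟩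
    have h3 := h2 v hv hp hb
    have h4 := h v hv hp hb
    have hE := wordEnergy_nonneg k (j + 2) v
    have h5 : 1 / (2 * (((j + 1 : ℕ) : ℝ) * C + 1)) * ((j + 1 : ℕ) : ℝ) * wordEnergy k (j + 1) v ≤
        1 / 2 * wordEnergy k (j + 2) v := by
      have h6 : 1 / (2 * (((j + 1 : ℕ) : ℝ) * C + 1)) * ((j + 1 : ℕ) : ℝ) * C ≤ 1 / 2 := by
        rw [mul_assoc, one_div, inv_mul_le_iff₀ hpos]
        linarith
      calc _ ≤ 1 / (2 * (((j + 1 : ℕ) : ℝ) * C + 1)) * ((j + 1 : ℕ) : ℝ) *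
            (C * wordEnergy k (j + 2) v) := by gcongr
        _ = 1 / (2 * (((j + 1 : ℕ) : ℝ) * C + 1)) * ((j + 1 : ℕ) : ℝ) * C *
            wordEnergy k (j + 2) v := by ring
        _ ≤ _ := by gcongr
    have e1 : j + 1 + 1 = j + 2 := rfl
    have e2 : j + 1 + 2 = j + 3 := rfl
    rw [e1, e2] at *
    linarith

/-- Gagliardo-Nirenberg: for functions bounded by one, `∫ |∂^j v|^{2k/j}` is controlled by
`∫ |∂^k v|²`. -/
theorem exists_wordEnergy_le (d k j : ℕ) (hj : 1 ≤ j) (hjk : j ≤ k) :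
    ∃ C : ℝ, 0 ≤ C ∧ ∀ v : Space d → ℝ, (∀ n : ℕ, ContDiff ℝ n v) → IsPeriodic v →
      (∀ x, |v x| ≤ 1) → wordEnergy k j v ≤ C * wordEnergy k k v := by
  induction hjk using Nat.decreasingInduction with
  | self => exact ⟨1, zero_le_one, fun v _ _ _ => by rw [one_mul]⟩
  | of_succ j hlt ih =>
    obtain ⟨C, hC, h⟩ := ih (by omega)
    obtain ⟨i, rfl⟩ : ∃ i, j = i + 1 := ⟨j - 1, by omega⟩
    obtain ⟨K, hK, h2⟩ := exists_wordEnergy_le_succ d k i hlt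
    refine ⟨K * C, by positivity, fun v hv hp hb => (h2 v hv hp hb).trans ?_⟩
    rw [mul_assoc]
    exact mul_le_mul_of_nonneg_left (h v hv hp hb) hK

end GagliardoNirenberg

/-! ### The Moser estimate and the constants `𝒦_k`. -/

section Composition

variable {d N : ℕ}

theorem exists_multiIndex_prod_eq (l : List (Fin d)) :
    ∃ α ∈ Finset.piAntidiag (Finset.univ : Finset (Fin d)) l.length,
      ∀ g : Fin d → ℝ, (l.map g).prod = ∏ j, g j ^ α j := by
  induction l with
  | nil => exact ⟨0, by simp, fun g => by simp⟩
  | cons i l ih =>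
    obtain ⟨α, hα, h⟩ := ih
    refine ⟨α + Pi.single i 1, Finset.mem_piAntidiag.2 ⟨?_, by simp⟩, fun g => ?_⟩
    · have := (Finset.mem_piAntidiag.1 hα).1
      simp only [Pi.add_apply, Finset.sum_add_distrib, List.length_cons]
      rw [this]
      simp
    · rw [List.map_cons, List.prod_cons, h]
      simp only [Pi.add_apply, pow_add, Finset.prod_mul_distrib]
      rw [mul_comm]
      congr 1
      rw [Finset.prod_eq_single i]
      · simp
      · intro k _ hk; simp [hk]
      · simp

/-- On the Fourier side the order of the derivatives is irrelevant, so each word contributes one of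
the monomials in the Sobolev weight. -/
theorem IsTrigPoly.integral_listD_sq_le {c : (Fin d → ℤ) → ℂ} {v : Space d → ℝ}
    (h : IsTrigPoly N c v) (l : List (Fin d)) :
    ∫ x in cell d, ‖SVV.listD l v x‖ ^ 2 ≤ derivSq l.length v := by
  rw [(h.listD l).integral_sq, h.derivSq_eq]
  have : 0 < Real.pi := Real.pi_pos
  gcongr with ξ _
  rw [norm_mul, mul_pow, norm_prod_wave]
  obtain ⟨α, hα, hprod⟩ := exists_multiIndex_prod_eq l
  rw [hprod]
  gcongr
  exact Finset.single_le_sum (f := fun α : Fin d → ℕ => ∏ j, ((ξ j : ℝ) ^ 2) ^ α j)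
    (fun _ _ => Finset.prod_nonneg fun _ _ => by positivity) hα

theorem derivSq_nonneg {F : Type*} [NormedAddCommGroup F] [NormedSpace ℝ F] (k : ℕ)
    (φ : Space d → F) : 0 ≤ derivSq k φ :=
  Finset.sum_nonneg fun _ _ => integral_nonneg fun _ => sq_nonneg _

theorem derivSq_le_integral_iteratedFDeriv {F : Type*} [NormedAddCommGroup F] [NormedSpace ℝ F]
    (k : ℕ) {φ : Space d → F} (hφ : ContDiff ℝ k φ) :
    derivSq k φ ≤ (Finset.piAntidiag (Finset.univ : Finset (Fin d)) k).card *
      ∫ x in cell d, ‖iteratedFDeriv ℝ k φ x‖ ^ 2 := by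
  rw [derivSq, ← nsmul_eq_mul, ← Finset.sum_const]
  refine Finset.sum_le_sum fun α hα => ?_
  have hlen := length_wordOf_of_mem hα
  rw [multiD_eq_listD]
  have hφ' : ContDiff ℝ ((wordOf α).length : ℕ) φ := by rw [hlen]; exact hφ
  refine integral_mono (integrableOn_cell _ ?_) (integrableOn_cell _ ?_) fun x => ?_
  · exact ((contDiff_listD (wordOf α) 0 (by rwa [zero_add])).continuous.norm).pow 2
  · exact ((hφ.continuous_iteratedFDeriv (by exact_mod_cast le_rfl)).norm).pow 2
  · have := norm_listD_le_iteratedFDeriv (wordOf α) hφ' x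
    rw [hlen] at this
    exact pow_le_pow_left₀ (norm_nonneg _) this 2

/-- The pointwise chain rule estimate, homogeneous in the derivatives of the inner function. -/
theorem norm_iteratedFDeriv_comp_sq_le {F : Type*} [NormedAddCommGroup F] [NormedSpace ℝ F]
    {k : ℕ} (hk : 1 ≤ k) {g : ℝ → F} (hg : ContDiff ℝ k g) {v : Space d → ℝ}
    (hv : ContDiff ℝ k v) (x : Space d) {A : ℝ} (hA : 0 ≤ A)
    (hgA : ∀ i, 1 ≤ i → i ≤ k → ‖iteratedDeriv i g (v x)‖ ≤ A) :
    ‖iteratedFDeriv ℝ k (fun y => g (v y)) x‖ ^ 2 ≤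
      (k.factorial * A) ^ 2 * ((k : ℝ) ^ (2 * k - 1 : ℝ) *
        ∑ i ∈ Finset.Icc 1 k, ((Fintype.card (Fin i → Fin d) : ℝ) ^ (2 * k / i - 1 : ℝ) *
          ∑ l : Fin i → Fin d, |listD (List.ofFn l) v x| ^ (2 * k / i : ℝ))) := by
  set E : ℕ → ℝ := fun i => ∑ l : Fin i → Fin d, |listD (List.ofFn l) v x| with hE
  have hE0 : ∀ i, 0 ≤ E i := fun i => Finset.sum_nonneg fun _ _ => abs_nonneg _
  -- Chosen so that the `i`-th derivative of `v` is at most `D^i`, the homogeneous form required by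
  -- the chain rule bound. Its power `D^(2k)` then splits into the terms `E_i^(2k/i)`.
  set D : ℝ := ∑ i ∈ Finset.Icc 1 k, E i ^ (1 / i : ℝ) with hD
  have hD0 : 0 ≤ D := Finset.sum_nonneg fun i _ => Real.rpow_nonneg (hE0 i) _
  -- Subtracting the value at the point makes the zeroth derivative vanish there, so `A` need only
  -- bound the derivatives of order at least one.
  set g₀ : ℝ → F := fun y => -g (v x) + g y with hg₀
  have hg₀C : ContDiff ℝ k g₀ := contDiff_const.add hg
  have hcomp : ContDiff ℝ k (g₀ ∘ v) := hg₀C.comp hv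
  have heq : (fun y => g (v y)) = (fun _ => g (v x)) + g₀ ∘ v := by
    funext y; simp [hg₀]
  have h1 : iteratedFDeriv ℝ k (fun y => g (v y)) x = iteratedFDeriv ℝ k (g₀ ∘ v) x := by
    rw [heq, iteratedFDeriv_add_apply contDiff_const.contDiffAt hcomp.contDiffAt,
      iteratedFDeriv_const_of_ne (by omega)]
    simp
  have h2 : ‖iteratedFDeriv ℝ k (g₀ ∘ v) x‖ ≤ k.factorial * A * D ^ k := by
    refine norm_iteratedFDeriv_comp_le hg₀C hv le_rfl x (fun i hi => ?_) (fun i hi1 hi => ?_)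
    · rw [norm_iteratedFDeriv_eq_norm_iteratedDeriv]
      rcases Nat.eq_zero_or_pos i with h0 | h0
      · subst h0; simpa [hg₀] using hA
      · rw [hg₀, iteratedDeriv_const_add h0]
        exact hgA i h0 hi
    · have hi0 : (i : ℝ) ≠ 0 := by exact_mod_cast (by omega : i ≠ 0)
      calc _ ≤ E i := norm_iteratedFDeriv_le_sum i (hv.of_le (by exact_mod_cast hi)) x
        _ = (E i ^ (1 / i : ℝ)) ^ i := by
          rw [← Real.rpow_natCast, ← Real.rpow_mul (hE0 i), one_div_mul_cancel hi0, Real.rpow_one]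
        _ ≤ D ^ i := pow_le_pow_left₀ (Real.rpow_nonneg (hE0 i) _)
          (Finset.single_le_sum (f := fun i : ℕ => E i ^ (1 / i : ℝ))
            (fun i _ => Real.rpow_nonneg (hE0 i) _) (Finset.mem_Icc.2 ⟨hi1, hi⟩)) i
  have hk1 : (1 : ℝ) ≤ k := by exact_mod_cast hk
  have h3 : (D ^ k) ^ 2 ≤ (k : ℝ) ^ (2 * k - 1 : ℝ) *
      ∑ i ∈ Finset.Icc 1 k, ((Fintype.card (Fin i → Fin d) : ℝ) ^ (2 * k / i - 1 : ℝ) *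
          ∑ l : Fin i → Fin d, |listD (List.ofFn l) v x| ^ (2 * k / i : ℝ)) := by
    have e1 : (D ^ k) ^ 2 = D ^ (2 * k : ℝ) := by
      rw [← pow_mul, ← Real.rpow_natCast]; congr 1; push_cast; ring
    rw [e1]
    have h4 := Real.rpow_sum_le_const_mul_sum_rpow_of_nonneg (s := Finset.Icc 1 k)
      (f := fun i : ℕ => E i ^ (1 / i : ℝ)) (p := 2 * k) (by linarith)
      (fun i _ => Real.rpow_nonneg (hE0 i) _)
    rw [Nat.card_Icc, Nat.add_sub_cancel] at h4
    refine h4.trans ?_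
    gcongr with i hi
    obtain ⟨hi1, hi2⟩ := Finset.mem_Icc.1 hi
    have hi0 : (0 : ℝ) < i := by exact_mod_cast hi1
    have hik : (i : ℝ) ≤ k := by exact_mod_cast hi2
    have h5 := Real.rpow_sum_le_const_mul_sum_rpow_of_nonneg
      (s := (Finset.univ : Finset (Fin i → Fin d)))
      (f := fun l => |listD (List.ofFn l) v x|) (p := 2 * k / i)
      (by rw [le_div_iff₀ hi0]; linarith) (fun l _ => abs_nonneg _)
    rw [Finset.card_univ] at h5
    refine le_trans (le_of_eq ?_) h5
    rw [← Real.rpow_mul (hE0 i)]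
    congr 1
    ring
  rw [h1]
  calc _ ≤ (k.factorial * A * D ^ k) ^ 2 := pow_le_pow_left₀ (norm_nonneg _) h2 2
    _ = (k.factorial * A) ^ 2 * (D ^ k) ^ 2 := by ring
    _ ≤ _ := mul_le_mul_of_nonneg_left h3 (sq_nonneg _)

/-- The composition estimate for inner functions that are bounded by one. -/
theorem exists_derivSq_comp_le (d k : ℕ) (hk : 1 ≤ k) :
    ∃ C : ℝ, 0 ≤ C ∧ ∀ (N : ℕ) (c : (Fin d → ℤ) → ℂ) (v : Space d → ℝ) (g : ℝ → Space d) (A : ℝ),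
      IsTrigPoly N c v → (∀ x, |v x| ≤ 1) → ContDiff ℝ k g → 0 ≤ A →
      (∀ x i, 1 ≤ i → i ≤ k → ‖iteratedDeriv i g (v x)‖ ≤ A) →
      derivSq k (fun x => g (v x)) ≤ C * A ^ 2 * derivSq k v := by
  have hGN : ∀ i, ∃ C : ℝ, 0 ≤ C ∧ (1 ≤ i → i ≤ k → ∀ v : Space d → ℝ,
      (∀ n : ℕ, ContDiff ℝ n v) → IsPeriodic v → (∀ x, |v x| ≤ 1) →
      wordEnergy k i v ≤ C * wordEnergy k k v) := by
    intro i
    by_cases h : 1 ≤ i ∧ i ≤ k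
    · obtain ⟨C, hC, h2⟩ := exists_wordEnergy_le d k i h.1 h.2
      exact ⟨C, hC, fun _ _ => h2⟩
    · exact ⟨0, le_rfl, fun h1 h2 => absurd ⟨h1, h2⟩ h⟩
  choose G hG0 hG using hGN
  set P : ℝ := (((Finset.piAntidiag (Finset.univ : Finset (Fin d)) k).card : ℕ) : ℝ)
  set S : ℝ := ∑ i ∈ Finset.Icc 1 k, (Fintype.card (Fin i → Fin d) : ℝ) ^ (2 * k / i - 1 : ℝ) * G i
    with hS
  set W : ℝ := ((Fintype.card (Fin k → Fin d) : ℕ) : ℝ)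
  have hS0 : 0 ≤ S := Finset.sum_nonneg fun i _ =>
    mul_nonneg (Real.rpow_nonneg (Nat.cast_nonneg _) _) (hG0 i)
  have hk1 : (0 : ℝ) < k := by exact_mod_cast hk
  refine ⟨P * ((k.factorial : ℝ) ^ 2 * ((k : ℝ) ^ (2 * k - 1 : ℝ) * (S * W))), by positivity,
    fun N c v g A hv hbd hg hA hgA => ?_⟩
  have hsm : ∀ n : ℕ, ContDiff ℝ n v := fun n => hv.contDiff
  refine (derivSq_le_integral_iteratedFDeriv k (hg.comp (hsm k))).trans ?_
  have hword : wordEnergy k k v ≤ W * derivSq k v := by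
    have : W * derivSq k v = ∑ _l : Fin k → Fin d, derivSq k v := by
      rw [Finset.sum_const, nsmul_eq_mul, Finset.card_univ]
    rw [this]
    refine Finset.sum_le_sum fun l _ => ?_
    have h1 := hv.integral_listD_sq_le (List.ofFn l)
    rw [List.length_ofFn] at h1
    have e : (2 * k / k : ℝ) = (2 : ℕ) := by field_simp; norm_num
    simp only [e, Real.rpow_natCast]
    simpa only [Real.norm_eq_abs] using h1
  have hcont : ∀ (i : ℕ) (l : Fin i → Fin d),
      Continuous fun x => |listD (List.ofFn l) v x| ^ (2 * k / i : ℝ) :=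
    fun i l => continuous_abs_listD_rpow hsm _ (by positivity)
  have hint : ∫ x in cell d, ‖iteratedFDeriv ℝ k (fun y => g (v y)) x‖ ^ 2 ≤
      (k.factorial * A) ^ 2 * ((k : ℝ) ^ (2 * k - 1 : ℝ) *
        ∑ i ∈ Finset.Icc 1 k, ((Fintype.card (Fin i → Fin d) : ℝ) ^ (2 * k / i - 1 : ℝ) *
          wordEnergy k i v)) := by
    have h1 := fun x => norm_iteratedFDeriv_comp_sq_le hk hg (hsm k) x hA (hgA x)
    refine (integral_mono (integrableOn_cell _ ?_) (integrableOn_cell _ ?_) h1).trans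
      (le_of_eq ?_)
    · exact (((hg.comp (hsm k)).continuous_iteratedFDeriv (by exact_mod_cast le_rfl)).norm).pow 2
    · exact continuous_const.mul (continuous_const.mul (continuous_finsetSum _ fun i _ =>
        continuous_const.mul (continuous_finsetSum _ fun l _ => hcont i l)))
    · rw [integral_const_mul, integral_const_mul, integral_finsetSum]
      · simp only [integral_const_mul, wordEnergy]
        congr 2
        refine Finset.sum_congr rfl fun i _ => ?_
        rw [integral_finsetSum _ fun l _ => integrableOn_cell _ (hcont i l)]
      · exact fun i _ => integrableOn_cell _ (continuous_const.mul
          (continuous_finsetSum _ fun l _ => hcont i l))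
  have hsum : ∑ i ∈ Finset.Icc 1 k, ((Fintype.card (Fin i → Fin d) : ℝ) ^ (2 * k / i - 1 : ℝ) *
      wordEnergy k i v) ≤ S * (W * derivSq k v) := by
    rw [hS, Finset.sum_mul]
    refine Finset.sum_le_sum fun i hi => ?_
    obtain ⟨hi1, hi2⟩ := Finset.mem_Icc.1 hi
    rw [mul_assoc]
    refine mul_le_mul_of_nonneg_left ?_ (Real.rpow_nonneg (Nat.cast_nonneg _) _)
    exact (hG i hi1 hi2 v hsm hv.isPeriodic hbd).trans
      (mul_le_mul_of_nonneg_left hword (hG0 i))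
  calc _ ≤ P * ((k.factorial * A) ^ 2 * ((k : ℝ) ^ (2 * k - 1 : ℝ) * (S * (W * derivSq k v)))) := by
        refine mul_le_mul_of_nonneg_left (hint.trans ?_) (Nat.cast_nonneg _)
        gcongr
    _ = _ := by ring

theorem derivSq_const_smul (k : ℕ) (a : ℝ) {c : (Fin d → ℤ) → ℂ} {v : Space d → ℝ}
    (hv : IsTrigPoly N c v) : derivSq k (fun x => a * v x) = a ^ 2 * derivSq k v := by
  have h : IsTrigPoly N (fun ξ => a * c ξ) (fun x => a * v x) := by
    intro x
    rw [Complex.ofReal_mul, hv x, trigPoly, trigPoly, Finset.mul_sum]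
    exact Finset.sum_congr rfl fun ξ _ => by ring
  rw [h.derivSq_eq, hv.derivSq_eq]
  simp only [norm_mul, mul_pow, Complex.norm_real, Real.norm_eq_abs, sq_abs, Finset.mul_sum]
  exact Finset.sum_congr rfl fun ξ _ => by ring

theorem bddAbove_fluxNorm {f : ℝ → Space d} {k : ℕ} (hf : ContDiff ℝ k f) {j : ℕ} (hj : j ≤ k)
    (R : ℝ) : BddAbove {r | ∃ v : ℝ, |v| ≤ R ∧ r = ‖iteratedDeriv j f v‖} := by
  have hc : Continuous fun v => ‖iteratedDeriv j f v‖ :=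
    (hf.continuous_iteratedDeriv j (by exact_mod_cast hj)).norm
  obtain ⟨B, hB⟩ := (isCompact_Icc (a := -R) (b := R)).bddAbove_image hc.continuousOn
  refine ⟨B, ?_⟩
  rintro r ⟨v, hv, rfl⟩
  exact hB ⟨v, abs_le.1 hv, rfl⟩

theorem fluxNorm_nonneg (f : ℝ → Space d) (R : ℝ) (j : ℕ) : 0 ≤ fluxNorm f R j :=
  Real.sSup_nonneg (by rintro r ⟨v, _, rfl⟩; exact norm_nonneg _)

/-- The Moser-type composition estimate. -/
theorem exists_derivNorm_comp_le (d k : ℕ) (hk : 1 ≤ k) :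
    ∃ C : ℝ, 0 ≤ C ∧ ∀ (N : ℕ) (c : (Fin d → ℤ) → ℂ) (v : Space d → ℝ) (f : ℝ → Space d) (M : ℝ),
      IsTrigPoly N c v → (∀ x, |v x| ≤ M) → ContDiff ℝ k f →
      derivNorm k (fun x => f (v x)) ≤
        C * (∑ j ∈ Finset.Icc 1 k, fluxNorm f M j * M ^ (j - 1)) * derivNorm k v := by
  obtain ⟨C, hC, h⟩ := exists_derivSq_comp_le d k hk
  refine ⟨√C, Real.sqrt_nonneg _, fun N c v f M hv hbd hf => ?_⟩
  have hM : 0 ≤ M := (abs_nonneg _).trans (hbd 0)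
  set S := ∑ j ∈ Finset.Icc 1 k, fluxNorm f M j * M ^ (j - 1) with hS
  have hS0 : 0 ≤ S := Finset.sum_nonneg fun j _ =>
    mul_nonneg (fluxNorm_nonneg _ _ _) (pow_nonneg hM _)
  suffices hsq : derivSq k (fun x => f (v x)) ≤ C * S ^ 2 * derivSq k v by
    refine (Real.sqrt_le_sqrt hsq).trans (le_of_eq ?_)
    rw [Real.sqrt_mul (by positivity), Real.sqrt_mul hC, Real.sqrt_sq hS0]
    rfl
  -- For `M = 0` no rescaling is possible, but then `v = 0` and `f ∘ v` is constant.
  rcases hM.eq_or_lt with h0 | h0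
  · have hv0 : (fun x => f (v x)) = fun _ => f 0 := by
      funext x
      have := hbd x
      rw [← h0] at this
      rw [abs_nonpos_iff.1 this]
    refine le_trans ?_ (mul_nonneg (by positivity) (derivSq_nonneg _ _))
    refine (derivSq_le_integral_iteratedFDeriv k (by rw [hv0]; exact contDiff_const)).trans ?_
    rw [hv0, iteratedFDeriv_const_of_ne (by omega)]
    simp
  · have hw : IsTrigPoly N (fun ξ => (M⁻¹ : ℝ) * c ξ) (fun x => M⁻¹ * v x) := by
      intro x
      rw [Complex.ofReal_mul, hv x, trigPoly, trigPoly, Finset.mul_sum]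
      exact Finset.sum_congr rfl fun ξ _ => by ring
    have hfC : ContDiff ℝ k fun y : ℝ => f (M * y) := hf.comp (contDiff_const.mul contDiff_id)
    have hMx : ∀ x, M * (M⁻¹ * v x) = v x := fun x => by field_simp
    -- Applied to `v / M` and `y ↦ f(My)`. The `i`-th derivative gains `M^i`, which is `M` times the
    -- factor in `S`; the remaining `M²` cancels the `M⁻²` from the rescaled energy.
    have h1 := h N _ _ (fun y => f (M * y)) (M * S) hw (fun x => by
      rw [abs_mul, abs_of_pos (inv_pos.2 h0), inv_mul_le_iff₀ h0, mul_one]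
      exact hbd x) hfC (by positivity) (fun x i hi1 hi => by
        rw [iteratedDeriv_comp_const_smul (hf.of_le (by exact_mod_cast hi)) M]
        simp only [hMx, norm_smul, norm_pow, Real.norm_eq_abs, abs_of_pos h0]
        have h2 : ‖iteratedDeriv i f (v x)‖ ≤ fluxNorm f M i :=
          le_csSup (bddAbove_fluxNorm hf hi M) ⟨v x, hbd x, rfl⟩
        have h3 : fluxNorm f M i * M ^ (i - 1) ≤ S :=
          Finset.single_le_sum (f := fun j => fluxNorm f M j * M ^ (j - 1))
            (fun j _ => mul_nonneg (fluxNorm_nonneg _ _ _) (pow_nonneg hM _))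
            (Finset.mem_Icc.2 ⟨hi1, hi⟩)
        calc M ^ i * ‖iteratedDeriv i f (v x)‖ ≤ M ^ i * fluxNorm f M i := by gcongr
          _ = M * (fluxNorm f M i * M ^ (i - 1)) := by
            obtain ⟨n, rfl⟩ : ∃ n, i = n + 1 := ⟨i - 1, by omega⟩
            rw [Nat.add_sub_cancel]; ring
          _ ≤ M * S := by gcongr)
    simp only [hMx] at h1
    rw [derivSq_const_smul k M⁻¹ hv] at h1
    refine h1.trans (le_of_eq ?_)
    field_simp

theorem compositionConst_nonneg (T : ℝ) (f : ℝ → Space d) (u : ℝ → Space d → ℝ) (k : ℕ) :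
    0 ≤ compositionConst T f u k :=
  Real.sInf_nonneg fun _ h => h.1

/-- The infimum that defines `𝒦_k` is attained. -/
theorem derivNorm_comp_le_compositionConst {T : ℝ} {f : ℝ → Space d} {u : ℝ → Space d → ℝ}
    {k : ℕ} {K : ℝ} (hK0 : 0 ≤ K)
    (hK : ∀ t ∈ Icc 0 T, derivNorm k (fun x => f (u t x)) ≤ K * derivNorm k (u t)) :
    (∀ t ∈ Icc 0 T, derivNorm k (fun x => f (u t x)) ≤
      compositionConst T f u k * derivNorm k (u t)) ∧ compositionConst T f u k ≤ K := by
  have hbdd : BddBelow {K | 0 ≤ K ∧ ∀ t ∈ Icc 0 T,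
    derivNorm k (fun x => f (u t x)) ≤ K * derivNorm k (u t)} := ⟨0, fun _ h => h.1⟩
  refine ⟨fun t ht => ?_, csInf_le hbdd ⟨hK0, hK⟩⟩
  -- When `∂^k u` vanishes the admissible `K` forces the left side to vanish too; otherwise one
  -- divides and takes the infimum.
  rcases (Real.sqrt_nonneg (derivSq k (u t))).eq_or_lt with h0 | h0
  · have := hK t ht
    rw [derivNorm, derivNorm, ← h0] at this
    rw [derivNorm, derivNorm, ← h0]
    simpa using this
  · change 0 < derivNorm k (u t) at h0
    rw [← div_le_iff₀ h0]
    refine le_csInf ⟨K, hK0, hK⟩ fun b hb => ?_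
    rw [div_le_iff₀ h0]
    exact hb.2 t ht

end Composition

/-! ### The system for the Fourier coefficients and its energy balance. -/

section SemiDiscrete

variable {d N : ℕ}

theorem periodicConv_trigPoly (b : (Fin d → ℤ) → ℂ) {φ : Space d → ℂ}
    (hφ : IntegrableOn φ (cell d)) :
    periodicConv (trigPoly N b) φ = trigPoly N fun ξ => b ξ * fourierCoefficient φ ξ := by
  funext x
  have h1 : ∀ y, trigPoly N b (x - y) * φ y =
      ∑ ξ ∈ freqs d N, b ξ * expWave ξ x * (φ y * expWave (-ξ) y) := by
    intro y
    rw [trigPoly, Finset.sum_mul]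
    refine Finset.sum_congr rfl fun ξ _ => ?_
    rw [sub_eq_add_neg, expWave_add_apply, expWave_neg]
    ring
  rw [periodicConv]
  simp only [h1]
  rw [integral_finsetSum]
  · rw [trigPoly, Finset.mul_sum]
    refine Finset.sum_congr rfl fun ξ _ => ?_
    rw [integral_const_mul, fourierCoefficient]
    ring
  · intro ξ _
    refine Integrable.const_mul (Integrable.mul_bdd (c := 1) hφ
      (contDiff_expWave (n := 0) (-ξ)).continuous.aestronglyMeasurable ?_) _
    exact Eventually.of_forall fun x => (norm_expWave _ _).le

theorem viscosityKernel_eq (m : ℝ) (q : ℝ → ℝ) :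
    viscosityKernel (d := d) N m q =
      trigPoly N fun ξ => ((if m ≤ ‖freqVec ξ‖ then q ‖freqVec ξ‖ else 0 : ℝ) : ℂ) := by
  funext x
  rw [viscosityKernel, trigPoly, Finset.sum_filter]
  refine Finset.sum_congr rfl fun ξ _ => ?_
  split_ifs <;> simp

/-- The quadratic form `∑_{j,k} ξ_j ξ_k Q̂^{j,k}_ξ` of the viscosity kernel. -/
def viscosityForm (m : ℝ) (q : Fin d → Fin d → ℝ → ℝ) (ξ : Fin d → ℤ) : ℝ :=
  ∑ j, ∑ k, (ξ j : ℝ) * ξ k * if m ≤ ‖freqVec ξ‖ then q j k ‖freqVec ξ‖ else 0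

/-- The Fourier coefficients of the right-hand side of the semi-discrete equation. -/
def svvCoefficient (f : ℝ → Space d) (μ : Measure (Space d)) (ε m : ℝ)
    (q : Fin d → Fin d → ℝ → ℝ) (v : Space d → ℝ) (c : (Fin d → ℤ) → ℂ) (ξ : Fin d → ℤ) : ℂ :=
  -(∑ j, Complex.I * ξ j * fourierCoefficient (fun y => ((f (v y) j : ℝ) : ℂ)) ξ)
    + levySymbol μ (freqVec ξ) * c ξ - ((ε * viscosityForm m q ξ : ℝ) : ℂ) * c ξ

theorem trigPoly_add (b c : (Fin d → ℤ) → ℂ) (x : Space d) :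
    trigPoly N (fun ξ => b ξ + c ξ) x = trigPoly N b x + trigPoly N c x := by
  simp [trigPoly, add_mul, Finset.sum_add_distrib]

theorem trigPoly_sum {ι : Type*} (s : Finset ι) (b : ι → (Fin d → ℤ) → ℂ) (x : Space d) :
    trigPoly N (fun ξ => ∑ i ∈ s, b i ξ) x = ∑ i ∈ s, trigPoly N (b i) x := by
  simp only [trigPoly, Finset.sum_mul]
  exact Finset.sum_comm

theorem trigPoly_const_mul (a : ℂ) (c : (Fin d → ℤ) → ℂ) (x : Space d) :
    trigPoly N (fun ξ => a * c ξ) x = a * trigPoly N c x := by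
  simp [trigPoly, Finset.mul_sum, mul_assoc]

theorem trigPoly_congr {b c : (Fin d → ℤ) → ℂ} (h : ∀ ξ ∈ freqs d N, b ξ = c ξ) :
    trigPoly N b = trigPoly N c := by
  funext x
  exact Finset.sum_congr rfl fun ξ hξ => by rw [h ξ hξ]

theorem IsTrigPoly.fourierCoefficient_eq {c : (Fin d → ℤ) → ℂ} {v : Space d → ℝ}
    (hv : IsTrigPoly N c v) {ξ : Fin d → ℤ} (hξ : ξ ∈ freqs d N) :
    fourierCoefficient (fun y => (v y : ℂ)) ξ = c ξ := by
  have : (fun y => (v y : ℂ)) = trigPoly N c := funext hv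
  rw [this, fourierCoefficient_trigPoly c hξ]

theorem svvRHS_eq_trigPoly {f : ℝ → Space d} {μ : Measure (Space d)} (hμ : IsLevyMeasure μ)
    {ε m : ℝ} {q : Fin d → Fin d → ℝ → ℝ} {v : Space d → ℝ} {c : (Fin d → ℤ) → ℂ}
    (hv : IsTrigPoly N c v) (x : Space d) :
    svvRHS N f μ ε m q v x = trigPoly N (svvCoefficient f μ ε m q v c) x := by
  have h1 : ∀ j, partialD j (fourierProj N fun y => ((f (v y) j : ℝ) : ℂ)) x =
      trigPoly N (fun ξ => Complex.I * ξ j *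
        fourierCoefficient (fun y => ((f (v y) j : ℝ) : ℂ)) ξ) x := by
    intro j
    exact congrFun (partialD_trigPoly (N := N)
      (fourierCoefficient fun y => ((f (v y) j : ℝ) : ℂ)) j) x
  have hint : IntegrableOn (fun y => (v y : ℂ)) (cell d) :=
    integrableOn_cell _ (Complex.continuous_ofReal.comp (hv.contDiff (n := 0)).continuous)
  have h2 : ∀ j k, partialD j (partialD k
      (periodicConv (viscosityKernel N m (q j k)) fun y => (v y : ℂ))) x =
      trigPoly N (fun ξ => ((-((ξ j : ℝ) * ξ k *
        if m ≤ ‖freqVec ξ‖ then q j k ‖freqVec ξ‖ else 0) : ℝ) : ℂ) * c ξ) x := by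
    intro j k
    rw [viscosityKernel_eq, periodicConv_trigPoly _ hint, partialD_trigPoly, partialD_trigPoly]
    refine congrFun (trigPoly_congr fun ξ hξ => ?_) x
    rw [hv.fourierCoefficient_eq hξ]
    push_cast
    linear_combination (ξ j : ℂ) * ξ k *
      ((if m ≤ ‖freqVec ξ‖ then q j k ‖freqVec ξ‖ else 0 : ℝ) : ℂ) * c ξ * Complex.I_sq
  rw [svvRHS]
  simp only [h1, h2]
  rw [hμ.levyOp_trigPoly hv x]
  simp only [← trigPoly_sum]
  rw [← trigPoly_const_mul, ← neg_one_mul, ← trigPoly_const_mul, ← trigPoly_add, ← trigPoly_add]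
  refine congrFun (trigPoly_congr fun ξ _ => ?_) x
  rw [svvCoefficient, viscosityForm, Finset.sum_congr rfl fun j _ => (Finset.sum_mul _ _ _).symm,
    ← Finset.sum_mul]
  push_cast
  simp only [Finset.sum_neg_distrib]
  ring

/-- The Fourier coefficients of a solution satisfy a system of ordinary differential equations. -/
theorem IsSVVSolution.exists_coefficients {T : ℝ} {f : ℝ → Space d} {μ : Measure (Space d)}
    (hμ : IsLevyMeasure μ) {u₀ : Space d → ℝ} {ε m : ℝ} {Q : Fin d → Fin d → ℝ → ℝ → ℝ}
    {u : ℝ → Space d → ℝ} (h : IsSVVSolution N T f μ u₀ ε m Q u) :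
    ∃ c : (Fin d → ℤ) → ℝ → ℂ, (∀ ξ ∈ freqs d N, ContinuousOn (c ξ) (Icc 0 T)) ∧
      (∀ t ∈ Icc 0 T, IsTrigPoly N (fun ξ => c ξ t) (u t)) ∧
      ∀ t ∈ Ioo 0 T, ∀ ξ ∈ freqs d N, HasDerivAt (c ξ)
        (svvCoefficient f μ ε m (fun j k p => Q j k p t) (u t) (fun ξ => c ξ t) ξ) t := by
  obtain ⟨c, hc, hu⟩ := h.expansion
  have hrep : ∀ t ∈ Icc 0 T, IsTrigPoly N (fun ξ => c ξ t) (u t) := fun t ht x => hu t ht x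
  refine ⟨c, fun ξ hξ => (hc ξ hξ).1, hrep, fun t ht ξ hξ => ?_⟩
  have hder : ∀ ξ ∈ freqs d N, HasDerivAt (c ξ) (deriv (c ξ) t) t := fun ξ hξ =>
    ((hc ξ hξ).2.differentiableAt (isOpen_Ioo.mem_nhds ht)).hasDerivAt
  -- Both sides are time derivatives of `u` at `x`, one from the expansion and one from the
  -- equation; orthogonality then identifies the coefficients.
  have heq : ∀ x, trigPoly N (fun ξ => deriv (c ξ) t) x =
      trigPoly N (svvCoefficient f μ ε m (fun j k p => Q j k p t) (u t) (fun ξ => c ξ t)) x := by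
    intro x
    rw [← svvRHS_eq_trigPoly hμ (hrep t (Ioo_subset_Icc_self ht)) x]
    have h1 : HasDerivAt (fun τ => ∑ ξ ∈ freqs d N, c ξ τ * expWave ξ x)
        (∑ ξ ∈ freqs d N, deriv (c ξ) t * expWave ξ x) t :=
      HasDerivAt.fun_sum fun ξ hξ => (hder ξ hξ).mul_const _
    refine h1.unique ((h.equation t ht x).congr_of_eventuallyEq ?_)
    filter_upwards [isOpen_Ioo.mem_nhds ht] with τ hτ
    exact (hu τ (Ioo_subset_Icc_self hτ) x).symm
  have h2 := fourierCoefficient_trigPoly (N := N) (fun ξ => deriv (c ξ) t) hξ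
  rw [funext heq, fourierCoefficient_trigPoly _ hξ] at h2
  rw [h2]
  exact hder ξ hξ

/-! ### The dissipation of the viscosity -/

theorem abs_le_norm_freqVec (ξ : Fin d → ℤ) (j : Fin d) : |(ξ j : ℝ)| ≤ ‖freqVec ξ‖ := by
  simpa [freqVec] using PiLp.norm_apply_le (freqVec ξ) j

/-- For `|ξ| ≥ m` each of the `d²` entries deviates from the identity by at most `B m²/|ξ|²`, while
`|ξ_j ξ_k| ≤ |ξ|²`, so the loss is `d² B ε m²`. For `|ξ| < m` the form vanishes, but `ε|ξ|² ≤ ε m² ≤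
A`. -/
theorem viscosityForm_ge {ε m A B : ℝ} {q : Fin d → Fin d → ℝ → ℝ} (hε : 0 ≤ ε) (hB : 0 ≤ B)
    (hA : ε * m ^ 2 ≤ A)
    (hq : ∀ j k, ∀ p ∈ Icc m (N : ℝ), |q j k p - if j = k then 1 else 0| ≤ B * m ^ 2 / p ^ 2)
    {ξ : Fin d → ℤ} (hξ : ξ ∈ freqs d N) :
    ε * ‖freqVec ξ‖ ^ 2 - A * (1 + d ^ 2 * B) ≤ ε * viscosityForm m q ξ := by
  have hA0 : 0 ≤ A := le_trans (by positivity) hA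
  have hp0 := norm_nonneg (freqVec ξ)
  by_cases hm : m ≤ ‖freqVec ξ‖
  · set p := ‖freqVec ξ‖ with hp
    have hmem : p ∈ Icc m (N : ℝ) := ⟨hm, mem_freqs.1 hξ⟩
    have hterm : ∀ j k, (ξ j : ℝ) * ξ k * (if j = k then 1 else 0) - B * m ^ 2 ≤
        (ξ j : ℝ) * ξ k * q j k p := by
      intro j k
      have h1 : |(ξ j : ℝ) * ξ k * (q j k p - if j = k then 1 else 0)| ≤ B * m ^ 2 := by
        rw [abs_mul, abs_mul]
        have hjk : |(ξ j : ℝ)| * |(ξ k : ℝ)| ≤ p ^ 2 := by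
          rw [sq]
          exact mul_le_mul (abs_le_norm_freqVec ξ j) (abs_le_norm_freqVec ξ k) (abs_nonneg _) hp0
        calc _ ≤ p ^ 2 * (B * m ^ 2 / p ^ 2) :=
              mul_le_mul hjk (hq j k p hmem) (abs_nonneg _) (sq_nonneg _)
          _ ≤ B * m ^ 2 := by
              rcases eq_or_ne p 0 with h0 | h0
              · rw [h0]; simp; positivity
              · rw [mul_div_cancel₀ _ (pow_ne_zero 2 h0)]
      have h2 := (abs_le.1 h1).1
      rw [mul_sub] at h2
      linarith
    have hsum : p ^ 2 - d ^ 2 * (B * m ^ 2) ≤ viscosityForm m q ξ := by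
      have h3 : ∑ j : Fin d, ∑ k : Fin d,
          ((ξ j : ℝ) * ξ k * (if j = k then 1 else 0) - B * m ^ 2) ≤ viscosityForm m q ξ := by
        rw [viscosityForm]
        refine Finset.sum_le_sum fun j _ => Finset.sum_le_sum fun k _ => ?_
        rw [if_pos hm]
        exact hterm j k
      refine le_trans (le_of_eq ?_) h3
      rw [norm_freqVec_sq]
      simp [Finset.sum_sub_distrib, sq, mul_assoc]
    have h4 := mul_le_mul_of_nonneg_left hsum hε
    have h5 : (d : ℝ) ^ 2 * B * (ε * m ^ 2) ≤ d ^ 2 * B * A :=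
      mul_le_mul_of_nonneg_left hA (by positivity)
    nlinarith
  · have h0 : viscosityForm m q ξ = 0 := by simp [viscosityForm, hm]
    have h1 : ‖freqVec ξ‖ ^ 2 ≤ m ^ 2 := pow_le_pow_left₀ hp0 (not_le.1 hm).le 2
    have h2 := mul_le_mul_of_nonneg_left h1 hε
    have h3 : 0 ≤ A * (d ^ 2 * B) := by positivity
    rw [h0]
    nlinarith

/-! ### The convection term -/

/-- The weighted energy `(2π)^d ∑ W(ξ) |c_ξ|²`. -/
def energy (N : ℕ) (W : (Fin d → ℤ) → ℝ) (c : (Fin d → ℤ) → ℂ) : ℝ :=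
  (2 * Real.pi) ^ d * ∑ ξ ∈ freqs d N, W ξ * ‖c ξ‖ ^ 2

/-- The contribution of the convection to the growth of the weighted energy. -/
def convection (N : ℕ) (f : ℝ → Space d) (v : Space d → ℝ) (W : (Fin d → ℤ) → ℝ)
    (c : (Fin d → ℤ) → ℂ) : ℝ :=
  (2 * Real.pi) ^ d * ∑ ξ ∈ freqs d N, W ξ * ∑ j, (-((starRingEnd ℂ) (c ξ) *
    (Complex.I * ξ j * fourierCoefficient (fun y => ((f (v y) j : ℝ) : ℂ)) ξ))).re

theorem conj_prod_wave_mul (ξ : Fin d → ℤ) (l : List (Fin d)) :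
    (starRingEnd ℂ) (l.map fun j => Complex.I * (ξ j : ℂ)).prod *
      (l.map fun j => Complex.I * (ξ j : ℂ)).prod = ((l.map fun j => (ξ j : ℝ) ^ 2).prod : ℝ) := by
  rw [← norm_prod_wave, mul_comm, Complex.mul_conj, Complex.normSq_eq_norm_sq]

/-- Parseval for `∂^l f_j(v)` against `∂_j ∂^l v`. The minus sign is absorbed by conjugating the
factor `i ξ_j`, so the divergence has moved onto `v`. -/
theorem convection_word (j : Fin d) (l : List (Fin d)) {f : ℝ → Space d}
    (hf : ContDiff ℝ (l.length : ℕ) f) {v : Space d → ℝ} {c : (Fin d → ℤ) → ℂ}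
    (hv : IsTrigPoly N c v) :
    (2 * Real.pi) ^ d * ∑ ξ ∈ freqs d N, (l.map fun i => (ξ i : ℝ) ^ 2).prod *
      (-((starRingEnd ℂ) (c ξ) *
        (Complex.I * ξ j * fourierCoefficient (fun y => ((f (v y) j : ℝ) : ℂ)) ξ))).re =
      ∫ x in cell d, listD l (fun y => f (v y)) x j * listD (j :: l) v x := by
  have hfv : ContDiff ℝ (l.length : ℕ) fun y => f (v y) := hf.comp hv.contDiff
  let L : Space d →L[ℝ] ℂ := Complex.ofRealCLM.comp (EuclideanSpace.proj j)
  have h1 : listD l (fun y => ((f (v y) j : ℝ) : ℂ)) =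
      fun x => ((listD l (fun y => f (v y)) x j : ℝ) : ℂ) := listD_clm L l hfv
  have hcont : Continuous fun x => listD l (fun y => f (v y)) x j :=
    (EuclideanSpace.proj (𝕜 := ℝ) j).continuous.comp
      (contDiff_listD l 0 (by rwa [zero_add])).continuous
  have h2 := integral_mul_conj_trigPoly (N := N)
    (fun ξ => ((j :: l).map fun i => Complex.I * (ξ i : ℂ)).prod * c ξ)
    (integrableOn_cell _ (Complex.continuous_ofReal.comp hcont))
  simp only [← hv.listD (j :: l) _, Complex.conj_ofReal, Function.comp_apply,
    ← Complex.ofReal_mul] at h2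
  rw [integral_complex_ofReal] at h2
  have h3 := congrArg Complex.re h2
  rw [Complex.ofReal_re] at h3
  rw [h3, ← Complex.ofReal_pow, Complex.re_ofReal_mul, Complex.re_sum]
  congr 1
  refine Finset.sum_congr rfl fun ξ _ => ?_
  have h4 : fourierCoefficient (Complex.ofReal ∘ fun x => listD l (fun y => f (v y)) x j) ξ =
      (l.map fun i => Complex.I * (ξ i : ℂ)).prod *
        fourierCoefficient (fun y => ((f (v y) j : ℝ) : ℂ)) ξ := by
    have h5 := fourierCoefficient_listD l (φ := fun y => ((f (v y) j : ℝ) : ℂ))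
      (L.contDiff.comp hfv) ((hv.isPeriodic.comp f).comp fun y => ((y j : ℝ) : ℂ)) ξ
    rw [h1] at h5
    exact h5
  rw [h4, ← Complex.re_ofReal_mul, ← conj_prod_wave_mul]
  congr 1
  simp only [List.map_cons, List.prod_cons, map_mul, Complex.conj_I, map_intCast]
  ring

/-- The pointwise inequality `ab ≤ a²/ε + ε b²/4`. The last energy is the sum of `‖∂_j ∂^α v‖²` over
all `j` and `α`, which counts mixed derivatives repeatedly and is exactly the viscous dissipation.
-/
theorem convection_sobWeight_le {s : ℕ} {f : ℝ → Space d} (hf : ContDiff ℝ s f)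
    {v : Space d → ℝ} {c : (Fin d → ℤ) → ℂ} (hv : IsTrigPoly N c v) {ε : ℝ} (hε : 0 < ε) :
    convection N f v (sobWeight s) c ≤ 1 / ε * derivSq s (fun x => f (v x)) +
      ε / 4 * energy N (fun ξ => ‖freqVec ξ‖ ^ 2 * sobWeight s ξ) c := by
  set A := Finset.piAntidiag (Finset.univ : Finset (Fin d)) s with hA
  have hE : energy N (fun ξ => ‖freqVec ξ‖ ^ 2 * sobWeight s ξ) c =
      ∑ α ∈ A, ∫ x in cell d, ∑ j, ‖listD (j :: wordOf α) v x‖ ^ 2 := by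
    have h1 : ∀ α, ∫ x in cell d, ∑ j, ‖listD (j :: wordOf α) v x‖ ^ 2 =
        (2 * Real.pi) ^ d * ∑ ξ ∈ freqs d N,
          ‖freqVec ξ‖ ^ 2 * (∏ i, ((ξ i : ℝ) ^ 2) ^ α i) * ‖c ξ‖ ^ 2 := by
      intro α
      rw [integral_finsetSum]
      · simp only [(hv.listD _).integral_sq, ← Finset.mul_sum]
        rw [Finset.sum_comm]
        congr 1
        refine Finset.sum_congr rfl fun ξ _ => ?_
        rw [norm_freqVec_sq, Finset.sum_mul, Finset.sum_mul]
        refine Finset.sum_congr rfl fun j _ => ?_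
        rw [norm_mul, mul_pow, norm_prod_wave, List.map_cons, List.prod_cons, prod_wordOf]
      · intro j _
        exact integrableOn_cell (fun x => ‖listD (j :: wordOf α) v x‖ ^ 2)
          (((hv.listD (j :: wordOf α)).contDiff (n := 0)).continuous.norm.pow 2)
    simp only [h1, ← Finset.mul_sum]
    rw [energy, Finset.sum_comm]
    congr 1
    refine Finset.sum_congr rfl fun ξ _ => ?_
    rw [sobWeight, Finset.mul_sum, Finset.sum_mul]
  have hC : convection N f v (sobWeight s) c =
      ∑ α ∈ A, ∑ j, ∫ x in cell d,
        listD (wordOf α) (fun y => f (v y)) x j * listD (j :: wordOf α) v x := by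
    have h1 : ∀ α ∈ A, ∀ j, ∫ x in cell d,
        listD (wordOf α) (fun y => f (v y)) x j * listD (j :: wordOf α) v x = _ :=
      fun α hα j => (convection_word j (wordOf α)
        (by rw [length_wordOf_of_mem hα]; exact hf) hv).symm
    rw [Finset.sum_congr rfl fun α hα => Finset.sum_congr rfl fun j _ => h1 α hα j]
    simp only [← Finset.mul_sum, prod_wordOf, convection]
    congr 1
    rw [Finset.sum_congr rfl fun α _ => Finset.sum_comm, Finset.sum_comm]
    refine Finset.sum_congr rfl fun ξ _ => ?_
    rw [sobWeight, Finset.sum_mul]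
    exact Finset.sum_congr rfl fun α _ => Finset.mul_sum _ _ _
  rw [hE, hC, derivSq, Finset.mul_sum, Finset.mul_sum, ← Finset.sum_add_distrib]
  refine Finset.sum_le_sum fun α hα => ?_
  have hfv : ContDiff ℝ (0 + (wordOf α).length : ℕ) fun y => f (v y) := by
    rw [zero_add, length_wordOf_of_mem hα]; exact hf.comp hv.contDiff
  have hc1 : Continuous (listD (wordOf α) fun y => f (v y)) :=
    (contDiff_listD (wordOf α) 0 hfv).continuous
  have hc1j : ∀ j, Continuous fun x => listD (wordOf α) (fun y => f (v y)) x j := fun j =>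
    (EuclideanSpace.proj (𝕜 := ℝ) j).continuous.comp hc1
  have hc2 : ∀ j, Continuous (listD (j :: wordOf α) v) := fun j =>
    ((hv.listD (j :: wordOf α)).contDiff (n := 0)).continuous
  have hi1 : ∀ j, IntegrableOn
      (fun x => listD (wordOf α) (fun y => f (v y)) x j * listD (j :: wordOf α) v x) (cell d) :=
    fun j => integrableOn_cell _ ((hc1j j).mul (hc2 j))
  have hi2 : IntegrableOn
      (fun x => 1 / ε * ‖listD (wordOf α) (fun y => f (v y)) x‖ ^ 2) (cell d) :=
    integrableOn_cell _ (continuous_const.mul (hc1.norm.pow 2))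
  have hi3 : IntegrableOn
      (fun x => ε / 4 * ∑ j, ‖listD (j :: wordOf α) v x‖ ^ 2) (cell d) :=
    integrableOn_cell _ (continuous_const.mul
      (continuous_finsetSum _ fun j _ => (hc2 j).norm.pow 2))
  rw [multiD_eq_listD, ← integral_finsetSum _ fun j _ => hi1 j, ← integral_const_mul,
    ← integral_const_mul, ← integral_add hi2 hi3]
  refine integral_mono (integrable_finsetSum _ fun j _ => hi1 j) (hi2.add hi3) fun x => ?_
  simp only
  rw [EuclideanSpace.norm_sq_eq, Finset.mul_sum, Finset.mul_sum, ← Finset.sum_add_distrib]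
  refine Finset.sum_le_sum fun j _ => ?_
  rw [Real.norm_eq_abs, Real.norm_eq_abs, sq_abs, sq_abs]
  set a := listD (wordOf α) (fun y => f (v y)) x j
  set b := listD (j :: wordOf α) v x
  have h1 : 0 ≤ 1 / ε * (a - ε / 2 * b) ^ 2 := by positivity
  have h2 : 1 / ε * (a - ε / 2 * b) ^ 2 = 1 / ε * a ^ 2 + ε / 4 * b ^ 2 - a * b := by
    field_simp; ring
  linarith

/-- Without derivatives the convection does not contribute: it is in divergence form. -/
theorem convection_zero {f : ℝ → Space d} (hf : Continuous f)
    {v : Space d → ℝ} {c : (Fin d → ℤ) → ℂ} (hv : IsTrigPoly N c v) :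
    convection N f v (sobWeight 0) c = 0 := by
  have h1 := fun j => convection_word (N := N) j [] (f := f) (by simpa using hf) hv
  simp only [List.map_nil, List.prod_nil, one_mul] at h1
  have h2 : ∀ j, ∫ x in cell d, listD [] (fun y => f (v y)) x j * listD [j] v x = 0 := by
    intro j
    have hfj : Continuous fun y => f y j := (EuclideanSpace.proj (𝕜 := ℝ) j).continuous.comp hf
    -- With this primitive, `f_j(v) ∂_j v = ∂_j F(v)` has mean zero.
    set F : ℝ → ℝ := fun y => ∫ z in (0 : ℝ)..y, f z j with hF
    have hder : ∀ y, HasDerivAt F (f y j) y := fun y =>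
      intervalIntegral.integral_hasDerivAt_right (hfj.intervalIntegrable _ _)
        (hfj.stronglyMeasurableAtFilter _ _) hfj.continuousAt
    have hFC : ContDiff ℝ 1 F := by
      rw [contDiff_one_iff_deriv]
      refine ⟨fun y => (hder y).differentiableAt, ?_⟩
      rw [funext fun y => (hder y).deriv]
      exact hfj
    have h3 := integral_partialD_eq_zero j (hFC.comp (hv.contDiff (n := 1)))
      (hv.isPeriodic.comp F)
    rw [← h3]
    refine integral_congr_ae (Eventually.of_forall fun x => ?_)
    have h4 := ((hder (v x)).comp_hasFDerivAt x
      ((hv.contDiff (n := 1)).differentiable (by simp) x).hasFDerivAt).fderiv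
    simp only [listD_nil, listD_cons, partialD]
    rw [h4]
    simp
  simp only [h2] at h1
  simp only [convection, sobWeight_zero, one_mul]
  rw [Finset.sum_comm, Finset.mul_sum]
  exact Finset.sum_eq_zero fun j _ => h1 j

/-! ### The energy balance -/

/-- The estimate holds frequency by frequency: the symbol and the viscosity are multipliers, so any
nonnegative weight passes through. -/
theorem energy_balance_le {f : ℝ → Space d} {μ : Measure (Space d)} (hμ : IsLevyMeasure μ)
    {ε m R : ℝ} {q : Fin d → Fin d → ℝ → ℝ} {v : Space d → ℝ} {c : (Fin d → ℤ) → ℂ}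
    (hq : ∀ ξ ∈ freqs d N, ε * ‖freqVec ξ‖ ^ 2 - R ≤ ε * viscosityForm m q ξ)
    {W : (Fin d → ℤ) → ℝ} (hW : ∀ ξ, 0 ≤ W ξ) :
    (2 * Real.pi) ^ d * ∑ ξ ∈ freqs d N,
        W ξ * (2 * inner ℝ (c ξ) (svvCoefficient f μ ε m q v c ξ)) ≤
      2 * convection N f v W c - 2 * ε * energy N (fun ξ => ‖freqVec ξ‖ ^ 2 * W ξ) c +
        2 * R * energy N W c := by
  have hpi : 0 < Real.pi := Real.pi_pos
  have hterm : ∀ ξ ∈ freqs d N,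
      W ξ * (2 * inner ℝ (c ξ) (svvCoefficient f μ ε m q v c ξ)) ≤
        2 * (W ξ * ∑ j, (-((starRingEnd ℂ) (c ξ) * (Complex.I * ξ j *
          fourierCoefficient (fun y => ((f (v y) j : ℝ) : ℂ)) ξ))).re) -
        2 * ε * (‖freqVec ξ‖ ^ 2 * W ξ * ‖c ξ‖ ^ 2) + 2 * R * (W ξ * ‖c ξ‖ ^ 2) := by
    intro ξ hξ
    have hin : inner ℝ (c ξ) (svvCoefficient f μ ε m q v c ξ) =
        (∑ j, (-((starRingEnd ℂ) (c ξ) * (Complex.I * ξ j *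
          fourierCoefficient (fun y => ((f (v y) j : ℝ) : ℂ)) ξ))).re) +
        ((levySymbol μ (freqVec ξ)).re - ε * viscosityForm m q ξ) * ‖c ξ‖ ^ 2 := by
      have hcc : (starRingEnd ℂ) (c ξ) * c ξ = ((‖c ξ‖ ^ 2 : ℝ) : ℂ) := by
        rw [mul_comm, Complex.mul_conj, Complex.normSq_eq_norm_sq]
      have e : (starRingEnd ℂ) (c ξ) * svvCoefficient f μ ε m q v c ξ =
          (∑ j, -((starRingEnd ℂ) (c ξ) * (Complex.I * ξ j *
            fourierCoefficient (fun y => ((f (v y) j : ℝ) : ℂ)) ξ))) +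
          ((‖c ξ‖ ^ 2 : ℝ) : ℂ) * levySymbol μ (freqVec ξ) -
          ((ε * viscosityForm m q ξ * ‖c ξ‖ ^ 2 : ℝ) : ℂ) := by
        rw [Complex.ofReal_mul (ε * viscosityForm m q ξ), ← hcc, svvCoefficient,
          Finset.sum_neg_distrib, ← Finset.mul_sum]
        ring
      have h1 : inner ℝ (c ξ) (svvCoefficient f μ ε m q v c ξ) =
          ((starRingEnd ℂ) (c ξ) * svvCoefficient f μ ε m q v c ξ).re := by
        rw [Complex.inner, mul_comm]
      rw [h1, e, Complex.sub_re, Complex.add_re, Complex.re_sum, Complex.re_ofReal_mul,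
        Complex.ofReal_re]
      ring
    rw [hin]
    have h2 := hμ.re_levySymbol_nonpos (freqVec ξ)
    have h3 := hq ξ hξ
    have h4 : 0 ≤ W ξ * ‖c ξ‖ ^ 2 := mul_nonneg (hW ξ) (sq_nonneg _)
    have h5 := mul_le_mul_of_nonneg_right
      (show (levySymbol μ (freqVec ξ)).re - ε * viscosityForm m q ξ ≤
        -(ε * ‖freqVec ξ‖ ^ 2) + R by linarith) h4
    nlinarith
  calc _ ≤ (2 * Real.pi) ^ d * ∑ ξ ∈ freqs d N, _ :=
        mul_le_mul_of_nonneg_left (Finset.sum_le_sum hterm) (by positivity)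
    _ = _ := by
        rw [Finset.sum_add_distrib, Finset.sum_sub_distrib, ← Finset.mul_sum, ← Finset.mul_sum,
          ← Finset.mul_sum, convection, energy, energy]
        ring

end SemiDiscrete

/-! ### Differential inequalities and their integration in time. -/

section TimeIntegration

variable {d N : ℕ}

theorem norm_freqVec_sq_eq_sobWeight (ξ : Fin d → ℤ) : ‖freqVec ξ‖ ^ 2 = sobWeight 1 ξ := by
  have h1 : ∀ j : Fin d, Pi.single j 1 ∈ Finset.piAntidiag (Finset.univ : Finset (Fin d)) 1 := by
    intro j
    simp [Finset.mem_piAntidiag]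
  refine le_antisymm ?_ (sobWeight_one_le ξ)
  rw [norm_freqVec_sq, sobWeight]
  calc ∑ j, (ξ j : ℝ) ^ 2 = ∑ j, ∏ i, ((ξ i : ℝ) ^ 2) ^ (Pi.single j 1 : Fin d → ℕ) i := by
        refine Finset.sum_congr rfl fun j _ => ?_
        rw [Finset.prod_eq_single j (fun i _ hi => by simp [hi]) (by simp)]
        simp
    _ = ∑ α ∈ Finset.univ.image fun j : Fin d => (Pi.single j 1 : Fin d → ℕ),
          ∏ i, ((ξ i : ℝ) ^ 2) ^ α i := by
        rw [Finset.sum_image]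
        intro i _ j _ hij
        by_contra hne
        have := congrFun hij i
        simp [hne] at this
    _ ≤ _ := Finset.sum_le_sum_of_subset_of_nonneg
        (by intro α hα; obtain ⟨j, -, rfl⟩ := Finset.mem_image.1 hα; exact h1 j)
        fun α _ _ => Finset.prod_nonneg fun _ _ => by positivity

theorem energy_mono {W W' : (Fin d → ℤ) → ℝ} (h : ∀ ξ, W ξ ≤ W' ξ) (c : (Fin d → ℤ) → ℂ) :
    energy N W c ≤ energy N W' c := by
  have : 0 < Real.pi := Real.pi_pos
  unfold energy
  gcongr with ξ _
  exact h ξ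

theorem energy_nonneg {W : (Fin d → ℤ) → ℝ} (h : ∀ ξ, 0 ≤ W ξ) (c : (Fin d → ℤ) → ℂ) :
    0 ≤ energy N W c := by
  have : 0 < Real.pi := Real.pi_pos
  exact mul_nonneg (by positivity)
    (Finset.sum_nonneg fun ξ _ => mul_nonneg (h ξ) (sq_nonneg _))

theorem energy_linear (a b : ℝ) (W W' : (Fin d → ℤ) → ℝ) (c : (Fin d → ℤ) → ℂ) :
    energy N (fun ξ => a * W ξ + b * W' ξ) c = a * energy N W c + b * energy N W' c := by
  simp only [energy, add_mul, Finset.sum_add_distrib, mul_assoc, ← Finset.mul_sum]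
  ring

theorem energy_smul (a : ℝ) (W : (Fin d → ℤ) → ℝ) (c : (Fin d → ℤ) → ℂ) :
    energy N (fun ξ => a * W ξ) c = a * energy N W c := by
  simpa using energy_linear (N := N) a 0 W W c

theorem continuousOn_energy {I : Set ℝ} {c : (Fin d → ℤ) → ℝ → ℂ}
    (hc : ∀ ξ ∈ freqs d N, ContinuousOn (c ξ) I) (W : (Fin d → ℤ) → ℝ) :
    ContinuousOn (fun t => energy N W fun ξ => c ξ t) I :=
  continuousOn_const.mul (continuousOn_finsetSum _ fun ξ hξ =>
    continuousOn_const.mul ((hc ξ hξ).norm.pow 2))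

theorem sqrt_add_le_add_sqrt {a b : ℝ} (ha : 0 ≤ a) (hb : 0 ≤ b) : √(a + b) ≤ √a + √b := by
  refine Real.sqrt_le_iff.2 ⟨by positivity, ?_⟩
  nlinarith [Real.sq_sqrt ha, Real.sq_sqrt hb, mul_nonneg (Real.sqrt_nonneg a) (Real.sqrt_nonneg b)]

theorem sqrt_mul_sq {a b : ℝ} (ha : 0 ≤ a) (hb : 0 ≤ b) : √(a * b ^ 2) = √a * b := by
  rw [Real.sqrt_mul ha, Real.sqrt_sq hb]

/-- Only the upper bound for `y'` is integrated; `y'` itself need not be integrable, as it is merely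
chosen pointwise later. -/
theorem integral_bounds_of_deriv_le {T G : ℝ} (hT : 0 ≤ T) {y y' D g : ℝ → ℝ}
    (hy : ContinuousOn y (Icc 0 T)) (hD : ContinuousOn D (Icc 0 T)) (hg : ContinuousOn g (Icc 0 T))
    (hy0 : ∀ t ∈ Icc 0 T, 0 ≤ y t) (hD0 : ∀ t ∈ Icc 0 T, 0 ≤ D t) (hg0 : ∀ t ∈ Icc 0 T, 0 ≤ g t)
    (hder : ∀ t ∈ Ioo 0 T, HasDerivAt y (y' t) t) (hle : ∀ t ∈ Ioo 0 T, y' t ≤ g t - D t)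
    (hG : ∫ t in (0 : ℝ)..T, g t ≤ G) :
    (∀ t ∈ Icc 0 T, y t ≤ y 0 + G) ∧ ∫ t in (0 : ℝ)..T, D t ≤ y 0 + G := by
  have key : ∀ t ∈ Icc 0 T, y t - y 0 ≤ (∫ τ in (0 : ℝ)..t, g τ) - ∫ τ in (0 : ℝ)..t, D τ := by
    intro t ht
    have hsub : Icc 0 t ⊆ Icc 0 T := Icc_subset_Icc_right ht.2
    have hgi : IntervalIntegrable g volume 0 t :=
      (hg.mono (by rw [uIcc_of_le ht.1]; exact hsub)).intervalIntegrable
    have hDi : IntervalIntegrable D volume 0 t :=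
      (hD.mono (by rw [uIcc_of_le ht.1]; exact hsub)).intervalIntegrable
    rw [← intervalIntegral.integral_sub hgi hDi]
    refine intervalIntegral.sub_le_integral_of_hasDeriv_right_of_le ht.1 (hy.mono hsub)
      (fun x hx => (hder x ⟨hx.1, hx.2.trans_le ht.2⟩).hasDerivWithinAt) ?_
      (fun x hx => hle x ⟨hx.1, hx.2.trans_le ht.2⟩)
    exact ((hg.mono hsub).sub (hD.mono hsub)).integrableOn_Icc
  constructor
  · intro t ht
    have hsub : Icc 0 t ⊆ Icc 0 T := Icc_subset_Icc_right ht.2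
    have h1 : ∫ τ in (0 : ℝ)..t, g τ ≤ ∫ τ in (0 : ℝ)..T, g τ := by
      refine intervalIntegral.integral_mono_interval le_rfl ht.1 ht.2 ?_ ?_
      · exact (ae_restrict_mem measurableSet_Ioc).mono fun x hx => hg0 x (Ioc_subset_Icc_self hx)
      · exact (hg.mono (by rw [uIcc_of_le hT])).intervalIntegrable
    have h2 : 0 ≤ ∫ τ in (0 : ℝ)..t, D τ :=
      intervalIntegral.integral_nonneg ht.1 fun x hx => hD0 x (hsub hx)
    linarith [key t ht]
  · have h1 := key T ⟨hT, le_rfl⟩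
    have h2 := hy0 T ⟨hT, le_rfl⟩
    linarith

/-- The energy balance satisfied by the solutions of the semi-discrete equation. The low frequencies
that are free of viscosity contribute the linear growth rate `R`. -/
structure EnergySystem (N : ℕ) (T ε R : ℝ) (f : ℝ → Space d) (u : ℝ → Space d → ℝ)
    (c : (Fin d → ℤ) → ℝ → ℂ) : Prop where
  time_pos : 0 < T
  eps_pos : 0 < ε
  rate_nonneg : 0 ≤ R
  continuousOn : ∀ ξ ∈ freqs d N, ContinuousOn (c ξ) (Icc 0 T)
  isTrigPoly : ∀ t ∈ Icc 0 T, IsTrigPoly N (fun ξ => c ξ t) (u t)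
  balance : ∀ W : (Fin d → ℤ) → ℝ, (∀ ξ, 0 ≤ W ξ) → ∀ t ∈ Ioo 0 T, ∃ y',
    HasDerivAt (fun τ => energy N W fun ξ => c ξ τ) y' t ∧
    y' ≤ 2 * convection N f (u t) W (fun ξ => c ξ t) -
      2 * ε * energy N (fun ξ => ‖freqVec ξ‖ ^ 2 * W ξ) (fun ξ => c ξ t) +
      2 * R * energy N W fun ξ => c ξ t

theorem IsSVVSolution.exists_energySystem {T : ℝ} (hT : 0 < T) {f : ℝ → Space d}
    {μ : Measure (Space d)} (hμ : IsLevyMeasure μ) {u₀ : Space d → ℝ} {ε m A B : ℝ}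
    {Q : Fin d → Fin d → ℝ → ℝ → ℝ} {u : ℝ → Space d → ℝ}
    (h : IsSVVSolution N T f μ u₀ ε m Q u) (hε : 0 < ε) (hB : 0 ≤ B) (hA : ε * m ^ 2 ≤ A)
    (hQ : ∀ j k, ∀ t ∈ Icc 0 T, ∀ p ∈ Icc m (N : ℝ),
      |Q j k p t - if j = k then 1 else 0| ≤ B * m ^ 2 / p ^ 2) :
    ∃ c, EnergySystem N T ε (A * (1 + d ^ 2 * B)) f u c := by
  obtain ⟨c, hc, hrep, hder⟩ := h.exists_coefficients hμ
  have hA0 : 0 ≤ A := le_trans (by positivity) hA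
  refine ⟨c, hT, hε, by positivity, hc, hrep, fun W hW t ht => ?_⟩
  refine ⟨_, (HasDerivAt.fun_sum fun ξ hξ =>
    ((hder t ht ξ hξ).norm_sq).const_mul (W ξ)).const_mul _, ?_⟩
  exact energy_balance_le hμ (fun ξ hξ => viscosityForm_ge hε.le hB hA
    (fun j k p hp => hQ j k t (Ioo_subset_Icc_self ht) p hp) hξ) hW

namespace EnergySystem

variable {T ε R : ℝ} {f : ℝ → Space d} {u : ℝ → Space d → ℝ} {c : (Fin d → ℤ) → ℝ → ℂ}

theorem derivSq_eq (h : EnergySystem N T ε R f u c) (s : ℕ) {t : ℝ} (ht : t ∈ Icc 0 T) :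
    derivSq s (u t) = energy N (sobWeight s) fun ξ => c ξ t :=
  (h.isTrigPoly t ht).derivSq_eq s

theorem derivNormDT_eq_sqrt (h : EnergySystem N T ε R f u c) (s : ℕ) :
    derivNormDT T s u = √(∫ t in (0 : ℝ)..T, energy N (sobWeight s) fun ξ => c ξ t) := by
  rw [derivNormDT, intervalIntegral.integral_of_le h.time_pos.le, integral_Ioc_eq_integral_Ioo]
  congr 1
  exact setIntegral_congr_fun measurableSet_Ioo fun t ht =>
    h.derivSq_eq s (Ioo_subset_Icc_self ht)

theorem intervalIntegrable_energy (h : EnergySystem N T ε R f u c) (W : (Fin d → ℤ) → ℝ) :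
    IntervalIntegrable (fun t => energy N W fun ξ => c ξ t) volume 0 T :=
  ((continuousOn_energy h.continuousOn W).mono
    (by rw [uIcc_of_le h.time_pos.le])).intervalIntegrable

/-- From a differential inequality for the energy of order `s` to the estimate of the norms. -/
theorem estimate_of_deriv_le (h : EnergySystem N T ε R f u c) (s : ℕ) {g : ℝ → ℝ} {G : ℝ}
    (hg : ContinuousOn g (Icc 0 T)) (hg0 : ∀ t ∈ Icc 0 T, 0 ≤ g t)
    (hG : ∫ t in (0 : ℝ)..T, g t ≤ G)
    (hle : ∀ t ∈ Ioo 0 T, ∀ y', HasDerivAt (fun τ => energy N (sobWeight s) fun ξ => c ξ τ) y' t →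
      y' ≤ 2 * convection N f (u t) (sobWeight s) (fun ξ => c ξ t) -
        2 * ε * energy N (fun ξ => ‖freqVec ξ‖ ^ 2 * sobWeight s ξ) (fun ξ => c ξ t) +
        2 * R * energy N (sobWeight s) (fun ξ => c ξ t) →
      ε ^ (2 * s) * y' ≤ g t -
        ε ^ (2 * s + 1) * energy N (fun ξ => ‖freqVec ξ‖ ^ 2 * sobWeight s ξ) fun ξ => c ξ t) :
    ∀ t ∈ Icc 0 T, ε ^ s * derivNorm s (u t) + ε ^ ((s : ℝ) + 1 / 2) * derivNormDT T (s + 1) u ≤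
      2 * √G + 2 * (ε ^ s * derivNorm s (u 0)) := by
  intro t ht
  have hε := h.eps_pos
  have h0T : (0 : ℝ) ∈ Icc 0 T := ⟨le_rfl, h.time_pos.le⟩
  have hW : ∀ ξ : Fin d → ℤ, 0 ≤ sobWeight s ξ := sobWeight_nonneg s
  have hW2 : ∀ ξ : Fin d → ℤ, 0 ≤ ‖freqVec ξ‖ ^ 2 * sobWeight s ξ := fun ξ =>
    mul_nonneg (sq_nonneg _) (hW ξ)
  choose! y' hy' hy'le using h.balance (sobWeight s) hW
  have hG0 : 0 ≤ G := (intervalIntegral.integral_nonneg h.time_pos.le hg0).trans hG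
  obtain ⟨b1, b2⟩ := integral_bounds_of_deriv_le h.time_pos.le
    (y := fun τ => ε ^ (2 * s) * energy N (sobWeight s) fun ξ => c ξ τ)
    (y' := fun τ => ε ^ (2 * s) * y' τ)
    (D := fun τ => ε ^ (2 * s + 1) *
      energy N (fun ξ => ‖freqVec ξ‖ ^ 2 * sobWeight s ξ) fun ξ => c ξ τ)
    (continuousOn_const.mul (continuousOn_energy h.continuousOn _))
    (continuousOn_const.mul (continuousOn_energy h.continuousOn _)) hg
    (fun τ _ => mul_nonneg (by positivity) (energy_nonneg hW _))
    (fun τ _ => mul_nonneg (by positivity) (energy_nonneg hW2 _)) hg0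
    (fun τ hτ => (hy' τ hτ).const_mul _)
    (fun τ hτ => hle τ hτ _ (hy' τ hτ) (hy'le τ hτ)) hG
  have hpow : √(ε ^ (2 * s)) = ε ^ s := by
    rw [mul_comm, pow_mul, Real.sqrt_sq (by positivity)]
  have hN : ∀ τ ∈ Icc 0 T, ε ^ s * derivNorm s (u τ) =
      √(ε ^ (2 * s) * energy N (sobWeight s) fun ξ => c ξ τ) := by
    intro τ hτ
    rw [derivNorm, h.derivSq_eq s hτ, Real.sqrt_mul (by positivity), hpow]
  have hDT : ε ^ ((s : ℝ) + 1 / 2) * derivNormDT T (s + 1) u ≤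
      √(∫ τ in (0 : ℝ)..T, ε ^ (2 * s + 1) *
        energy N (fun ξ => ‖freqVec ξ‖ ^ 2 * sobWeight s ξ) fun ξ => c ξ τ) := by
    rw [h.derivNormDT_eq_sqrt, intervalIntegral.integral_const_mul, Real.sqrt_mul (by positivity)]
    have e : ε ^ ((s : ℝ) + 1 / 2) = √(ε ^ (2 * s + 1)) := by
      rw [Real.sqrt_eq_rpow, ← Real.rpow_natCast, ← Real.rpow_mul hε.le]
      congr 1
      push_cast
      ring
    rw [e]
    refine mul_le_mul_of_nonneg_left (Real.sqrt_le_sqrt ?_) (Real.sqrt_nonneg _)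
    exact intervalIntegral.integral_mono_on h.time_pos.le (h.intervalIntegrable_energy _)
      (h.intervalIntegrable_energy _) fun τ _ => energy_mono (sobWeight_succ_le s) _
  -- Used once for the energy at time `t` and once for the integrated dissipation, hence the two
  -- factors `2` in the conclusion.
  have hsq : ∀ z : ℝ, z ≤ (ε ^ (2 * s) * energy N (sobWeight s) fun ξ => c ξ 0) + G →
      √z ≤ ε ^ s * derivNorm s (u 0) + √G := by
    intro z hz
    rw [hN 0 h0T]
    exact (Real.sqrt_le_sqrt hz).trans (sqrt_add_le_add_sqrt
      (mul_nonneg (by positivity) (energy_nonneg hW _)) hG0)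
  rw [hN t ht]
  linarith [hsq _ (b1 t ht), hsq _ b2, hDT]

/-! ### The basic estimate -/

/-- The growth term is bounded by a given `E`, which is later supplied either by the supremum norm
or by Grönwall's inequality. -/
theorem estimate_zero_of_le (h : EnergySystem N T ε R f u c) (hf : Continuous f) {E : ℝ}
    (hE : ∀ t ∈ Icc 0 T, energy N (sobWeight 0) (fun ξ => c ξ t) ≤ E) :
    ∀ t ∈ Icc 0 T, ε ^ 0 * derivNorm 0 (u t) + ε ^ (((0 : ℕ) : ℝ) + 1 / 2) * derivNormDT T (0 + 1) u ≤
      2 * √(2 * R * T * E) + 2 * (ε ^ 0 * derivNorm 0 (u 0)) := by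
  have hE0 : 0 ≤ E := (energy_nonneg (sobWeight_nonneg 0) _).trans
    (hE 0 ⟨le_rfl, h.time_pos.le⟩)
  have hR := h.rate_nonneg
  refine h.estimate_of_deriv_le 0 (g := fun _ => 2 * R * E) continuousOn_const
    (fun _ _ => by positivity) (le_of_eq ?_) fun t ht y' _ hy' => ?_
  · simp; ring
  · rw [convection_zero hf (h.isTrigPoly t (Ioo_subset_Icc_self ht))] at hy'
    have h1 := mul_le_mul_of_nonneg_left (hE t (Ioo_subset_Icc_self ht))
      (by positivity : 0 ≤ 2 * R)
    have h2 : 0 ≤ ε * energy N (fun ξ => ‖freqVec ξ‖ ^ 2 * sobWeight 0 ξ) fun ξ => c ξ t :=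
      mul_nonneg h.eps_pos.le (energy_nonneg (fun ξ =>
        mul_nonneg (sq_nonneg _) (sobWeight_nonneg 0 ξ)) _)
    simp only [Nat.mul_zero, pow_zero, zero_add, pow_one, one_mul]
    linarith

/-- Grönwall: since the convection vanishes, `e^(-2Rt)` times the energy is nonincreasing. -/
theorem energy_zero_le (h : EnergySystem N T ε R f u c) (hf : Continuous f) :
    ∀ t ∈ Icc 0 T, energy N (sobWeight 0) (fun ξ => c ξ t) ≤
      Real.exp (2 * R * T) * energy N (sobWeight 0) fun ξ => c ξ 0 := by
  intro t ht
  set y : ℝ → ℝ := fun τ => energy N (sobWeight 0) fun ξ => c ξ τ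
  have hy0 : ∀ τ, 0 ≤ y τ := fun τ => energy_nonneg (sobWeight_nonneg 0) _
  have hcont : ContinuousOn (fun τ => Real.exp (-(2 * R) * τ) * y τ) (Icc 0 T) :=
    (Continuous.continuousOn (by fun_prop)).mul (continuousOn_energy h.continuousOn _)
  choose! y' hy' hy'le using h.balance (sobWeight 0) (sobWeight_nonneg 0)
  have hder : ∀ τ ∈ Ioo 0 T, HasDerivAt (fun τ => Real.exp (-(2 * R) * τ) * y τ)
      (Real.exp (-(2 * R) * τ) * (-(2 * R)) * y τ + Real.exp (-(2 * R) * τ) * y' τ) τ := by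
    intro τ hτ
    have h1 : HasDerivAt (fun τ => Real.exp (-(2 * R) * τ))
        (Real.exp (-(2 * R) * τ) * (-(2 * R))) τ := by
      simpa using ((hasDerivAt_id τ).const_mul (-(2 * R))).exp
    exact h1.mul (hy' τ hτ)
  have hanti : AntitoneOn (fun τ => Real.exp (-(2 * R) * τ) * y τ) (Icc 0 T) := by
    refine antitoneOn_of_deriv_nonpos (convex_Icc 0 T) hcont ?_ ?_
    · rw [interior_Icc]
      exact fun τ hτ => (hder τ hτ).differentiableAt.differentiableWithinAt
    · rw [interior_Icc]
      intro τ hτ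
      rw [(hder τ hτ).deriv]
      have h1 := hy'le τ hτ
      rw [convection_zero hf (h.isTrigPoly τ (Ioo_subset_Icc_self hτ))] at h1
      have h2 : 0 ≤ ε * energy N (fun ξ => ‖freqVec ξ‖ ^ 2 * sobWeight 0 ξ) fun ξ => c ξ τ :=
        mul_nonneg h.eps_pos.le (energy_nonneg (fun ξ =>
          mul_nonneg (sq_nonneg _) (sobWeight_nonneg 0 ξ)) _)
      have h3 : y' τ ≤ 2 * R * y τ := by linarith
      have h4 := mul_le_mul_of_nonneg_left h3 (Real.exp_pos (-(2 * R) * τ)).le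
      linarith
  have h1 := hanti ⟨le_rfl, h.time_pos.le⟩ ht ht.1
  simp only [mul_zero, Real.exp_zero, one_mul] at h1
  have h2 : y t = Real.exp (2 * R * t) * (Real.exp (-(2 * R) * t) * y t) := by
    rw [← mul_assoc, ← Real.exp_add]
    have : 2 * R * t + -(2 * R) * t = 0 := by ring
    rw [this, Real.exp_zero, one_mul]
  have hR := h.rate_nonneg
  calc y t = Real.exp (2 * R * t) * (Real.exp (-(2 * R) * t) * y t) := h2
    _ ≤ Real.exp (2 * R * t) * y 0 := mul_le_mul_of_nonneg_left h1 (Real.exp_pos _).le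
    _ ≤ Real.exp (2 * R * T) * y 0 := by
      refine mul_le_mul_of_nonneg_right (Real.exp_le_exp.2 ?_) (hy0 0)
      exact mul_le_mul_of_nonneg_left ht.2 (by positivity)

theorem integral_energy_le_sq (h : EnergySystem N T ε R f u c) (s : ℕ) {X : ℝ}
    (hX : ε ^ s * derivNorm s (u 0) + ε ^ ((s : ℝ) + 1 / 2) * derivNormDT T (s + 1) u ≤ X) :
    ε ^ (2 * s + 1) * ∫ t in (0 : ℝ)..T, energy N (sobWeight (s + 1)) (fun ξ => c ξ t) ≤ X ^ 2 := by
  have hε := h.eps_pos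
  have h1 : 0 ≤ ε ^ s * derivNorm s (u 0) := mul_nonneg (by positivity) (Real.sqrt_nonneg _)
  have h2 : ε ^ ((s : ℝ) + 1 / 2) * derivNormDT T (s + 1) u ≤ X := by linarith
  have h3 : 0 ≤ ε ^ ((s : ℝ) + 1 / 2) * derivNormDT T (s + 1) u :=
    mul_nonneg (Real.rpow_nonneg hε.le _) (Real.sqrt_nonneg _)
  refine le_trans (le_of_eq ?_) (pow_le_pow_left₀ h3 h2 2)
  rw [mul_pow, h.derivNormDT_eq_sqrt, Real.sq_sqrt (intervalIntegral.integral_nonneg h.time_pos.le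
    fun t _ => energy_nonneg (sobWeight_nonneg _) _), ← Real.rpow_natCast (_ ^ _) 2,
    ← Real.rpow_mul hε.le, ← Real.rpow_natCast ε]
  congr 2
  push_cast
  ring

/-! ### Higher order estimates -/

/-- Where `|ξ|² ≥ 4l/ε` the first term dominates; below that threshold all but one of the `s + 1`
factors `|ξ|²` are replaced by `4l/ε`. -/
theorem mul_sobWeight_le {l ε : ℝ} (hl : 0 ≤ l) (hε : 0 < ε) (s : ℕ) (ξ : Fin d → ℤ) :
    l * sobWeight (s + 1) ξ ≤
      ε / 4 * (‖freqVec ξ‖ ^ 2 * sobWeight (s + 1) ξ) + l * (4 * l / ε) ^ s * ‖freqVec ξ‖ ^ 2 := by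
  set a := ‖freqVec ξ‖ ^ 2 with ha
  have ha0 : 0 ≤ a := sq_nonneg _
  have hw := sobWeight_nonneg (s + 1) ξ
  rcases le_total l (ε / 4 * a) with h1 | h1
  · have h2 := mul_le_mul_of_nonneg_right h1 hw
    have h3 : 0 ≤ l * (4 * l / ε) ^ s * a := by positivity
    linarith
  · have h2 : a ≤ 4 * l / ε := by
      rw [le_div_iff₀ hε]; linarith
    have h3 : sobWeight (s + 1) ξ ≤ (4 * l / ε) ^ s * a := by
      refine (sobWeight_le_pow (s + 1) ξ).trans ?_
      rw [← ha, pow_succ]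
      gcongr
    have h4 := mul_le_mul_of_nonneg_left h3 hl
    have h5 : 0 ≤ ε / 4 * (a * sobWeight (s + 1) ξ) := by positivity
    linarith

theorem mul_energy_le {l ε : ℝ} (hl : 0 ≤ l) (hε : 0 < ε) (s : ℕ) (b : (Fin d → ℤ) → ℂ) :
    l * energy N (sobWeight (s + 1)) b ≤
      ε / 4 * energy N (fun ξ => ‖freqVec ξ‖ ^ 2 * sobWeight (s + 1) ξ) b +
        l * (4 * l / ε) ^ s * energy N (fun ξ => ‖freqVec ξ‖ ^ 2) b := by
  rw [← energy_smul, ← energy_linear]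
  exact energy_mono (mul_sobWeight_le hl hε s) b

theorem convection_le (h : EnergySystem N T ε R f u c) {s : ℕ} (hf : ContDiff ℝ s f) {K : ℝ}
    {t : ℝ} (ht : t ∈ Icc 0 T)
    (hK : derivNorm s (fun x => f (u t x)) ≤ K * derivNorm s (u t)) :
    convection N f (u t) (sobWeight s) (fun ξ => c ξ t) ≤
      K ^ 2 / ε * energy N (sobWeight s) (fun ξ => c ξ t) +
        ε / 4 * energy N (fun ξ => ‖freqVec ξ‖ ^ 2 * sobWeight s ξ) fun ξ => c ξ t := by
  have hε := h.eps_pos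
  have h1 := convection_sobWeight_le hf (h.isTrigPoly t ht) hε
  have h2 : derivSq s (fun x => f (u t x)) ≤ K ^ 2 * energy N (sobWeight s) fun ξ => c ξ t := by
    have h3 := pow_le_pow_left₀ (Real.sqrt_nonneg _) hK 2
    simp only [mul_pow, derivNorm] at h3
    rw [Real.sq_sqrt (derivSq_nonneg _ _),
      Real.sq_sqrt (derivSq_nonneg _ _), h.derivSq_eq s ht] at h3
    exact h3
  have h4 := mul_le_mul_of_nonneg_left h2 (by positivity : 0 ≤ 1 / ε)
  refine h1.trans ?_
  have e : 1 / ε * (K ^ 2 * energy N (sobWeight s) fun ξ => c ξ t) =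
      K ^ 2 / ε * energy N (sobWeight s) fun ξ => c ξ t := by ring
  linarith

theorem rate_scaling {ε e : ℝ} (hε : 0 < ε) (he : ε ≤ e) {R : ℝ} (hR : 0 ≤ R) (s : ℕ) :
    ε ^ (2 * (s + 1)) * (2 * R * (4 * (2 * R) / ε) ^ s) ≤ 2 * R * (8 * R) ^ s * e ^ (s + 1) * ε := by
  have h1 : ε ^ (2 * (s + 1)) * (2 * R * (4 * (2 * R) / ε) ^ s) =
      2 * R * (8 * R) ^ s * ε ^ (s + 1) * ε := by
    rw [div_pow]
    field_simp
    ring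
  rw [h1]
  gcongr

/-- The estimate of order `s + 1` that uses only the constant of order `s + 1`. -/
theorem estimate_interpolated (h : EnergySystem N T ε R f u c) {s : ℕ}
    (hf : ContDiff ℝ (s + 1 : ℕ) f) {e K X : ℝ} (he : ε ≤ e) (hK0 : 0 ≤ K) (hX0 : 0 ≤ X)
    (hX : ε * ∫ t in (0 : ℝ)..T, energy N (sobWeight 1) (fun ξ => c ξ t) ≤ X ^ 2)
    (hK : ∀ t ∈ Icc 0 T,
      derivNorm (s + 1) (fun x => f (u t x)) ≤ K * derivNorm (s + 1) (u t)) :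
    ∀ t ∈ Icc 0 T, ε ^ (s + 1) * derivNorm (s + 1) (u t) +
        ε ^ (((s + 1 : ℕ) : ℝ) + 1 / 2) * derivNormDT T (s + 1 + 1) u ≤
      2 * (√(2 * R * (8 * R) ^ s * e ^ (s + 1)) + √(2 * 8 ^ s) * K ^ (s + 1)) * X +
        2 * (ε ^ (s + 1) * derivNorm (s + 1) (u 0)) := by
  have hε := h.eps_pos
  have hR := h.rate_nonneg
  have he0 : 0 ≤ e := hε.le.trans he
  set A := 2 * R * (8 * R) ^ s * e ^ (s + 1) with hA
  have hA0 : 0 ≤ A := by positivity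
  -- The low frequency coefficients for `l = 2R` and `l = 2K²/ε`, after scaling by `ε^(2(s+1))` and
  -- with one factor `ε` left to pair with `E1`.
  set Z := A + 2 * 8 ^ s * (K ^ (s + 1)) ^ 2 with hZ
  have hZ0 : 0 ≤ Z := by positivity
  have hbound := h.estimate_of_deriv_le (s + 1)
    (g := fun t => Z * (ε * energy N (sobWeight 1) fun ξ => c ξ t)) (G := Z * X ^ 2)
    (continuousOn_const.mul (continuousOn_const.mul (continuousOn_energy h.continuousOn _)))
    (fun t _ => mul_nonneg hZ0 (mul_nonneg hε.le (energy_nonneg (sobWeight_nonneg 1) _)))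
    (by
      rw [intervalIntegral.integral_const_mul, intervalIntegral.integral_const_mul]
      exact mul_le_mul_of_nonneg_left hX hZ0)
    (fun t ht y' _ hy' => by
      have htI := Ioo_subset_Icc_self ht
      have h1 := h.convection_le hf htI (hK t htI)
      have h2 := mul_energy_le (N := N) (by positivity : 0 ≤ 2 * R) hε s (fun ξ => c ξ t)
      have h3 := mul_energy_le (N := N) (by positivity : 0 ≤ 2 * (K ^ 2 / ε)) hε s
        (fun ξ => c ξ t)
      have hE1 : energy N (fun ξ => ‖freqVec ξ‖ ^ 2) (fun ξ => c ξ t) =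
          energy N (sobWeight 1) fun ξ => c ξ t := by rw [funext norm_freqVec_sq_eq_sobWeight]
      rw [hE1] at h2 h3
      set E1 := energy N (sobWeight 1) fun ξ => c ξ t with hE1d
      set D := energy N (fun ξ => ‖freqVec ξ‖ ^ 2 * sobWeight (s + 1) ξ) fun ξ => c ξ t
      have hE10 : 0 ≤ E1 := energy_nonneg (sobWeight_nonneg 1) _
      -- Of the dissipation `2εD`, the convection uses `εD/2` and each of the two frequency
      -- splittings `εD/4`.
      have h4 : y' ≤ -(ε * D) + (2 * R * (4 * (2 * R) / ε) ^ s) * E1 +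
          2 * (K ^ 2 / ε) * (4 * (2 * (K ^ 2 / ε)) / ε) ^ s * E1 := by linarith
      have h5 := mul_le_mul_of_nonneg_left h4 (by positivity : 0 ≤ ε ^ (2 * (s + 1)))
      have h6 := mul_le_mul_of_nonneg_right (rate_scaling hε he hR s) hE10
      have h7 : ε ^ (2 * (s + 1)) * (2 * (K ^ 2 / ε) * (4 * (2 * (K ^ 2 / ε)) / ε) ^ s) =
          2 * 8 ^ s * (K ^ (s + 1)) ^ 2 * ε := by
        have e1 : 4 * (2 * (K ^ 2 / ε)) / ε = 8 * K ^ 2 / ε ^ 2 := by field_simp; ring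
        rw [e1, div_pow]
        field_simp
        ring
      have h8 : ε ^ (2 * (s + 1)) * (-(ε * D) + (2 * R * (4 * (2 * R) / ε) ^ s) * E1 +
          2 * (K ^ 2 / ε) * (4 * (2 * (K ^ 2 / ε)) / ε) ^ s * E1) =
          -(ε ^ (2 * (s + 1) + 1) * D) +
          ε ^ (2 * (s + 1)) * (2 * R * (4 * (2 * R) / ε) ^ s) * E1 +
          ε ^ (2 * (s + 1)) * (2 * (K ^ 2 / ε) * (4 * (2 * (K ^ 2 / ε)) / ε) ^ s) * E1 := by
        ring
      rw [h8, h7] at h5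
      have h9 : Z * (ε * E1) = A * ε * E1 + 2 * 8 ^ s * (K ^ (s + 1)) ^ 2 * ε * E1 := by
        rw [hZ]; ring
      rw [h9]
      linarith)
  intro t ht
  refine (hbound t ht).trans ?_
  have hs : √(Z * X ^ 2) ≤ (√A + √(2 * 8 ^ s) * K ^ (s + 1)) * X := by
    rw [Real.sqrt_mul hZ0, Real.sqrt_sq hX0]
    refine mul_le_mul_of_nonneg_right ?_ hX0
    refine (sqrt_add_le_add_sqrt hA0 (by positivity)).trans ?_
    rw [sqrt_mul_sq (by positivity : (0 : ℝ) ≤ 2 * 8 ^ s) (by positivity : 0 ≤ K ^ (s + 1))]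
  linarith

/-- The estimate of order `s + 1` in terms of the dissipation controlled at order `s`. -/
theorem estimate_recursive (h : EnergySystem N T ε R f u c) {s : ℕ}
    (hf : ContDiff ℝ (s + 1 : ℕ) f) {e K X Y : ℝ} (he : ε ≤ e) (hK0 : 0 ≤ K) (hX0 : 0 ≤ X)
    (hY0 : 0 ≤ Y)
    (hX : ε * ∫ t in (0 : ℝ)..T, energy N (sobWeight 1) (fun ξ => c ξ t) ≤ X ^ 2)
    (hY : ε ^ (2 * s + 1) *
      ∫ t in (0 : ℝ)..T, energy N (sobWeight (s + 1)) (fun ξ => c ξ t) ≤ Y ^ 2)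
    (hK : ∀ t ∈ Icc 0 T,
      derivNorm (s + 1) (fun x => f (u t x)) ≤ K * derivNorm (s + 1) (u t)) :
    ∀ t ∈ Icc 0 T, ε ^ (s + 1) * derivNorm (s + 1) (u t) +
        ε ^ (((s + 1 : ℕ) : ℝ) + 1 / 2) * derivNormDT T (s + 1 + 1) u ≤
      2 * (√(2 * R * (8 * R) ^ s * e ^ (s + 1)) * X + √2 * K * Y) +
        2 * (ε ^ (s + 1) * derivNorm (s + 1) (u 0)) := by
  have hε := h.eps_pos
  have hR := h.rate_nonneg
  have he0 : 0 ≤ e := hε.le.trans he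
  set A := 2 * R * (8 * R) ^ s * e ^ (s + 1) with hA
  have hA0 : 0 ≤ A := by positivity
  have hcE1 := continuousOn_energy h.continuousOn (sobWeight 1)
  have hcE := continuousOn_energy h.continuousOn (sobWeight (s + 1))
  have hbound := h.estimate_of_deriv_le (s + 1)
    (g := fun t => A * (ε * energy N (sobWeight 1) fun ξ => c ξ t) +
      2 * K ^ 2 * (ε ^ (2 * s + 1) * energy N (sobWeight (s + 1)) fun ξ => c ξ t))
    (G := A * X ^ 2 + 2 * K ^ 2 * Y ^ 2)
    ((continuousOn_const.mul (continuousOn_const.mul hcE1)).add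
      (continuousOn_const.mul (continuousOn_const.mul hcE)))
    (fun t _ => add_nonneg
      (mul_nonneg hA0 (mul_nonneg hε.le (energy_nonneg (sobWeight_nonneg 1) _)))
      (mul_nonneg (by positivity)
        (mul_nonneg (by positivity) (energy_nonneg (sobWeight_nonneg _) _))))
    (by
      rw [intervalIntegral.integral_add
        (((h.intervalIntegrable_energy (sobWeight 1)).const_mul ε).const_mul A)
        (((h.intervalIntegrable_energy (sobWeight (s + 1))).const_mul _).const_mul _),
        intervalIntegral.integral_const_mul, intervalIntegral.integral_const_mul,
        intervalIntegral.integral_const_mul, intervalIntegral.integral_const_mul]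
      exact add_le_add (mul_le_mul_of_nonneg_left hX hA0)
        (mul_le_mul_of_nonneg_left hY (by positivity)))
    (fun t ht y' _ hy' => by
      have htI := Ioo_subset_Icc_self ht
      have h1 := h.convection_le hf htI (hK t htI)
      have h2 := mul_energy_le (N := N) (by positivity : 0 ≤ 2 * R) hε s (fun ξ => c ξ t)
      rw [funext norm_freqVec_sq_eq_sobWeight] at h2
      set E1 := energy N (sobWeight 1) fun ξ => c ξ t
      set E := energy N (sobWeight (s + 1)) fun ξ => c ξ t
      set D := energy N (fun ξ => ‖freqVec ξ‖ ^ 2 * sobWeight (s + 1) ξ) fun ξ => c ξ t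
      have hE10 : 0 ≤ E1 := energy_nonneg (sobWeight_nonneg 1) _
      have hD0 : 0 ≤ ε * D := mul_nonneg hε.le (energy_nonneg (fun ξ =>
        mul_nonneg (sq_nonneg _) (sobWeight_nonneg _ ξ)) _)
      -- Here only the growth rate `2R` is split by frequency; the convection term is left intact,
      -- to be integrated by means of `hY`.
      have h4 : y' ≤ -(ε * D) + (2 * R * (4 * (2 * R) / ε) ^ s) * E1 + 2 * (K ^ 2 / ε) * E := by
        linarith
      have h5 := mul_le_mul_of_nonneg_left h4 (by positivity : 0 ≤ ε ^ (2 * (s + 1)))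
      have h6 := mul_le_mul_of_nonneg_right (rate_scaling hε he hR s) hE10
      have h8 : ε ^ (2 * (s + 1)) * (-(ε * D) + (2 * R * (4 * (2 * R) / ε) ^ s) * E1 +
          2 * (K ^ 2 / ε) * E) = -(ε ^ (2 * (s + 1) + 1) * D) +
          ε ^ (2 * (s + 1)) * (2 * R * (4 * (2 * R) / ε) ^ s) * E1 +
          2 * K ^ 2 * (ε ^ (2 * s + 1) * E) := by
        field_simp
        ring
      rw [h8] at h5
      linarith)
  intro t ht
  refine (hbound t ht).trans ?_
  have hs : √(A * X ^ 2 + 2 * K ^ 2 * Y ^ 2) ≤ √A * X + √2 * K * Y := by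
    refine (sqrt_add_le_add_sqrt (by positivity) (by positivity)).trans (le_of_eq ?_)
    rw [sqrt_mul_sq hA0 hX0, sqrt_mul_sq (by positivity) hY0, sqrt_mul_sq (by norm_num) hK0]
  linarith

end EnergySystem

end TimeIntegration

/-! ### Initial data and the two forms of the bound. -/

section EnergyEstimates

variable {d N : ℕ}

/-- Bessel's inequality: `‖P_N v‖²` is the inner product of `v` with `P_N v`, at most half the sum
of the two squared norms. -/
theorem sum_norm_sq_fourierCoefficient_le {v : Space d → ℝ}
    (hv : MemLp v ⊤ (volume.restrict (cell d))) :
    energy N (sobWeight 0) (fourierCoefficient fun y => (v y : ℂ)) ≤ ∫ x in cell d, v x ^ 2 := by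
  set b : (Fin d → ℤ) → ℂ := fourierCoefficient fun y => (v y : ℂ) with hb
  have hint : IntegrableOn (fun y => (v y : ℂ)) (cell d) :=
    (hv.integrable le_top).ofReal
  have hsq : IntegrableOn (fun x => v x ^ 2) (cell d) :=
    (hv.mono_exponent le_top : MemLp v 2 _).integrable_sq
  have hP := (contDiff_trigPoly (N := N) (n := 0) b).continuous
  have h1 := congrArg Complex.re (integral_mul_conj_trigPoly (N := N) b hint)
  have h2 : (((2 * Real.pi : ℝ) ^ d : ℂ) * ∑ ξ ∈ freqs d N, (starRingEnd ℂ) (b ξ) *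
      fourierCoefficient (fun y => (v y : ℂ)) ξ).re = energy N (sobWeight 0) b := by
    rw [← Complex.ofReal_pow, Complex.re_ofReal_mul, Complex.re_sum, energy]
    congr 1
    refine Finset.sum_congr rfl fun ξ _ => ?_
    rw [← hb, mul_comm, Complex.mul_conj, Complex.ofReal_re, Complex.normSq_eq_norm_sq,
      sobWeight_zero, one_mul]
  rw [h2] at h1
  have h3 : energy N (sobWeight 0) b = ∫ x in cell d, ‖trigPoly N b x‖ ^ 2 := by
    rw [integral_norm_sq_trigPoly, energy]
    simp only [sobWeight_zero, one_mul]
  have hPint : IntegrableOn (fun x => ‖trigPoly N b x‖ ^ 2) (cell d) :=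
    integrableOn_cell _ (hP.norm.pow 2)
  have hprod : IntegrableOn (fun x => (v x : ℂ) * (starRingEnd ℂ) (trigPoly N b x)) (cell d) := by
    obtain ⟨B, hB⟩ : ∃ B, ∀ x, ‖(starRingEnd ℂ) (trigPoly N b x)‖ ≤ B := by
      refine ⟨∑ ξ ∈ freqs d N, ‖b ξ‖, fun x => ?_⟩
      rw [RCLike.norm_conj]
      refine (norm_sum_le _ _).trans (Finset.sum_le_sum fun ξ _ => ?_)
      rw [norm_mul, norm_expWave, mul_one]
    exact Integrable.mul_bdd (c := B) hint
      (Complex.continuous_conj.comp hP).aestronglyMeasurable (Eventually.of_forall hB)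
  have h4 : (∫ x in cell d, (v x : ℂ) * (starRingEnd ℂ) (trigPoly N b x)).re ≤
      1 / 2 * (∫ x in cell d, v x ^ 2) + 1 / 2 * ∫ x in cell d, ‖trigPoly N b x‖ ^ 2 := by
    have h5 := Complex.reCLM.integral_comp_comm hprod
    simp only [Complex.reCLM_apply] at h5
    rw [← h5, ← integral_const_mul, ← integral_const_mul, ← integral_add (hsq.const_mul _)
      (hPint.const_mul _)]
    refine integral_mono (Complex.reCLM.integrable_comp hprod)
      ((hsq.const_mul _).add (hPint.const_mul _)) fun x => ?_
    have h6 : ((v x : ℂ) * (starRingEnd ℂ) (trigPoly N b x)).re ≤ |v x| * ‖trigPoly N b x‖ := by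
      refine (Complex.re_le_norm _).trans ?_
      rw [norm_mul, RCLike.norm_conj, Complex.norm_real, Real.norm_eq_abs]
    simp only
    nlinarith [sq_nonneg (|v x| - ‖trigPoly N b x‖), sq_abs (v x)]
  linarith

/-- The supremum is a genuine one because `∑ |c_ξ(t)|` is continuous on the compact time interval.
-/
theorem abs_le_supNormDT {T : ℝ} {u : ℝ → Space d → ℝ} {c : (Fin d → ℤ) → ℝ → ℂ}
    (hc : ∀ ξ ∈ freqs d N, ContinuousOn (c ξ) (Icc 0 T))
    (hrep : ∀ t ∈ Icc 0 T, IsTrigPoly N (fun ξ => c ξ t) (u t)) {t : ℝ} (ht : t ∈ Icc 0 T)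
    (x : Space d) : |u t x| ≤ supNormDT T u := by
  have hcont : ContinuousOn (fun t => ∑ ξ ∈ freqs d N, ‖c ξ t‖) (Icc 0 T) :=
    continuousOn_finsetSum _ fun ξ hξ => (hc ξ hξ).norm
  obtain ⟨B, hB⟩ := isCompact_Icc.bddAbove_image hcont
  refine le_csSup ⟨B, ?_⟩ ⟨t, ht, x, rfl⟩
  rintro r ⟨τ, hτ, y, rfl⟩
  refine le_trans ?_ (hB ⟨τ, hτ, rfl⟩)
  have h1 : |u τ y| = ‖trigPoly N (fun ξ => c ξ τ) y‖ := by
    rw [← hrep τ hτ y, Complex.norm_real, Real.norm_eq_abs]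
  rw [h1]
  refine (norm_sum_le _ _).trans (Finset.sum_le_sum fun ξ _ => ?_)
  rw [norm_mul, norm_expWave, mul_one]

namespace EnergySystem

variable {T ε R : ℝ} {f : ℝ → Space d} {u : ℝ → Space d → ℝ} {c : (Fin d → ℤ) → ℝ → ℂ}

theorem energy_zero_eq (h : EnergySystem N T ε R f u c) {t : ℝ} (ht : t ∈ Icc 0 T) :
    energy N (sobWeight 0) (fun ξ => c ξ t) = ∫ x in cell d, ‖u t x‖ ^ 2 := by
  rw [(h.isTrigPoly t ht).integral_sq, energy]
  simp only [sobWeight_zero, one_mul]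

/-- The `L²` estimate in terms of the supremum norm. -/
theorem estimate_zero_sup (h : EnergySystem N T ε R f u c) (hf : Continuous f) :
    ∀ t ∈ Icc 0 T, ε ^ 0 * derivNorm 0 (u t) + ε ^ (((0 : ℕ) : ℝ) + 1 / 2) * derivNormDT T (0 + 1) u ≤
      2 * √(2 * R * T * (2 * Real.pi) ^ d) * supNormDT T u + 2 * (ε ^ 0 * derivNorm 0 (u 0)) := by
  intro t ht
  have hM : 0 ≤ supNormDT T u := (abs_nonneg _).trans (abs_le_supNormDT h.continuousOn h.isTrigPoly ht 0)
  have hR := h.rate_nonneg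
  have hT := h.time_pos
  refine (h.estimate_zero_of_le hf (E := (2 * Real.pi) ^ d * supNormDT T u ^ 2)
    (fun τ hτ => ?_) t ht).trans (le_of_eq ?_)
  · rw [h.energy_zero_eq hτ]
    have h1 : ∫ x in cell d, ‖u τ x‖ ^ 2 ≤ ∫ _x in cell d, supNormDT T u ^ 2 := by
      refine integral_mono (integrableOn_cell _
        (((h.isTrigPoly τ hτ).contDiff (n := 0)).continuous.norm.pow 2))
        (integrableOn_cell _ continuous_const) fun x => ?_
      exact pow_le_pow_left₀ (norm_nonneg _) (abs_le_supNormDT h.continuousOn h.isTrigPoly hτ x) 2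
    refine h1.trans (le_of_eq ?_)
    rw [setIntegral_const, measureReal_def, volume_cell,
      ENNReal.toReal_ofReal (by positivity [Real.pi_pos]), smul_eq_mul]
  · rw [← mul_assoc, sqrt_mul_sq (mul_nonneg (by positivity) (by positivity [Real.pi_pos])) hM]
    ring

/-- The `L²` estimate in terms of the initial energy. -/
theorem estimate_zero_initial (h : EnergySystem N T ε R f u c) (hf : Continuous f) {U : ℝ}
    (hU : energy N (sobWeight 0) (fun ξ => c ξ 0) ≤ U) :
    (∀ t ∈ Icc 0 T,
      ε ^ 0 * derivNorm 0 (u t) + ε ^ (((0 : ℕ) : ℝ) + 1 / 2) * derivNormDT T (0 + 1) u ≤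
        2 * √(2 * R * T * (Real.exp (2 * R * T) * U)) + 2 * √U) ∧
    ε * ∫ t in (0 : ℝ)..T, energy N (sobWeight 1) (fun ξ => c ξ t) ≤
      (2 * √(2 * R * T * (Real.exp (2 * R * T) * U)) + 2 * √U) ^ 2 := by
  have h0T : (0 : ℝ) ∈ Icc 0 T := ⟨le_rfl, h.time_pos.le⟩
  have h1 : ∀ t ∈ Icc 0 T,
      ε ^ 0 * derivNorm 0 (u t) + ε ^ (((0 : ℕ) : ℝ) + 1 / 2) * derivNormDT T (0 + 1) u ≤
        2 * √(2 * R * T * (Real.exp (2 * R * T) * U)) + 2 * √U := by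
    intro t ht
    refine (h.estimate_zero_of_le hf (fun τ hτ => (h.energy_zero_le hf τ hτ).trans
      (mul_le_mul_of_nonneg_left hU (Real.exp_pos _).le)) t ht).trans ?_
    have h2 : derivNorm 0 (u 0) ≤ √U := by
      rw [derivNorm, h.derivSq_eq 0 h0T]
      exact Real.sqrt_le_sqrt hU
    rw [pow_zero, one_mul]
    linarith
  refine ⟨h1, ?_⟩
  simpa using h.integral_energy_le_sq 0 (h1 0 h0T)

end EnergySystem

/-- The estimate of order `s` with all the constants `𝒦_1, …, 𝒦_s`. -/
theorem exists_estimate_product (d s : ℕ) (T R e U : ℝ) :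
    ∃ C : ℝ, 0 ≤ C ∧ ∀ (N : ℕ) (ε : ℝ) (f : ℝ → Space d) (u : ℝ → Space d → ℝ)
      (c : (Fin d → ℤ) → ℝ → ℂ) (K : ℕ → ℝ),
      EnergySystem N T ε R f u c → ε ≤ e → energy N (sobWeight 0) (fun ξ => c ξ 0) ≤ U →
      ContDiff ℝ s f → (∀ k, 0 ≤ K k) →
      (∀ k ∈ Finset.Icc 1 s, ∀ t ∈ Icc 0 T,
        derivNorm k (fun x => f (u t x)) ≤ K k * derivNorm k (u t)) →
      ∀ t ∈ Icc 0 T, ε ^ s * derivNorm s (u t) + ε ^ ((s : ℝ) + 1 / 2) * derivNormDT T (s + 1) u ≤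
        C * (1 + ∑ j ∈ Finset.range s, ε ^ j * derivNorm j (u 0)) *
          ∏ k ∈ Finset.Icc 1 s, (1 + K k) + 4 * (ε ^ s * derivNorm s (u 0)) := by
  set X := 2 * √(2 * R * T * (Real.exp (2 * R * T) * U)) + 2 * √U with hX
  have hX0 : 0 ≤ X := by positivity
  induction s with
  | zero =>
    refine ⟨X, hX0, fun N ε f u c K h he hU hf _ _ t ht => ?_⟩
    refine ((h.estimate_zero_initial hf.continuous hU).1 t ht).trans ?_
    have : 0 ≤ 4 * (ε ^ 0 * derivNorm 0 (u 0)) :=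
      mul_nonneg (by norm_num) (mul_nonneg (by norm_num) (Real.sqrt_nonneg _))
    simp only [Finset.range_zero, Finset.sum_empty, add_zero, mul_one, Finset.Icc_eq_empty_of_lt one_pos,
      Finset.prod_empty]
    linarith
  | succ s ih =>
    obtain ⟨C, hC, ih⟩ := ih
    set a := √(2 * R * (8 * R) ^ s * e ^ (s + 1))
    refine ⟨2 * (a * X + √2 * (C + 4)), by positivity,
      fun N ε f u c K h he hU hf hK0 hK t ht => ?_⟩
    have hε := h.eps_pos
    have h0T : (0 : ℝ) ∈ Icc 0 T := ⟨le_rfl, h.time_pos.le⟩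
    have hn : ∀ j, 0 ≤ ε ^ j * derivNorm j (u 0) := fun j =>
      mul_nonneg (by positivity) (Real.sqrt_nonneg _)
    have hs := ih N ε f u c K h he hU (hf.of_le (by norm_cast; omega)) hK0
      (fun k hk => hK k (Finset.mem_Icc.2 ⟨(Finset.mem_Icc.1 hk).1,
        (Finset.mem_Icc.1 hk).2.trans (Nat.le_succ s)⟩)) 0 h0T
    set S := ∑ j ∈ Finset.range s, ε ^ j * derivNorm j (u 0)
    set P := ∏ k ∈ Finset.Icc 1 s, (1 + K k)
    set n := ε ^ s * derivNorm s (u 0)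
    have hS0 : 0 ≤ S := Finset.sum_nonneg fun j _ => hn j
    have hn0 : 0 ≤ n := hn s
    have hP1 : 1 ≤ P := Finset.one_le_prod fun k _ => le_add_of_nonneg_right (hK0 k)
    have hY0 : 0 ≤ C * (1 + S) * P + 4 * n := by positivity
    refine (h.estimate_recursive hf he (hK0 (s + 1)) hX0 hY0
      (h.estimate_zero_initial (hf.continuous) hU).2 (h.integral_energy_le_sq s hs)
      (hK (s + 1) (Finset.mem_Icc.2 ⟨by omega, le_rfl⟩)) t ht).trans ?_
    rw [Finset.sum_range_succ, Finset.prod_Icc_succ_top (by omega)]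
    have hk := hK0 (s + 1)
    set k := K (s + 1)
    have hQ : 1 ≤ (1 + (S + n)) * P := by nlinarith
    -- The initial norm of order `s` leaves its separate place and joins the sum of lower order
    -- norms; its factor `4` explains the `C + 4` in the new constant.
    have hYle : C * (1 + S) * P + 4 * n ≤ (C + 4) * ((1 + (S + n)) * P) := by
      have e1 : C * (1 + S) * P ≤ C * ((1 + (S + n)) * P) := by
        rw [mul_assoc]
        gcongr
        linarith
      have e2 : n ≤ (1 + (S + n)) * P := by nlinarith
      linarith
    set G := (1 + (S + n)) * P
    have hG : 0 ≤ G := by linarith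
    have e1 : a * X ≤ a * X * (G * (1 + k)) := by
      have : 1 ≤ G * (1 + k) := by nlinarith
      exact le_mul_of_one_le_right (by positivity) this
    have e2 : √2 * k * (C * (1 + S) * P + 4 * n) ≤ √2 * (C + 4) * (G * (1 + k)) := by
      calc _ ≤ √2 * k * ((C + 4) * G) := by gcongr
        _ = √2 * (C + 4) * (G * k) := by ring
        _ ≤ _ := by gcongr; linarith
    have e3 := hn (s + 1)
    have e4 : 2 * (a * X + √2 * (C + 4)) * (1 + (S + n)) * (P * (1 + k)) =
        2 * (a * X * (G * (1 + k)) + √2 * (C + 4) * (G * (1 + k))) := by ring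
    rw [e4]
    linarith

/-- The two bounds hold simultaneously. -/
theorem exists_energy_estimate (d s : ℕ) (T R e U : ℝ) :
    ∃ C : ℝ, ∀ (N : ℕ) (ε : ℝ) (f : ℝ → Space d) (u : ℝ → Space d → ℝ)
      (c : (Fin d → ℤ) → ℝ → ℂ) (K : ℕ → ℝ),
      EnergySystem N T ε R f u c → ε ≤ e → energy N (sobWeight 0) (fun ξ => c ξ 0) ≤ U →
      ContDiff ℝ s f → (∀ k, 0 ≤ K k) →
      (∀ k ∈ Finset.Icc 1 s, ∀ t ∈ Icc 0 T,
        derivNorm k (fun x => f (u t x)) ≤ K k * derivNorm k (u t)) →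
      ∃ B : ℝ, (s = 0 → B ≤ C * supNormDT T u) ∧
        (1 ≤ s → B ≤ C * (1 + ∏ _k ∈ Finset.Icc 1 s, K s) ∧
          B ≤ C * (1 + ∑ j ∈ Finset.range s, ε ^ j * derivNorm j (u 0)) *
            ∏ k ∈ Finset.Icc 1 s, (1 + K k)) ∧
        ∀ t ∈ Icc 0 T,
          ε ^ s * derivNorm s (u t) + ε ^ ((s : ℝ) + 1 / 2) * derivNormDT T (s + 1) u ≤
            B + 4 * ε ^ s * derivNorm s (u 0) := by
  rcases Nat.eq_zero_or_pos s with rfl | hs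
  · refine ⟨2 * √(2 * R * T * (2 * Real.pi) ^ d), fun N ε f u c K h _ _ hf _ _ =>
      ⟨_, fun _ => le_rfl, fun h0 => absurd h0 (by norm_num), fun t ht => ?_⟩⟩
    refine (h.estimate_zero_sup hf.continuous t ht).trans ?_
    have : 0 ≤ ε ^ 0 * derivNorm 0 (u 0) := mul_nonneg (by norm_num) (Real.sqrt_nonneg _)
    linarith
  · obtain ⟨s, rfl⟩ : ∃ r, s = r + 1 := ⟨s - 1, by omega⟩
    obtain ⟨C, hC, hprod⟩ := exists_estimate_product d (s + 1) T R e U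
    set X := 2 * √(2 * R * T * (Real.exp (2 * R * T) * U)) + 2 * √U with hX
    have hX0 : 0 ≤ X := by positivity
    set a := √(2 * R * (8 * R) ^ s * e ^ (s + 1))
    set b := √(2 * 8 ^ s : ℝ)
    have ha : 0 ≤ a := Real.sqrt_nonneg _
    have hb : 0 ≤ b := Real.sqrt_nonneg _
    refine ⟨C + 2 * (a + b) * X, fun N ε f u c K h he hU hf hK0 hK => ?_⟩
    have hε := h.eps_pos
    have hn : ∀ j, 0 ≤ ε ^ j * derivNorm j (u 0) := fun j =>
      mul_nonneg (by positivity) (Real.sqrt_nonneg _)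
    have hk := hK0 (s + 1)
    set B₁ := 2 * (a + b * K (s + 1) ^ (s + 1)) * X
    set B₂ := C * (1 + ∑ j ∈ Finset.range (s + 1), ε ^ j * derivNorm j (u 0)) *
            ∏ k ∈ Finset.Icc 1 (s + 1), (1 + K k) with hB₂
    -- The left side is bounded with `B₁` and with `B₂`, hence with their minimum, which inherits
    -- both upper bounds.
    refine ⟨min B₁ B₂, fun h0 => absurd h0 (by omega), fun _ => ⟨?_, ?_⟩, fun t ht => ?_⟩
    · refine (min_le_left _ _).trans ?_
      rw [Finset.prod_const, Nat.card_Icc, Nat.add_sub_cancel]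
      set κ := K (s + 1) ^ (s + 1)
      have hκ : 0 ≤ κ := by positivity
      have e1 : (C + 2 * (a + b) * X) * (1 + κ) - 2 * (a + b * κ) * X =
        C * (1 + κ) + 2 * (a * κ + b) * X := by ring
      have e2 : 0 ≤ C * (1 + κ) + 2 * (a * κ + b) * X := by positivity
      linarith
    · refine (min_le_right _ _).trans ?_
      have h1 : 0 ≤ ∑ j ∈ Finset.range (s + 1), ε ^ j * derivNorm j (u 0) :=
        Finset.sum_nonneg fun j _ => hn j
      have h2 : 0 ≤ ∏ k ∈ Finset.Icc 1 (s + 1), (1 + K k) :=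
        Finset.prod_nonneg fun k _ => add_nonneg zero_le_one (hK0 k)
      rw [hB₂]
      gcongr
      exact le_add_of_nonneg_right (by positivity)
    · have h1 := h.estimate_interpolated hf he hk hX0
        (h.estimate_zero_initial hf.continuous hU).2
        (hK (s + 1) (Finset.mem_Icc.2 ⟨by omega, le_rfl⟩)) t ht
      have h2 := hprod N ε f u c K h he hU hf hK0 hK t ht
      have h3 := hn (s + 1)
      rw [mul_assoc 4, ← sub_le_iff_le_add]
      refine le_min ?_ ?_ <;> linarith

end EnergyEstimates

/-! ### Uniform constants from the parameters of the method. -/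

section Parameters

variable {d : ℕ} {T θ : ℝ} {ε m : ℕ → ℝ} {Q : ℕ → Fin d → Fin d → ℝ → ℝ → ℝ}

theorem IsSVVParameters.exists_amplitude_le (h : IsSVVParameters d T θ ε m Q) :
    ∃ e : ℝ, ∀ N, ε N ≤ e := by
  have h1 : (fun N : ℕ => (N : ℝ) ^ (-θ)) =O[atTop] (1 : ℕ → ℝ) := by
    refine IsBigO.of_bound 1 ?_
    filter_upwards [eventually_ge_atTop 1] with N hN
    have hN1 : (1 : ℝ) ≤ N := by exact_mod_cast hN
    rw [Real.norm_of_nonneg (by positivity)]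
    simpa using Real.rpow_le_one_of_one_le_of_nonpos hN1 (by linarith [h.theta_pos])
  obtain ⟨e, he⟩ := (isBigO_one_nat_atTop_iff).1 (h.amplitude.1.trans h1)
  exact ⟨e, fun N => (le_abs_self _).trans (he N)⟩

/-- For `N ≥ 2` the logarithm is at least `log 2`, so the logarithmic factor may be divided out. -/
theorem exists_amplitude_mul_sq_le {C : ℝ}
    (hC : ∀ N : ℕ, 2 ≤ N → ε N * m N ^ 2 * Real.log N ^ d ≤ C) :
    ∃ A : ℝ, ∀ N : ℕ, 2 ≤ N → 0 ≤ ε N → ε N * m N ^ 2 ≤ A := by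
  have hlog : 0 < Real.log 2 := Real.log_pos (by norm_num)
  refine ⟨C / Real.log 2 ^ d, fun N hN hε => ?_⟩
  rw [le_div_iff₀ (by positivity)]
  refine le_trans ?_ (hC N hN)
  have : Real.log 2 ≤ Real.log N := Real.log_le_log (by norm_num) (by exact_mod_cast hN)
  gcongr

end Parameters

end SVV

end

theorem mainTheorem11 (d s : ℕ) (hd : 1 ≤ d) :
    ∃ CM : ℝ, ∀ (T θ : ℝ) (ε m : ℕ → ℝ) (Q : ℕ → Fin d → Fin d → ℝ → ℝ → ℝ)
      (μ μs μn : Measure (SVV.Space d)) (u₀ : SVV.Space d → ℝ),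
      0 < T → SVV.IsSVVParameters d T θ ε m Q →
      (∃ C : ℝ, ∀ N : ℕ, 2 ≤ N → ε N * m N ^ 2 * Real.log N ^ d ≤ C) →
      SVV.IsLevyMeasure μ → μ = μs + μn → SVV.IsSymmetricMeasure μs → SVV.HasFirstMoment μn →
      SVV.IsPeriodic u₀ → MemLp u₀ ⊤ (volume.restrict (SVV.cell d)) → SVV.IsBV u₀ →
      -- the symbol of the nonsymmetric part grows at most linearly
      (∃ Cn : ℝ, ∀ ξ : SVV.Space d,
        IntegrableOn (SVV.symbolIntegrand ξ) {0}ᶜ μn ∧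
        ‖SVV.levySymbol μn ξ‖ ≤ Cn * (1 + ‖ξ‖)) ∧
      ∃ C : ℝ, ∀ (f : ℝ → SVV.Space d) (N : ℕ) (u : ℝ → SVV.Space d → ℝ),
        ContDiff ℝ (s + 1) f → 2 ≤ N →
        SVV.IsSVVSolution N T f μ u₀ (ε N) (m N) (Q N) u →
        -- the constants `𝒦_k` have the property that defines them, and the stated size
        (∀ k ∈ Finset.Icc 1 (s + 1),
          (∀ t ∈ Icc 0 T, SVV.derivNorm k (fun x => f (u t x)) ≤
            SVV.compositionConst T f u k * SVV.derivNorm k (u t)) ∧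
          SVV.compositionConst T f u k ≤
            CM * ∑ j ∈ Finset.Icc 1 k,
              SVV.fluxNorm f (SVV.supNormDT T u) j * SVV.supNormDT T u ^ (j - 1)) ∧
        -- the energy estimate
        (8 * (d : ℝ) ^ ((s : ℝ) / 2) * SVV.compositionConst T f u (s + 1) / N < ε N →
          ∃ B : ℝ,
            (s = 0 → B ≤ C * SVV.supNormDT T u) ∧
            (1 ≤ s →
              B ≤ C * (1 + ∏ _k ∈ Finset.Icc 1 s, SVV.compositionConst T f u s) ∧
              B ≤ C * (1 + ∑ j ∈ Finset.range s, ε N ^ j * SVV.derivNorm j (u 0)) *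
                ∏ k ∈ Finset.Icc 1 s, (1 + SVV.compositionConst T f u k)) ∧
            ∀ t ∈ Icc 0 T,
              ε N ^ s * SVV.derivNorm s (u t)
                  + ε N ^ ((s : ℝ) + 1 / 2) * SVV.derivNormDT T (s + 1) u
                ≤ B + 4 * ε N ^ s * SVV.derivNorm s (u 0)) := by
  choose CK hCK0 hCK using fun k (hk : 1 ≤ k) => SVV.exists_derivNorm_comp_le d k hk
  -- The sum dominates each Moser constant, so a single one serves all orders up to `s + 1`.
  refine ⟨∑ k ∈ (Finset.Icc 1 (s + 1)).attach, CK k (Finset.mem_Icc.1 k.2).1,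
    fun T θ ε m Q μ μs μn u₀ hT hpar hεm hμ _ _ hμn _ hu₀ _ => ⟨hμn.levySymbol_le, ?_⟩⟩
  obtain ⟨e, he⟩ := hpar.exists_amplitude_le
  obtain ⟨C', hεm⟩ := hεm
  obtain ⟨A, hA⟩ := SVV.exists_amplitude_mul_sq_le hεm
  obtain ⟨B, hB⟩ := hpar.kernel_bound
  have hQ : ∀ N, 2 ≤ N → ∀ j k, ∀ t ∈ Icc 0 T, ∀ p ∈ Icc (m N) (N : ℝ),
      |Q N j k p t - if j = k then 1 else 0| ≤ |B| * m N ^ 2 / p ^ 2 := by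
    intro N hN j k t ht p hp
    refine (hB N hN j k t ht p hp).trans ?_
    gcongr
    exact le_abs_self B
  -- The growth rate, the amplitude bound and the initial energy bound are fixed before `f`, `N` and
  -- `u`, which makes `C` uniform.
  obtain ⟨C, hC⟩ := SVV.exists_energy_estimate d s T (A * (1 + d ^ 2 * |B|)) e
    (∫ x in SVV.cell d, u₀ x ^ 2)
  refine ⟨C, fun f N u hf hN hu => ?_⟩
  have hfk : ∀ k ≤ s + 1, ContDiff ℝ k f := fun k hk => hf.of_le (by exact_mod_cast hk)
  have hcomp : ∀ k (hk : k ∈ Finset.Icc 1 (s + 1)), ∀ t ∈ Icc 0 T,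
      SVV.derivNorm k (fun x => f (u t x)) ≤
        CK k (Finset.mem_Icc.1 hk).1 * (∑ j ∈ Finset.Icc 1 k,
          SVV.fluxNorm f (SVV.supNormDT T u) j * SVV.supNormDT T u ^ (j - 1)) *
          SVV.derivNorm k (u t) := by
    intro k hk t ht
    obtain ⟨c, hc, hrep, -⟩ := hu.exists_coefficients hμ
    exact hCK k _ N _ (u t) f _ (hrep t ht)
      (fun x => SVV.abs_le_supNormDT hc hrep ht x) (hfk k (Finset.mem_Icc.1 hk).2)
  have hM : 0 ≤ SVV.supNormDT T u := Real.sSup_nonneg (by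
    rintro r ⟨t, _, x, rfl⟩
    exact abs_nonneg _)
  have hF : ∀ k, 0 ≤ ∑ j ∈ Finset.Icc 1 k,
      SVV.fluxNorm f (SVV.supNormDT T u) j * SVV.supNormDT T u ^ (j - 1) := fun k =>
    Finset.sum_nonneg fun j _ => mul_nonneg (SVV.fluxNorm_nonneg _ _ _) (pow_nonneg hM _)
  have hK : ∀ k (hk : k ∈ Finset.Icc 1 (s + 1)), _ := fun k hk =>
    SVV.derivNorm_comp_le_compositionConst (mul_nonneg (hCK0 k (Finset.mem_Icc.1 hk).1) (hF k))
      (hcomp k hk)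
  refine ⟨fun k hk => ⟨(hK k hk).1, (hK k hk).2.trans ?_⟩, fun hlt => ?_⟩
  · exact mul_le_mul_of_nonneg_right
      (Finset.single_le_sum (f := fun k : Finset.Icc 1 (s + 1) => CK k (Finset.mem_Icc.1 k.2).1)
        (fun k _ => hCK0 k _) (Finset.mem_attach _ ⟨k, hk⟩)) (hF k)
  -- The lower bound imposed on the amplitude is nonnegative, so it provides the positivity needed
  -- for the energy system.
  · have hε : 0 < ε N := lt_of_le_of_lt
      (div_nonneg (mul_nonneg (by positivity) (SVV.compositionConst_nonneg _ _ _ _))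
        (Nat.cast_nonneg N)) hlt
    obtain ⟨c, hsys⟩ := hu.exists_energySystem hT hμ hε (abs_nonneg B) (hA N hN hε.le) (hQ N hN)
    have h0T : (0 : ℝ) ∈ Icc 0 T := ⟨le_rfl, hT.le⟩
    refine hC N (ε N) f u c (SVV.compositionConst T f u) hsys (he N) ?_ (hfk s (Nat.le_succ s))
      (fun k => SVV.compositionConst_nonneg _ _ _ _) fun k hk => (hK k (Finset.mem_Icc.2
        ⟨(Finset.mem_Icc.1 hk).1, (Finset.mem_Icc.1 hk).2.trans (Nat.le_succ s)⟩)).1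
    have hinit : SVV.IsTrigPoly N (SVV.fourierCoefficient fun y => (u₀ y : ℂ)) (u 0) := hu.initial
    refine le_trans (le_of_eq ?_) (SVV.sum_norm_sq_fourierCoefficient_le (N := N) hu₀)
    rw [hsys.energy_zero_eq h0T, hinit.integral_sq, SVV.energy]
    simp only [SVV.sobWeight_zero, one_mul]
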